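/- Let $\Phi$ be a stationary random measure on $\mathbb{R}^d$ (i.e. $\Phi(\cdot+x)\overset{d}{=}\Phi$ for all $x\in\mathbb{R}^d$) which is square-integrable, that is, $\mathbb{E}\,\Phi(B)^2<\infty$ for all bounded Borel sets $B$. Let $\gamma=\mathbb{E}\,\Phi([0,1]^d)$ be its intensity, $$\alpha_\Phi(B)=\mathbb{E}\int \mathbf 1\{x\in[0,1]^d,\ y-x\in B\}\,\Phi^2(d(x,y))$$ its reduced second moment measure, and $\beta_\Phi=\alpha_\Phi-\gamma^2\lambda_d$ its covariance measure, a signed measure on the bounded Borel sets with total variation $|\beta_\Phi|$, where $\lambda_d$ is Lebesgue measure. Let $Z=\{Z(x):x\in\mathbb{R}^d\}$ be a stationary $\mathbb{R}^d$-valued random field with càdlàg paths (at each point the limits from all $2^d$ quadrants exist, and the path is continuous from the upper quadrant), independent of $\Phi$. Assume that $$\int \big\|\mathbb{P}\big((Z(y),Z(0))\in\cdot\big)-\mathbb{P}(Z(0)\in\cdot)^{\otimes 2}\big\|\,\alpha_\Phi(dy)<\infty,$$ where $\|\nu\|=\sup\{|\int f\,d\nu| : f \text{ measurable with values in } [-1,1]\}$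 is the total variation norm. Then $$\Gamma:=\int \mathbf 1\{x+Z(x)\in\cdot\}\,\Phi(dx)$$ is (almost surely) a stationary square-integrable random measure, and the following holds for every bounded convex Borel set $W\subset\mathbb{R}^d$ containing $0$ in its interior. For $\Psi\in\{\Phi,\Gamma\}$, the asymptotic variance of $\Psi$ with respect to $W$ is $\lim_{r\to\infty}\lambda_d(rW)^{-1}\operatorname{Var}[\Psi(rW)]\in[0,\infty]$ if this limit exists, and $\Psi$ is called hyperuniform with respect to $W$ if the limit exists and equals $0$. 1. If $\Phi$ is hyperuniform with respect to $W$, then so is $\Gamma$. 2. If $W$ is Fourier smooth, that is, $\big|\int_W e^{-i\langle k,x\rangle}\,dx\big|\le c(1+\|k\|)^{-(d+\vartheta)/2}$ for all $k\in\mathbb{R}^d$ and some $c,\vartheta>0$, or if $|\beta_\Phi|(\mathbb{R}^d)<\infty$, then $\Phi$ and $\Gamma$ have the same asymptotic variance with respect to $W$, provided one of these asymptotic variances exists. -/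

import Mathlib

open MeasureTheory ProbabilityTheory Filter Topology
open scoped ENNReal Pointwise

/-- The Euclidean space `ℝ^d`. -/
abbrev Space (d : ℕ) : Type := EuclideanSpace ℝ (Fin d)

/-- The unit cube `[0,1]^d`. -/
def unitCube (d : ℕ) : Set (Space d) := {x | ∀ i, x i ∈ Set.Icc (0 : ℝ) 1}

section RandomMeasures

variable {Ω : Type*} [MeasurableSpace Ω] {d : ℕ}

/-- A random measure on `ℝ^d`: a random element of the space of locally finite measures, with the
σ-field generated by the evaluations `φ ↦ φ B` (this is the σ-field carried by `Measure`). As usual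
it only matters up to a null event. -/
structure IsRandomMeasure (P : Measure Ω) (Φ : Ω → Measure (Space d)) : Prop where
  aemeasurable : AEMeasurable Φ P
  ae_locallyFinite : ∀ᵐ ω ∂P, IsLocallyFiniteMeasure (Φ ω)

/-- The shift `θ_x φ = φ(· + x)` of a measure. -/
noncomputable def shiftMeasure (x : Space d) (φ : Measure (Space d)) : Measure (Space d) :=
  φ.map (fun y => y - x)

/-- Stationarity: `θ_x Φ` has the same distribution as `Φ`, for each `x`. -/
def IsStationaryMeasure (P : Measure Ω) (Φ : Ω → Measure (Space d)) : Prop :=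
  ∀ x : Space d, IdentDistrib (fun ω => shiftMeasure x (Φ ω)) Φ P P

/-- (Local) square-integrability: `E Φ(B)² < ∞` for all bounded Borel sets `B`. -/
def IsSquareIntegrable (P : Measure Ω) (Φ : Ω → Measure (Space d)) : Prop :=
  ∀ B : Set (Space d), Bornology.IsBounded B → MeasurableSet B → ∫⁻ ω, (Φ ω B) ^ 2 ∂P < ∞

/-- A stationary square-integrable random measure on `ℝ^d`. -/
structure IsStationarySqRandomMeasure (P : Measure Ω) (Φ : Ω → Measure (Space d)) : Prop where
  isRandomMeasure : IsRandomMeasure P Φ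
  stationary : IsStationaryMeasure P Φ
  squareIntegrable : IsSquareIntegrable P Φ

/-- The intensity `γ = E Φ([0,1]^d)`. -/
noncomputable def intensity (P : Measure Ω) (Φ : Ω → Measure (Space d)) : ℝ :=
  (∫⁻ ω, Φ ω (unitCube d) ∂P).toReal

/-- The reduced second moment measure
`α_Φ(B) = E ∫ 1{x ∈ [0,1]^d, y - x ∈ B} Φ²(d(x,y))`. -/
noncomputable def reducedSecondMoment (P : Measure Ω) (Φ : Ω → Measure (Space d)) :
    Measure (Space d) :=
  P.bind (fun ω => (((Φ ω).prod (Φ ω)).restrict {p | p.1 ∈ unitCube d}).map (fun p => p.2 - p.1))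

/-- The covariance measure `β_Φ = α_Φ - γ² λ_d`, a signed measure on the bounded Borel sets
(only its values on these sets are meaningful). -/
noncomputable def covarianceMeasure (P : Measure Ω) (Φ : Ω → Measure (Space d))
    (B : Set (Space d)) : ℝ :=
  (reducedSecondMoment P Φ B).toReal - intensity P Φ ^ 2 * (volume B).toReal

/-- The total variation `|β_Φ|(ℝ^d)` of the covariance measure: the supremum of `∑ |β_Φ(B)|` over
all finite families of pairwise disjoint bounded Borel sets. -/
noncomputable def covarianceTotalVariation (P : Measure Ω) (Φ : Ω → Measure (Space d)) : ℝ≥0∞ :=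
  ⨆ (F : Finset (Set (Space d))) (_ : ∀ B ∈ F, Bornology.IsBounded B ∧ MeasurableSet B)
    (_ : (F : Set (Set (Space d))).PairwiseDisjoint id),
    ∑ B ∈ F, ENNReal.ofReal |covarianceMeasure P Φ B|

/-- The class `𝒦₀` of bounded convex (Borel) sets containing `0` in their interior. -/
structure IsWindow (W : Set (Space d)) : Prop where
  convex : Convex ℝ W
  isBounded : Bornology.IsBounded W
  zero_mem_interior : (0 : Space d) ∈ interior W
  measurableSet : MeasurableSet W

/-- `W` is Fourier smooth: `|∫_W e^{-i⟨k,x⟩} dx| ≤ c (1 + ‖k‖)^{-(d+ϑ)/2}` for all `k`, for some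
constants `c, ϑ > 0`. -/
def IsFourierSmooth (W : Set (Space d)) : Prop :=
  ∃ c ϑ : ℝ, 0 < c ∧ 0 < ϑ ∧ ∀ k : Space d,
    ‖∫ x in W, Complex.exp (-Complex.I * ((inner ℝ k x : ℝ) : ℂ))‖
      ≤ c * (1 + ‖k‖) ^ (-((d : ℝ) + ϑ) / 2)

/-- `v ∈ [0,∞]` is the asymptotic variance of `Φ` with respect to `W`:
`λ_d(rW)⁻¹ Var[Φ(rW)] → v` as `r → ∞`. -/
def HasAsymptoticVariance (P : Measure Ω) (Φ : Ω → Measure (Space d)) (W : Set (Space d))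
    (v : ℝ≥0∞) : Prop :=
  Tendsto (fun r : ℝ => (volume (r • W))⁻¹ * evariance (fun ω => (Φ ω (r • W)).toReal) P)
    atTop (𝓝 v)

/-- `Φ` is hyperuniform with respect to `W`: it is a stationary square-integrable random measure
and its asymptotic variance with respect to `W` exists and vanishes. -/
structure IsHyperuniform (P : Measure Ω) (Φ : Ω → Measure (Space d)) (W : Set (Space d)) :
    Prop where
  isStationarySq : IsStationarySqRandomMeasure P Φ
  asymptoticVariance_zero : HasAsymptoticVariance P Φ W 0

end RandomMeasures

section Displacements

variable {Ω : Type*} [MeasurableSpace Ω] {d : ℕ}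

/-- Càdlàg functions of several variables: at each `x` the limit of `w` exists within each of the
`2^d` quadrants at `x` (the coordinates in `I` approach strictly from below, the others from above,
including equality), and `w` is continuous at `x` within the upper quadrant. -/
def IsCadlag (w : Space d → Space d) : Prop :=
  ∀ x : Space d,
    (∀ I : Set (Fin d), ∃ l : Space d,
      Tendsto w (𝓝[{y | ∀ i, (i ∈ I → y i < x i) ∧ (i ∉ I → x i ≤ y i)}] x) (𝓝 l)) ∧
    ContinuousWithinAt w {y | ∀ i, x i ≤ y i} x

/-- A stationary random element of the space of càdlàg functions `ℝ^d → ℝ^d`; the σ-field on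
functions is the one generated by the evaluations `w ↦ w x` (the product σ-field). -/
structure IsStationaryCadlagField (P : Measure Ω) (Z : Ω → Space d → Space d) : Prop where
  measurable : Measurable Z
  cadlag : ∀ ω, IsCadlag (Z ω)
  stationary : ∀ s : Space d, IdentDistrib (fun ω x => Z ω (x + s)) Z P P

/-- The displaced random measure `Γ = ∫ 1{x + Z(x) ∈ ·} Φ(dx)`. -/
noncomputable def displaced (Φ : Ω → Measure (Space d)) (Z : Ω → Space d → Space d) :
    Ω → Measure (Space d) :=
  fun ω => (Φ ω).map (fun x => x + Z ω x)

/-- The total variation norm `‖μ - ν‖ = sup |∫ f dμ - ∫ f dν|` of the difference of two finite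
measures, the supremum being over all measurable `f` with values in `[-1,1]`. -/
noncomputable def tvNormSub {X : Type*} [MeasurableSpace X] (μ ν : Measure X) : ℝ≥0∞ :=
  ⨆ (f : X → ℝ) (_ : Measurable f) (_ : ∀ x, f x ∈ Set.Icc (-1 : ℝ) 1),
    ENNReal.ofReal |∫ x, f x ∂μ - ∫ x, f x ∂ν|

/-- The mixing coefficient `‖P((Z(y),Z(0)) ∈ ·) - P(Z(0) ∈ ·)^{⊗2}‖`. -/
noncomputable def mixingCoeff (P : Measure Ω) (Z : Ω → Space d → Space d) (y : Space d) : ℝ≥0∞ :=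
  tvNormSub (P.map (fun ω => (Z ω y, Z ω 0)))
    ((P.map (fun ω => Z ω 0)).prod (P.map (fun ω => Z ω 0)))

end Displacements

section Regularization

variable {d : ℕ}

/-- The shell of points whose norm has integer part `n`. -/
def normShell (d n : ℕ) : Set (Space d) := {x | ⌊‖x‖⌋₊ = n}

lemma measurableSet_normShell (d n : ℕ) : MeasurableSet (normShell d n) :=
  (Nat.measurable_floor.comp measurable_norm) (measurableSet_singleton n)

/-- The measures whose mass on the shell `n` is finite with integer part `m`. -/
def massLevel (d n m : ℕ) : Set (Measure (Space d)) :=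
  {φ | φ (normShell d n) < ∞ ∧ ⌊(φ (normShell d n)).toReal⌋₊ = m}

lemma measurableSet_massLevel (d n m : ℕ) : MeasurableSet (massLevel d n m) := by
  have h := Measure.measurable_coe (measurableSet_normShell d n)
  exact (measurableSet_lt h measurable_const).inter
    ((Nat.measurable_floor.comp h.ennreal_toReal) (measurableSet_singleton m))

open Classical in
/-- The part of a measure living on the shell `n`, provided its mass has integer part `m`. -/
noncomputable def shellKernel (d n m : ℕ) : Kernel (Measure (Space d)) (Space d) :=
  Kernel.piecewise (measurableSet_massLevel d n m)
    (Kernel.restrict ⟨id, measurable_id⟩ (measurableSet_normShell d n)) 0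

instance (d n m : ℕ) : IsFiniteKernel (shellKernel d n m) := by
  refine ⟨(m : ℝ≥0∞) + 1, by simp [lt_top_iff_ne_top], fun φ => ?_⟩
  classical
  rw [shellKernel, Kernel.piecewise_apply]
  split_ifs with h
  · rw [Kernel.restrict_apply, Measure.restrict_apply MeasurableSet.univ, Set.univ_inter]
    change φ (normShell d n) ≤ _
    obtain ⟨h1, h2⟩ := h
    rw [← ENNReal.ofReal_toReal h1.ne]
    have := (Nat.lt_floor_add_one (φ (normShell d n)).toReal).le
    rw [h2] at this
    refine (ENNReal.ofReal_le_ofReal this).trans ?_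
    rw [ENNReal.ofReal_add (by positivity) (by norm_num)]
    simp
  · simp

/-- An s-finite kernel that returns every locally finite measure unchanged. -/
noncomputable def locKernel (d : ℕ) : Kernel (Measure (Space d)) (Space d) :=
  Kernel.sum fun p : ℕ × ℕ => shellKernel d p.1 p.2

instance (d : ℕ) : IsSFiniteKernel (locKernel d) := by
  unfold locKernel; infer_instance

lemma locKernel_apply (φ : Measure (Space d)) [IsLocallyFiniteMeasure φ] :
    locKernel d φ = φ := by
  classical
  have hfin : ∀ n, φ (normShell d n) < ∞ := fun n => by
    refine lt_of_le_of_lt (measure_mono (t := Metric.closedBall 0 (n + 1)) fun x hx => ?_)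
      (isCompact_closedBall (0 : Space d) (n + 1)).measure_lt_top
    have := (Nat.lt_floor_add_one ‖x‖).le
    rw [show ⌊‖x‖⌋₊ = n from hx] at this
    simpa using this
  ext B hB
  have h1 : ∀ n m, shellKernel d n m φ B =
      if m = ⌊(φ (normShell d n)).toReal⌋₊ then φ (B ∩ normShell d n) else 0 := fun n m => by
    rw [shellKernel, Kernel.piecewise_apply]
    by_cases h : m = ⌊(φ (normShell d n)).toReal⌋₊
    · rw [if_pos ⟨hfin n, h.symm⟩, if_pos h, Kernel.restrict_apply' _ _ _ hB]
      rfl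
    · rw [if_neg (fun h' => h h'.2.symm), if_neg h]
      simp
  rw [locKernel, Kernel.sum_apply' _ _ hB, ENNReal.tsum_prod']
  simp only [h1, tsum_ite_eq]
  rw [← measure_iUnion]
  · congr 1
    ext x
    simp [normShell]
  · intro i j hij
    refine Set.disjoint_left.2 fun x hx hx' => hij ?_
    exact hx.2.symm.trans hx'.2
  · exact fun n => hB.inter (measurableSet_normShell d n)

/-- The point of the lattice with mesh `1 / (n + 1)` that lies next to `x` in its upper quadrant. -/
noncomputable def upperPoint (n : ℕ) (x : Space d) : Space d :=
  WithLp.toLp 2 fun i => (⌈(n + 1 : ℝ) * x i⌉ : ℝ) / (n + 1)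

lemma le_upperPoint (n : ℕ) (x : Space d) (i : Fin d) : x i ≤ upperPoint n x i := by
  simp only [upperPoint]
  rw [le_div_iff₀ (by positivity), mul_comm]
  exact Int.le_ceil _

lemma tendsto_upperPoint (x : Space d) : Tendsto (fun n => upperPoint n x) atTop (𝓝 x) := by
  refine tendsto_iff_norm_sub_tendsto_zero.2 ?_
  have h : ∀ i, Tendsto (fun n : ℕ => upperPoint n x i) atTop (𝓝 (x i)) := fun i => by
    have h0 : Tendsto (fun n : ℕ => x i + 1 / ((n : ℝ) + 1)) atTop (𝓝 (x i + 0)) :=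
      tendsto_const_nhds.add tendsto_one_div_add_atTop_nhds_zero_nat
    rw [add_zero] at h0
    refine tendsto_of_tendsto_of_tendsto_of_le_of_le tendsto_const_nhds h0
      (fun n => le_upperPoint n x i) fun n => ?_
    simp only [upperPoint]
    have hn : (0 : ℝ) < n + 1 := by positivity
    rw [div_le_iff₀ hn, add_mul (x i), one_div, inv_mul_cancel₀ hn.ne', mul_comm (x i)]
    exact (Int.ceil_lt_add_one _).le
  have h2 : Tendsto (fun n => WithLp.ofLp (upperPoint n x)) atTop (𝓝 (WithLp.ofLp x)) :=
    tendsto_pi_nhds.2 h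
  have h3 := ((PiLp.continuous_toLp 2 _).tendsto _).comp h2
  exact tendsto_iff_norm_sub_tendsto_zero.1 h3

/-- A jointly measurable evaluation map, which agrees with `(z, x) ↦ z x` for càdlàg `z`. -/
noncomputable def regEval (p : (Space d → Space d) × Space d) : Space d :=
  WithLp.toLp 2 fun i => limsup (fun n => p.1 (upperPoint n p.2) i) atTop

lemma measurable_regEval : Measurable (regEval (d := d)) := by
  refine (PiLp.continuous_toLp 2 _).measurable.comp (measurable_pi_lambda _ fun i => ?_)
  refine Measurable.limsup fun n => ?_
  have h1 : Measurable fun q : (Space d → Space d) × (Fin d → ℤ) =>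
      q.1 (WithLp.toLp 2 fun i => (q.2 i : ℝ) / (n + 1)) i := by
    refine measurable_from_prod_countable_left fun c => ?_
    have h0 : Measurable fun z : Space d → Space d =>
        z (WithLp.toLp 2 fun i => (c i : ℝ) / (n + 1)) := measurable_pi_apply _
    exact (measurable_pi_apply i).comp ((PiLp.continuous_ofLp 2 _).measurable.comp h0)
  have h2 : Measurable fun p : (Space d → Space d) × Space d =>
      (p.1, fun i => ⌈(n + 1 : ℝ) * p.2 i⌉) := by
    refine measurable_fst.prodMk (measurable_pi_lambda _ fun i => ?_)
    refine Int.measurable_ceil.comp (measurable_const.mul ?_)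
    exact (measurable_pi_apply i).comp ((PiLp.continuous_ofLp 2 _).measurable.comp measurable_snd)
  exact h1.comp h2

lemma IsCadlag.regEval_eq {w : Space d → Space d} (hw : IsCadlag w) (x : Space d) :
    regEval (w, x) = w x := by
  have h : Tendsto (fun n => w (upperPoint n x)) atTop (𝓝 (w x)) :=
    (hw x).2.tendsto.comp (tendsto_nhdsWithin_iff.2
      ⟨tendsto_upperPoint x, Eventually.of_forall fun n i => le_upperPoint n x i⟩)
  ext i
  exact ((((PiLp.continuous_ofLp 2 _).tendsto _).comp h).apply_nhds i).limsup_eq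

lemma IsCadlag.measurable {w : Space d → Space d} (hw : IsCadlag w) : Measurable w := by
  have : w = fun x => regEval (w, x) := funext fun x => (hw.regEval_eq x).symm
  rw [this]
  exact measurable_regEval.comp measurable_prodMk_left

lemma IsCadlag.comp_add {w : Space d → Space d} (hw : IsCadlag w) (s : Space d) :
    IsCadlag fun x => w (x + s) := by
  have key : ∀ (p : (Fin d → ℝ) → (Fin d → ℝ) → Prop)
      (_ : ∀ a b c : Fin d → ℝ, p a b → p (fun i => a i + c i) (fun i => b i + c i)) (x : Space d),
      Tendsto (fun y => y + s) (𝓝[{y | p y.ofLp x.ofLp}] x)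
        (𝓝[{y | p y.ofLp (x + s).ofLp}] (x + s)) := by
    intro p hp x
    refine tendsto_nhdsWithin_iff.2 ⟨?_, ?_⟩
    · exact (((continuous_id.add continuous_const).tendsto x).mono_left nhdsWithin_le_nhds)
    · filter_upwards [self_mem_nhdsWithin] with y hy
      exact hp _ _ s.ofLp hy
  intro x
  refine ⟨fun I => ?_, ?_⟩
  · obtain ⟨l, hl⟩ := (hw (x + s)).1 I
    refine ⟨l, hl.comp (key (fun a b => ∀ i, (i ∈ I → a i < b i) ∧ (i ∉ I → b i ≤ a i)) ?_ x)⟩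
    intro a b c h i
    exact ⟨fun hi => by simpa using (h i).1 hi, fun hi => by simpa using (h i).2 hi⟩
  · refine ((hw (x + s)).2.tendsto).comp (key (fun a b => ∀ i, b i ≤ a i) ?_ x)
    intro a b c h i
    simpa using h i

/-- The displaced measure as a measurable functional of the measure and the field. -/
noncomputable def displaceMap (p : Measure (Space d) × (Space d → Space d)) : Measure (Space d) :=
  (locKernel d p.1).map fun x => x + regEval (p.2, x)

lemma measurable_displace (z : Space d → Space d) :
    Measurable fun x => x + regEval (z, x) :=
  measurable_id.add (measurable_regEval.comp measurable_prodMk_left)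

lemma measurable_displaceMap : Measurable (displaceMap (d := d)) := by
  refine Measure.measurable_of_measurable_coe _ fun B hB => ?_
  have hS : MeasurableSet {q : (Measure (Space d) × (Space d → Space d)) × Space d |
      q.2 + regEval (q.1.2, q.2) ∈ B} :=
    (measurable_snd.add (measurable_regEval.comp
      (measurable_fst.snd.prodMk measurable_snd))) hB
  have h := Kernel.measurable_kernel_prodMk_left (κ := Kernel.comap (locKernel d)
    (Prod.fst : Measure (Space d) × (Space d → Space d) → Measure (Space d)) measurable_fst) hS
  convert h using 2 with p
  rw [displaceMap, Measure.map_apply (measurable_displace p.2) hB]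
  rfl

lemma displaced_eq_displaceMap {Φ : Measure (Space d)} [IsLocallyFiniteMeasure Φ]
    {z : Space d → Space d} (hz : IsCadlag z) :
    Φ.map (fun x => x + z x) = displaceMap (Φ, z) := by
  simp only [displaceMap, locKernel_apply, hz.regEval_eq]

lemma measurable_shiftMeasure (s : Space d) : Measurable (shiftMeasure s) :=
  Measure.measurable_map _ (measurable_id.sub_const s)

instance isLocallyFiniteMeasure_shiftMeasure (s : Space d) (φ : Measure (Space d))
    [IsLocallyFiniteMeasure φ] : IsLocallyFiniteMeasure (shiftMeasure s φ) := by
  refine ⟨fun x => ?_⟩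
  obtain ⟨U, hU, hUo, hfin⟩ := φ.exists_isOpen_measure_lt_top (x + s)
  have hm : Measurable fun y : Space d => y - s := measurable_id.sub_const s
  have hV : IsOpen ((fun y : Space d => y + s) ⁻¹' U) := hUo.preimage (by fun_prop)
  refine ⟨_, hV.mem_nhds hU, ?_⟩
  rw [shiftMeasure, Measure.map_apply hm hV.measurableSet]
  simpa [Set.preimage_preimage] using hfin

lemma shiftMeasure_displaceMap {φ : Measure (Space d)} [IsLocallyFiniteMeasure φ]
    {z : Space d → Space d} (hz : IsCadlag z) (s : Space d) :
    shiftMeasure s (displaceMap (φ, z)) = displaceMap (shiftMeasure s φ, fun x => z (x + s)) := by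
  have h1 : Measurable fun y : Space d => y - s := measurable_id.sub_const s
  have h2 : Measurable fun y : Space d => y + z y := measurable_id.add hz.measurable
  have h3 : Measurable fun y : Space d => y + z (y + s) :=
    measurable_id.add (hz.comp_add s).measurable
  rw [← displaced_eq_displaceMap hz, ← displaced_eq_displaceMap (hz.comp_add s), shiftMeasure,
    shiftMeasure, Measure.map_map h1 h2, Measure.map_map h3 h1]
  congr 1
  ext1 x
  simp
  abel

variable {Ω : Type*} [MeasurableSpace Ω] {P : Measure Ω} {Φ : Ω → Measure (Space d)}
  {Z : Ω → Space d → Space d}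

lemma displaced_ae_eq (hΦ : IsRandomMeasure P Φ) (hZ : IsStationaryCadlagField P Z) :
    displaced Φ Z =ᵐ[P] fun ω => displaceMap (Φ ω, Z ω) := by
  filter_upwards [hΦ.ae_locallyFinite] with ω hω
  exact displaced_eq_displaceMap (hZ.cadlag ω)

lemma aemeasurable_displaced (hΦ : IsRandomMeasure P Φ) (hZ : IsStationaryCadlagField P Z) :
    AEMeasurable (displaced Φ Z) P :=
  (measurable_displaceMap.comp_aemeasurable
    (hΦ.aemeasurable.prodMk hZ.measurable.aemeasurable)).congr (displaced_ae_eq hΦ hZ).symm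

lemma isStationaryMeasure_displaced [IsFiniteMeasure P] (hΦ : IsRandomMeasure P Φ)
    (hΦs : IsStationaryMeasure P Φ) (hZ : IsStationaryCadlagField P Z) (hindep : IndepFun Φ Z P) :
    IsStationaryMeasure P (displaced Φ Z) := by
  intro s
  have hshift : Measurable fun (z : Space d → Space d) x => z (x + s) :=
    measurable_pi_lambda _ fun x => measurable_pi_apply _
  have hid := ((hΦs s).prodMk (hZ.stationary s)
    (hindep.comp (measurable_shiftMeasure s) hshift) hindep).comp measurable_displaceMap
  refine ⟨(measurable_shiftMeasure s).comp_aemeasurable (aemeasurable_displaced hΦ hZ),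
    aemeasurable_displaced hΦ hZ, ?_⟩
  rw [Measure.map_congr (displaced_ae_eq hΦ hZ)]
  refine Eq.trans (Measure.map_congr ?_) hid.map_eq
  filter_upwards [hΦ.ae_locallyFinite, displaced_ae_eq hΦ hZ] with ω hω h
  rw [h, shiftMeasure_displaceMap (hZ.cadlag ω)]
  rfl

end Regularization

section UnitCube

variable {d : ℕ}

lemma isClosed_unitCube (d : ℕ) : IsClosed (unitCube d) := by
  have : unitCube d = ⋂ i, (fun x : Space d => x i) ⁻¹' Set.Icc 0 1 := by
    ext x; simp [unitCube]
  rw [this]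
  exact isClosed_iInter fun i => isClosed_Icc.preimage (by fun_prop)

lemma unitCube_eq_preimage (d : ℕ) :
    unitCube d = WithLp.ofLp ⁻¹' (Set.univ.pi fun _ : Fin d => Set.Icc (0 : ℝ) 1) := by
  ext x; simp [unitCube, Pi.le_def, forall_and]

lemma volume_unitCube (d : ℕ) : volume (unitCube d) = 1 := by
  rw [unitCube_eq_preimage, (PiLp.volume_preserving_ofLp (Fin d)).measure_preimage
    (MeasurableSet.univ_pi fun _ => measurableSet_Icc).nullMeasurableSet, volume_pi_pi]
  simp

lemma unitCube_subset_closedBall (d : ℕ) : unitCube d ⊆ Metric.closedBall 0 (√d) := by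
  intro x hx
  rw [mem_closedBall_zero_iff, EuclideanSpace.norm_eq]
  refine Real.sqrt_le_sqrt ?_
  calc ∑ i, ‖x i‖ ^ 2 ≤ ∑ _i : Fin d, (1 : ℝ) := Finset.sum_le_sum fun i _ => by
        have := hx i
        rw [Real.norm_eq_abs, sq_abs]
        nlinarith [this.1, this.2]
    _ = d := by simp

end UnitCube

section Campbell

variable {Ω : Type*} [MeasurableSpace Ω] {d : ℕ} {P : Measure Ω} {Φ : Ω → Measure (Space d)}

/-- A version of a random measure that is an s-finite kernel. -/
noncomputable def IsRandomMeasure.version (hΦ : IsRandomMeasure P Φ) : Kernel Ω (Space d) :=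
  (locKernel d).comap (hΦ.aemeasurable.mk Φ) hΦ.aemeasurable.measurable_mk

instance (hΦ : IsRandomMeasure P Φ) : IsSFiniteKernel hΦ.version := by
  unfold IsRandomMeasure.version; infer_instance

lemma IsRandomMeasure.version_ae_eq (hΦ : IsRandomMeasure P Φ) :
    ∀ᵐ ω ∂P, hΦ.version ω = Φ ω := by
  filter_upwards [hΦ.ae_locallyFinite, hΦ.aemeasurable.ae_eq_mk] with ω h1 h2
  rw [version, Kernel.comap_apply, ← h2, locKernel_apply]

lemma IsStationaryMeasure.lintegral_comp_shift (hΦ : IsStationaryMeasure P Φ)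
    {H : Measure (Space d) → ℝ≥0∞} (hH : Measurable H) (s : Space d) :
    ∫⁻ ω, H (shiftMeasure s (Φ ω)) ∂P = ∫⁻ ω, H (Φ ω) ∂P :=
  ((hΦ s).comp hH).lintegral_eq

lemma IsStationaryMeasure.lintegral_preimage_sub (hΦ : IsStationaryMeasure P Φ)
    {B : Set (Space d)} (hB : MeasurableSet B) (s : Space d) {g : ℝ≥0∞ → ℝ≥0∞}
    (hg : Measurable g) :
    ∫⁻ ω, g (Φ ω ((fun x => x - s) ⁻¹' B)) ∂P = ∫⁻ ω, g (Φ ω B) ∂P := by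
  rw [← hΦ.lintegral_comp_shift (H := fun φ => g (φ B)) (hg.comp (Measure.measurable_coe hB)) s]
  simp only [shiftMeasure]
  refine lintegral_congr fun ω => ?_
  have hs : Measurable fun x : Space d => x - s := measurable_id.sub_const s
  rw [Measure.map_apply hs hB]

/-- The mean measure of a random measure. -/
noncomputable def IsRandomMeasure.mean (hΦ : IsRandomMeasure P Φ) : Measure (Space d) :=
  P.bind hΦ.version

lemma IsRandomMeasure.lintegral_mean (hΦ : IsRandomMeasure P Φ) {f : Space d → ℝ≥0∞}
    (hf : Measurable f) : ∫⁻ x, f x ∂hΦ.mean = ∫⁻ ω, ∫⁻ x, f x ∂Φ ω ∂P := by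
  rw [mean, Measure.lintegral_bind (Kernel.aemeasurable _) hf.aemeasurable]
  refine lintegral_congr_ae ?_
  filter_upwards [hΦ.version_ae_eq] with ω h
  rw [h]

lemma IsRandomMeasure.mean_apply (hΦ : IsRandomMeasure P Φ) {B : Set (Space d)}
    (hB : MeasurableSet B) : hΦ.mean B = ∫⁻ ω, Φ ω B ∂P := by
  rw [← lintegral_indicator_one hB, hΦ.lintegral_mean (measurable_one.indicator hB)]
  simp [lintegral_indicator_one hB]

lemma IsSquareIntegrable.lintegral_lt_top [IsFiniteMeasure P] (h : IsSquareIntegrable P Φ)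
    {B : Set (Space d)} (hb : Bornology.IsBounded B) (hB : MeasurableSet B) :
    ∫⁻ ω, Φ ω B ∂P < ∞ := by
  have h1 : ∀ a : ℝ≥0∞, a ≤ 1 + a ^ 2 := fun a => by
    rcases le_total a 1 with ha | ha
    · exact ha.trans le_self_add
    · calc a = a * 1 := (mul_one a).symm
        _ ≤ a * a := by gcongr
        _ ≤ 1 + a ^ 2 := by rw [sq]; exact le_add_self
  calc ∫⁻ ω, Φ ω B ∂P ≤ ∫⁻ ω, 1 + (Φ ω B) ^ 2 ∂P := lintegral_mono fun ω => h1 _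
    _ = P Set.univ + ∫⁻ ω, (Φ ω B) ^ 2 ∂P := by rw [lintegral_add_left measurable_const]; simp
    _ < ∞ := ENNReal.add_lt_top.2 ⟨measure_lt_top _ _, h B hb hB⟩

lemma isBounded_unitCube (d : ℕ) : Bornology.IsBounded (unitCube d) :=
  Metric.isBounded_closedBall.subset (unitCube_subset_closedBall d)

lemma ofReal_intensity [IsFiniteMeasure P] (h : IsSquareIntegrable P Φ) :
    ENNReal.ofReal (intensity P Φ) = ∫⁻ ω, Φ ω (unitCube d) ∂P :=
  ENNReal.ofReal_toReal
    (h.lintegral_lt_top (isBounded_unitCube d) (isClosed_unitCube d).measurableSet).ne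

lemma intensity_nonneg : 0 ≤ intensity P Φ := ENNReal.toReal_nonneg

/-- A translation invariant locally finite measure is a multiple of Lebesgue measure. -/
lemma eq_smul_volume_of_invariant (m : Measure (Space d)) [IsFiniteMeasureOnCompacts m]
    (h : ∀ s B, MeasurableSet B → m ((fun x => x - s) ⁻¹' B) = m B) :
    m = m (unitCube d) • volume := by
  have : m.IsAddLeftInvariant := ⟨fun s => by
    ext B hB
    rw [Measure.map_apply (measurable_const_add s) hB, ← h (-s) B hB]
    congr 1
    ext x
    simp [add_comm]⟩
  have h2 := Measure.isAddLeftInvariant_eq_smul m volume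
  have h3 : m (unitCube d) = Measure.addHaarScalarFactor m volume := by
    conv_lhs => rw [h2]
    simp [volume_unitCube]
  rw [h3]
  exact h2

lemma IsStationarySqRandomMeasure.mean_eq [IsFiniteMeasure P]
    (hΦ : IsStationarySqRandomMeasure P Φ) :
    hΦ.isRandomMeasure.mean = ENNReal.ofReal (intensity P Φ) • volume := by
  have : IsFiniteMeasureOnCompacts hΦ.isRandomMeasure.mean := ⟨fun K hK => by
    rw [IsRandomMeasure.mean_apply _ hK.measurableSet]
    exact hΦ.squareIntegrable.lintegral_lt_top hK.isBounded hK.measurableSet⟩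
  rw [ofReal_intensity hΦ.squareIntegrable,
    ← hΦ.isRandomMeasure.mean_apply (isClosed_unitCube d).measurableSet]
  refine eq_smul_volume_of_invariant _ fun s B hB => ?_
  rw [IsRandomMeasure.mean_apply _ hB, IsRandomMeasure.mean_apply _ (hB.preimage (by fun_prop))]
  exact hΦ.stationary.lintegral_preimage_sub hB s (g := id) measurable_id

/-- Campbell's formula. -/
lemma IsStationarySqRandomMeasure.lintegral_lintegral [IsFiniteMeasure P]
    (hΦ : IsStationarySqRandomMeasure P Φ) {f : Space d → ℝ≥0∞} (hf : Measurable f) :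
    ∫⁻ ω, ∫⁻ x, f x ∂Φ ω ∂P = ENNReal.ofReal (intensity P Φ) * ∫⁻ x, f x := by
  rw [← IsRandomMeasure.lintegral_mean hΦ.isRandomMeasure hf, hΦ.mean_eq, lintegral_smul_measure]
  rfl

/-- The kernel `ω ↦ Φ ω ⊗ Φ ω`. -/
noncomputable def IsRandomMeasure.versionProd (hΦ : IsRandomMeasure P Φ) :
    Kernel Ω (Space d × Space d) := hΦ.version ×ₖ hΦ.version

instance (hΦ : IsRandomMeasure P Φ) : IsSFiniteKernel hΦ.versionProd := by
  unfold IsRandomMeasure.versionProd; infer_instance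

lemma IsRandomMeasure.versionProd_ae_eq (hΦ : IsRandomMeasure P Φ) :
    ∀ᵐ ω ∂P, hΦ.versionProd ω = (Φ ω).prod (Φ ω) := by
  filter_upwards [hΦ.version_ae_eq] with ω h
  rw [versionProd, Kernel.prod_apply, h]

/-- The second moment measure of a random measure. -/
noncomputable def IsRandomMeasure.secondMoment (hΦ : IsRandomMeasure P Φ) :
    Measure (Space d × Space d) := P.bind hΦ.versionProd

lemma IsRandomMeasure.lintegral_secondMoment (hΦ : IsRandomMeasure P Φ)
    {F : Space d × Space d → ℝ≥0∞} (hF : Measurable F) :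
    ∫⁻ p, F p ∂hΦ.secondMoment = ∫⁻ ω, ∫⁻ p, F p ∂(Φ ω).prod (Φ ω) ∂P := by
  rw [secondMoment, Measure.lintegral_bind (Kernel.aemeasurable _) hF.aemeasurable]
  refine lintegral_congr_ae ?_
  filter_upwards [hΦ.versionProd_ae_eq] with ω h
  rw [h]

lemma IsRandomMeasure.secondMoment_apply (hΦ : IsRandomMeasure P Φ)
    {B : Set (Space d × Space d)} (hB : MeasurableSet B) :
    hΦ.secondMoment B = ∫⁻ ω, (Φ ω).prod (Φ ω) B ∂P := by
  rw [← lintegral_indicator_one hB, hΦ.lintegral_secondMoment (measurable_one.indicator hB)]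
  simp [lintegral_indicator_one hB]

lemma IsRandomMeasure.secondMoment_prod (hΦ : IsRandomMeasure P Φ)
    {A B : Set (Space d)} (hA : MeasurableSet A) (hB : MeasurableSet B) :
    hΦ.secondMoment (A ×ˢ B) = ∫⁻ ω, Φ ω A * Φ ω B ∂P := by
  rw [hΦ.secondMoment_apply (hA.prod hB)]
  refine lintegral_congr_ae ?_
  filter_upwards [hΦ.ae_locallyFinite] with ω h
  rw [Measure.prod_prod]

lemma IsRandomMeasure.reducedSecondMoment_apply (hΦ : IsRandomMeasure P Φ)
    {B : Set (Space d)} (hB : MeasurableSet B) :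
    reducedSecondMoment P Φ B =
      hΦ.secondMoment {p | p.1 ∈ unitCube d ∧ p.2 - p.1 ∈ B} := by
  have hc : MeasurableSet {p : Space d × Space d | p.1 ∈ unitCube d} :=
    measurable_fst (isClosed_unitCube d).measurableSet
  have hs : Measurable fun p : Space d × Space d => p.2 - p.1 := measurable_snd.sub measurable_fst
  have hae : (fun ω => (((Φ ω).prod (Φ ω)).restrict {p | p.1 ∈ unitCube d}).map
      (fun p => p.2 - p.1)) =ᵐ[P] ((hΦ.versionProd.restrict hc).map fun p => p.2 - p.1) := by
    filter_upwards [hΦ.versionProd_ae_eq] with ω h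
    rw [Kernel.map_apply _ hs, Kernel.restrict_apply, h]
  rw [reducedSecondMoment, Measure.bind_congr_right hae,
    Measure.bind_apply hB (Kernel.aemeasurable _)]
  refine Eq.trans ?_ (hΦ.secondMoment_apply (hc.inter (hs hB))).symm
  refine lintegral_congr_ae ?_
  filter_upwards [hΦ.versionProd_ae_eq] with ω h
  rw [Kernel.map_apply _ hs, Kernel.restrict_apply, h, Measure.map_apply hs hB,
    Measure.restrict_apply (hs hB), Set.inter_comm]

lemma IsStationarySqRandomMeasure.secondMoment_prod_lt_top
    (hΦ : IsStationarySqRandomMeasure P Φ) {A B : Set (Space d)}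
    (hA : Bornology.IsBounded A) (hB : Bornology.IsBounded B)
    (hAm : MeasurableSet A) (hBm : MeasurableSet B) :
    hΦ.isRandomMeasure.secondMoment (A ×ˢ B) < ∞ := by
  rw [IsRandomMeasure.secondMoment_prod _ hAm hBm]
  refine lt_of_le_of_lt (lintegral_mono fun ω => ?_)
    (hΦ.squareIntegrable _ (hA.union hB) (hAm.union hBm))
  rw [sq]
  gcongr
  · exact Set.subset_union_left
  · exact Set.subset_union_right

lemma IsStationarySqRandomMeasure.lintegral_secondMoment_sub
    (hΦ : IsStationarySqRandomMeasure P Φ) {F : Space d × Space d → ℝ≥0∞} (hF : Measurable F)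
    (s : Space d) :
    ∫⁻ p, F (p.1 - s, p.2 - s) ∂hΦ.isRandomMeasure.secondMoment =
      ∫⁻ p, F p ∂hΦ.isRandomMeasure.secondMoment := by
  have hs : Measurable fun p : Space d × Space d => (p.1 - s, p.2 - s) := by fun_prop
  have hs1 : Measurable fun p : Space d => p - s := by fun_prop
  rw [IsRandomMeasure.lintegral_secondMoment _ hF]
  refine (IsRandomMeasure.lintegral_secondMoment _ (hF.comp hs)).trans ?_
  have hH : Measurable fun φ : Measure (Space d) =>
      ∫⁻ p, F p ∂((locKernel d) ×ₖ (locKernel d)) φ := hF.lintegral_kernel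
  have h := hΦ.stationary.lintegral_comp_shift hH s
  refine Eq.trans (lintegral_congr_ae ?_) (h.trans (lintegral_congr_ae ?_))
  · filter_upwards [hΦ.isRandomMeasure.ae_locallyFinite] with ω hω
    rw [Kernel.prod_apply, locKernel_apply, shiftMeasure, Measure.map_prod_map _ _ hs1 hs1,
      lintegral_map hF (by fun_prop)]
    rfl
  · filter_upwards [hΦ.isRandomMeasure.ae_locallyFinite] with ω hω
    rw [Kernel.prod_apply, locKernel_apply]

/-- The second moment measure in the coordinates `(x, y - x)`. -/
noncomputable def IsRandomMeasure.diffMoment (hΦ : IsRandomMeasure P Φ) :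
    Measure (Space d × Space d) := hΦ.secondMoment.map fun p => (p.1, p.2 - p.1)

lemma measurable_diffMap : Measurable fun p : Space d × Space d => (p.1, p.2 - p.1) :=
  measurable_fst.prodMk (measurable_snd.sub measurable_fst)

lemma IsRandomMeasure.diffMoment_apply (hΦ : IsRandomMeasure P Φ)
    {S : Set (Space d × Space d)} (hS : MeasurableSet S) :
    hΦ.diffMoment S = hΦ.secondMoment {p | (p.1, p.2 - p.1) ∈ S} :=
  Measure.map_apply measurable_diffMap hS

lemma IsRandomMeasure.diffMoment_unitCube_prod (hΦ : IsRandomMeasure P Φ)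
    {B : Set (Space d)} (hB : MeasurableSet B) :
    hΦ.diffMoment (unitCube d ×ˢ B) = reducedSecondMoment P Φ B := by
  rw [hΦ.diffMoment_apply ((isClosed_unitCube d).measurableSet.prod hB),
    hΦ.reducedSecondMoment_apply hB]
  rfl

lemma IsStationarySqRandomMeasure.diffMoment_prod_lt_top
    (hΦ : IsStationarySqRandomMeasure P Φ) {A B : Set (Space d)}
    (hA : Bornology.IsBounded A) (hB : Bornology.IsBounded B)
    (hAm : MeasurableSet A) (hBm : MeasurableSet B) :
    hΦ.isRandomMeasure.diffMoment (A ×ˢ B) < ∞ := by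
  obtain ⟨a, ha⟩ := hA.subset_closedBall 0
  obtain ⟨b, hb⟩ := hB.subset_closedBall 0
  rw [IsRandomMeasure.diffMoment_apply _ (hAm.prod hBm)]
  refine lt_of_le_of_lt (measure_mono fun p hp => ?_) (hΦ.secondMoment_prod_lt_top
    (A := Metric.closedBall 0 a) (B := Metric.closedBall 0 (a + b)) Metric.isBounded_closedBall
    Metric.isBounded_closedBall Metric.isClosed_closedBall.measurableSet
    Metric.isClosed_closedBall.measurableSet)
  have h1 := ha hp.1
  have h2 := hb hp.2
  refine ⟨h1, ?_⟩
  rw [mem_closedBall_zero_iff] at *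
  calc ‖p.2‖ = ‖p.1 + (p.2 - p.1)‖ := by congr 1; abel
    _ ≤ ‖p.1‖ + ‖p.2 - p.1‖ := norm_add_le _ _
    _ ≤ a + b := add_le_add h1 h2

lemma IsStationarySqRandomMeasure.diffMoment_prod_sub
    (hΦ : IsStationarySqRandomMeasure P Φ) {A B : Set (Space d)}
    (hAm : MeasurableSet A) (hBm : MeasurableSet B) (s : Space d) :
    hΦ.isRandomMeasure.diffMoment (((fun x => x - s) ⁻¹' A) ×ˢ B) =
      hΦ.isRandomMeasure.diffMoment (A ×ˢ B) := by
  have hs1 : Measurable fun p : Space d => p - s := by fun_prop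
  have e1 : MeasurableSet {p : Space d × Space d | (p.1, p.2 - p.1) ∈ A ×ˢ B} :=
    measurable_diffMap (hAm.prod hBm)
  have e2 : MeasurableSet {p : Space d × Space d |
      (p.1, p.2 - p.1) ∈ ((fun x => x - s) ⁻¹' A) ×ˢ B} :=
    measurable_diffMap ((hs1 hAm).prod hBm)
  rw [IsRandomMeasure.diffMoment_apply _ (hAm.prod hBm),
    IsRandomMeasure.diffMoment_apply _ ((hs1 hAm).prod hBm),
    ← lintegral_indicator_one e1, ← lintegral_indicator_one e2,
    ← hΦ.lintegral_secondMoment_sub (measurable_one.indicator e1) s]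
  refine lintegral_congr fun p => ?_
  have h : (p.1 - s, p.2 - s) ∈ {p : Space d × Space d | (p.1, p.2 - p.1) ∈ A ×ˢ B} ↔
      p ∈ {p : Space d × Space d | (p.1, p.2 - p.1) ∈ ((fun x => x - s) ⁻¹' A) ×ˢ B} := by
    simp
  by_cases hp : (p.1 - s, p.2 - s) ∈ {p : Space d × Space d | (p.1, p.2 - p.1) ∈ A ×ˢ B}
  · rw [Set.indicator_of_mem hp, Set.indicator_of_mem (h.1 hp)]
    rfl
  · rw [Set.indicator_of_notMem hp, Set.indicator_of_notMem (mt h.2 hp)]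

lemma IsStationarySqRandomMeasure.reducedSecondMoment_lt_top
    (hΦ : IsStationarySqRandomMeasure P Φ) {B : Set (Space d)}
    (hB : Bornology.IsBounded B) (hBm : MeasurableSet B) :
    reducedSecondMoment P Φ B < ∞ := by
  rw [← hΦ.isRandomMeasure.diffMoment_unitCube_prod hBm]
  exact hΦ.diffMoment_prod_lt_top (isBounded_unitCube d) hB
    (isClosed_unitCube d).measurableSet hBm

lemma IsStationarySqRandomMeasure.isFiniteMeasureOnCompacts
    (hΦ : IsStationarySqRandomMeasure P Φ) :
    IsFiniteMeasureOnCompacts (reducedSecondMoment P Φ) :=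
  ⟨fun _ hK => hΦ.reducedSecondMoment_lt_top hK.isBounded hK.measurableSet⟩

lemma IsStationarySqRandomMeasure.sigmaFinite (hΦ : IsStationarySqRandomMeasure P Φ) :
    SigmaFinite (reducedSecondMoment P Φ) := by
  have := hΦ.isFiniteMeasureOnCompacts
  infer_instance

lemma IsStationarySqRandomMeasure.diffMoment_prod_of_isBounded
    (hΦ : IsStationarySqRandomMeasure P Φ) {A B : Set (Space d)}
    (hB : Bornology.IsBounded B) (hAm : MeasurableSet A) (hBm : MeasurableSet B) :
    hΦ.isRandomMeasure.diffMoment (A ×ˢ B) = volume A * reducedSecondMoment P Φ B := by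
  set N := (hΦ.isRandomMeasure.diffMoment.restrict (Set.univ ×ˢ B)).map Prod.fst with hN
  have hNa : ∀ C, MeasurableSet C → N C = hΦ.isRandomMeasure.diffMoment (C ×ˢ B) := by
    intro C hC
    rw [hN, Measure.map_apply measurable_fst hC, Measure.restrict_apply (measurable_fst hC)]
    congr 1
    ext p
    simp
  have : IsFiniteMeasureOnCompacts N := ⟨fun K hK => by
    rw [hNa K hK.measurableSet]
    exact hΦ.diffMoment_prod_lt_top hK.isBounded hB hK.measurableSet hBm⟩
  have h := eq_smul_volume_of_invariant N fun s C hC => by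
    rw [hNa C hC, hNa _ (hC.preimage (by fun_prop))]
    exact hΦ.diffMoment_prod_sub hC hBm s
  rw [← hNa A hAm, h, hNa _ (isClosed_unitCube d).measurableSet,
    IsRandomMeasure.diffMoment_unitCube_prod _ hBm, Measure.smul_apply, smul_eq_mul, mul_comm]

lemma IsStationarySqRandomMeasure.diffMoment_eq_prod (hΦ : IsStationarySqRandomMeasure P Φ) :
    hΦ.isRandomMeasure.diffMoment = volume.prod (reducedSecondMoment P Φ) := by
  have := hΦ.sigmaFinite
  refine (Measure.prod_eq fun A B hA hB => ?_).symm
  have hU : B = ⋃ n : ℕ, B ∩ Metric.closedBall 0 n := by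
    rw [← Set.inter_iUnion, Metric.iUnion_closedBall_nat, Set.inter_univ]
  have hmono : Monotone fun n : ℕ => B ∩ Metric.closedBall (0 : Space d) n := fun m n hmn =>
    Set.inter_subset_inter_right _ (Metric.closedBall_subset_closedBall (by exact_mod_cast hmn))
  have hb : ∀ n : ℕ, Bornology.IsBounded (B ∩ Metric.closedBall (0 : Space d) n) := fun n =>
    Metric.isBounded_closedBall.subset Set.inter_subset_right
  have hm : ∀ n : ℕ, MeasurableSet (B ∩ Metric.closedBall (0 : Space d) n) := fun n =>
    hB.inter Metric.isClosed_closedBall.measurableSet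
  conv_lhs => rw [hU]
  conv_rhs => rw [hU]
  rw [Set.prod_iUnion, Monotone.measure_iUnion (fun m n h => Set.prod_mono_right (hmono h)),
    hmono.measure_iUnion, ENNReal.mul_iSup]
  simp only [hΦ.diffMoment_prod_of_isBounded (hb _) hA (hm _)]

/-- The second order Campbell formula. -/
lemma IsStationarySqRandomMeasure.lintegral_lintegral_prod
    (hΦ : IsStationarySqRandomMeasure P Φ) {F : Space d × Space d → ℝ≥0∞} (hF : Measurable F) :
    ∫⁻ ω, ∫⁻ p, F p ∂(Φ ω).prod (Φ ω) ∂P =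
      ∫⁻ u, (∫⁻ x, F (x, x + u)) ∂reducedSecondMoment P Φ := by
  have := hΦ.sigmaFinite
  have hF' : Measurable fun q : Space d × Space d => F (q.1, q.1 + q.2) := hF.comp (by fun_prop)
  refine Eq.trans ?_ (lintegral_prod_symm' (μ := volume) (fun q => F (q.1, q.1 + q.2)) hF')
  rw [← IsRandomMeasure.lintegral_secondMoment hΦ.isRandomMeasure hF,
    ← hΦ.diffMoment_eq_prod, IsRandomMeasure.diffMoment, lintegral_map hF' measurable_diffMap]
  simp

lemma IsStationaryMeasure.lintegral_closedBall (hΦ : IsStationaryMeasure P Φ) (v : Space d)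
    (R : ℝ) : ∫⁻ ω, (Φ ω (Metric.closedBall v R)) ^ 2 ∂P =
      ∫⁻ ω, (Φ ω (Metric.closedBall 0 R)) ^ 2 ∂P := by
  rw [← hΦ.lintegral_preimage_sub (B := Metric.closedBall 0 R)
    Metric.isClosed_closedBall.measurableSet v (g := fun a => a ^ 2) (measurable_id.pow_const 2)]
  congr! 4 with ω
  ext x
  simp [dist_eq_norm]

/-- The reduced second moment measure is translation bounded. -/
lemma IsStationarySqRandomMeasure.exists_forall_closedBall_le
    (hΦ : IsStationarySqRandomMeasure P Φ) (R : ℝ) :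
    ∃ C : ℝ≥0∞, C < ∞ ∧ ∀ v, reducedSecondMoment P Φ (Metric.closedBall v R) ≤ C := by
  set R' := max R 0 + √d
  have hR' : √d ≤ R' := le_add_of_nonneg_left (le_max_right _ _)
  refine ⟨2 * ∫⁻ ω, (Φ ω (Metric.closedBall 0 R')) ^ 2 ∂P, ENNReal.mul_lt_top (by simp)
    (hΦ.squareIntegrable _ Metric.isBounded_closedBall Metric.isClosed_closedBall.measurableSet),
    fun v => ?_⟩
  have hmeas : ∀ v : Space d, MeasurableSet (Metric.closedBall v R') := fun v =>
    Metric.isClosed_closedBall.measurableSet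
  have hae : ∀ v, AEMeasurable (fun ω => Φ ω (Metric.closedBall v R')) P := fun v =>
    (Measure.measurable_coe (hmeas v)).comp_aemeasurable hΦ.isRandomMeasure.aemeasurable
  rw [IsRandomMeasure.reducedSecondMoment_apply hΦ.isRandomMeasure
    Metric.isClosed_closedBall.measurableSet]
  calc _ ≤ hΦ.isRandomMeasure.secondMoment
        (Metric.closedBall 0 R' ×ˢ Metric.closedBall v R') := by
        refine measure_mono fun p hp => ?_
        have h1 := unitCube_subset_closedBall d hp.1
        have h2 : p.2 - p.1 ∈ Metric.closedBall v R := hp.2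
        rw [mem_closedBall_zero_iff] at h1
        rw [mem_closedBall_iff_norm] at h2
        refine ⟨mem_closedBall_zero_iff.2 (h1.trans hR'), mem_closedBall_iff_norm.2 ?_⟩
        calc ‖p.2 - v‖ = ‖(p.2 - p.1 - v) + p.1‖ := by congr 1; abel
          _ ≤ ‖p.2 - p.1 - v‖ + ‖p.1‖ := norm_add_le _ _
          _ ≤ max R 0 + √d := add_le_add (h2.trans (le_max_left _ _)) h1
    _ = ∫⁻ ω, Φ ω (Metric.closedBall 0 R') * Φ ω (Metric.closedBall v R') ∂P :=
        IsRandomMeasure.secondMoment_prod _ (hmeas _) (hmeas _)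
    _ ≤ ∫⁻ ω, (Φ ω (Metric.closedBall 0 R')) ^ 2 + (Φ ω (Metric.closedBall v R')) ^ 2 ∂P := by
        refine lintegral_mono fun ω => ?_
        have key : ∀ a b : ℝ≥0∞, a * b ≤ a ^ 2 + b ^ 2 := fun a b => by
          rcases le_total a b with h | h
          · calc a * b ≤ b * b := by gcongr
              _ ≤ _ := by rw [← sq]; exact le_add_self
          · calc a * b ≤ a * a := by gcongr
              _ ≤ _ := by rw [← sq]; exact le_self_add
        exact key _ _
    _ = _ := by
        rw [lintegral_add_left' ((hae _).pow_const 2), hΦ.stationary.lintegral_closedBall v, two_mul]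

end Campbell

section Covariogram

variable {d : ℕ}

/-- The covariogram `v ↦ λ(B ∩ (B - v))` of a set. -/
noncomputable def covariogram (B : Set (Space d)) (v : Space d) : ℝ≥0∞ :=
  volume (B ∩ (fun x => x + v) ⁻¹' B)

lemma covariogram_le (B : Set (Space d)) (v : Space d) : covariogram B v ≤ volume B :=
  measure_mono Set.inter_subset_left

lemma lintegral_indicator_mul_indicator {B : Set (Space d)} (hB : MeasurableSet B)
    (a b : Space d) :
    ∫⁻ x, B.indicator (1 : Space d → ℝ≥0∞) (x + a) * B.indicator (1 : Space d → ℝ≥0∞) (x + b) =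
      covariogram B (b - a) := by
  rw [covariogram, ← lintegral_indicator_one (hB.inter (hB.preimage (by fun_prop))),
    ← lintegral_add_right_eq_self (fun x => (B ∩ (fun y => y + (b - a)) ⁻¹' B).indicator
      (1 : Space d → ℝ≥0∞) x) a]
  refine lintegral_congr fun x => ?_
  rw [Set.inter_indicator_one, Pi.mul_apply]
  congr 1
  rw [show x + b = x + a + (b - a) by abel]
  rfl

lemma measurable_covariogram {B : Set (Space d)} (hB : MeasurableSet B) :
    Measurable (covariogram B) := by
  have h : covariogram B = fun v => ∫⁻ x, B.indicator (1 : Space d → ℝ≥0∞) (x + 0) *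
      B.indicator (1 : Space d → ℝ≥0∞) (x + v) := by
    ext v
    rw [lintegral_indicator_mul_indicator hB, sub_zero]
  rw [h]
  refine Measurable.lintegral_prod_right' (f := fun q : Space d × Space d =>
    B.indicator (1 : Space d → ℝ≥0∞) (q.2 + 0) * B.indicator (1 : Space d → ℝ≥0∞) (q.2 + q.1)) ?_
  have h1 : Measurable (B.indicator (1 : Space d → ℝ≥0∞)) := measurable_one.indicator hB
  exact (h1.comp (by fun_prop)).mul (h1.comp (by fun_prop))

lemma lintegral_covariogram {B : Set (Space d)} (hB : MeasurableSet B) (w : Space d) :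
    ∫⁻ u, covariogram B (u + w) = volume B ^ 2 := by
  have h1 : Measurable (B.indicator (1 : Space d → ℝ≥0∞)) := measurable_one.indicator hB
  rw [lintegral_add_right_eq_self]
  have h : covariogram B = fun v => ∫⁻ x, B.indicator (1 : Space d → ℝ≥0∞) x *
      B.indicator (1 : Space d → ℝ≥0∞) (x + v) := by
    ext v
    have := lintegral_indicator_mul_indicator hB 0 v
    simpa using this.symm
  rw [h, lintegral_lintegral_swap]
  · have : ∀ x : Space d, ∫⁻ v, B.indicator (1 : Space d → ℝ≥0∞) x *
        B.indicator (1 : Space d → ℝ≥0∞) (x + v) =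
        B.indicator (1 : Space d → ℝ≥0∞) x * volume B := fun x => by
      have h2 : Measurable fun v => B.indicator (1 : Space d → ℝ≥0∞) (x + v) :=
        h1.comp (measurable_const_add x)
      rw [lintegral_const_mul _ h2,
        lintegral_add_left_eq_self (fun v => B.indicator (1 : Space d → ℝ≥0∞) v) x,
        lintegral_indicator_one hB]
    simp only [this]
    rw [lintegral_mul_const _ h1, lintegral_indicator_one hB, sq]
  · exact ((h1.comp measurable_snd).mul (h1.comp (by fun_prop))).aemeasurable

end Covariogram

section Moments

variable {Ω : Type*} [MeasurableSpace Ω] {d : ℕ} {P : Measure Ω} {Φ : Ω → Measure (Space d)}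
  {Z : Ω → Space d → Space d}

lemma IsStationarySqRandomMeasure.lintegral_mul_preimage
    (hΦ : IsStationarySqRandomMeasure P Φ) {B : Set (Space d)} (hB : MeasurableSet B)
    (w : Space d) :
    ∫⁻ ω, Φ ω B * Φ ω ((fun x => x + w) ⁻¹' B) ∂P =
      ∫⁻ u, covariogram B (u + w) ∂reducedSecondMoment P Φ := by
  have h1 : Measurable (B.indicator (1 : Space d → ℝ≥0∞)) := measurable_one.indicator hB
  have hF : Measurable fun p : Space d × Space d =>
      B.indicator (1 : Space d → ℝ≥0∞) p.1 * B.indicator (1 : Space d → ℝ≥0∞) (p.2 + w) :=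
    (h1.comp measurable_fst).mul (h1.comp (by fun_prop))
  have h := hΦ.lintegral_lintegral_prod hF
  have hB' : MeasurableSet ((fun x => x + w) ⁻¹' B) := hB.preimage (by fun_prop)
  refine Eq.trans (lintegral_congr_ae ?_) (h.trans (lintegral_congr fun u => ?_))
  · filter_upwards [hΦ.isRandomMeasure.ae_locallyFinite] with ω hω
    rw [lintegral_prod_mul (f := B.indicator (1 : Space d → ℝ≥0∞))
      (g := fun y => B.indicator (1 : Space d → ℝ≥0∞) (y + w)) h1.aemeasurable
      (h1.comp (by fun_prop)).aemeasurable, lintegral_indicator_one hB,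
      ← lintegral_indicator_one hB']
    rfl
  · have := lintegral_indicator_mul_indicator hB 0 (u + w)
    simpa [add_assoc] using this

lemma IsStationarySqRandomMeasure.lintegral_sq
    (hΦ : IsStationarySqRandomMeasure P Φ) {B : Set (Space d)} (hB : MeasurableSet B) :
    ∫⁻ ω, Φ ω B ^ 2 ∂P = ∫⁻ u, covariogram B u ∂reducedSecondMoment P Φ := by
  have := hΦ.lintegral_mul_preimage hB 0
  simpa [sq] using this

lemma IsStationarySqRandomMeasure.lintegral_apply [IsFiniteMeasure P]
    (hΦ : IsStationarySqRandomMeasure P Φ) {B : Set (Space d)} (hB : MeasurableSet B) :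
    ∫⁻ ω, Φ ω B ∂P = ENNReal.ofReal (intensity P Φ) * volume B := by
  rw [← IsRandomMeasure.mean_apply hΦ.isRandomMeasure hB, hΦ.mean_eq]
  rfl

lemma ENNReal.mul_le_half_add_half_sq (a b : ℝ≥0∞) : 2 * (a * b) ≤ a ^ 2 + b ^ 2 := by
  rcases eq_or_ne a ∞ with rfl | ha
  · simp
  rcases eq_or_ne b ∞ with rfl | hb
  · simp
  lift a to NNReal using ha
  lift b to NNReal using hb
  norm_cast
  rw [← NNReal.coe_le_coe]
  push_cast
  nlinarith [sq_nonneg ((a : ℝ) - b)]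

lemma IsStationarySqRandomMeasure.lintegral_covariogram_add_le
    (hΦ : IsStationarySqRandomMeasure P Φ) {B : Set (Space d)} (hB : MeasurableSet B)
    (w : Space d) :
    ∫⁻ u, covariogram B (u + w) ∂reducedSecondMoment P Φ ≤ ∫⁻ ω, Φ ω B ^ 2 ∂P := by
  rw [← hΦ.lintegral_mul_preimage hB]
  have hae : AEMeasurable (fun ω => Φ ω B ^ 2) P :=
    ((Measure.measurable_coe hB).comp_aemeasurable hΦ.isRandomMeasure.aemeasurable).pow_const 2
  have h2 : ∫⁻ ω, Φ ω ((fun x => x + w) ⁻¹' B) ^ 2 ∂P = ∫⁻ ω, Φ ω B ^ 2 ∂P := by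
    rw [← hΦ.stationary.lintegral_preimage_sub hB (-w) (g := fun a => a ^ 2)
      (measurable_id.pow_const 2)]
    simp
  have h3 : 2 * ∫⁻ ω, Φ ω B * Φ ω ((fun x => x + w) ⁻¹' B) ∂P ≤ 2 * ∫⁻ ω, Φ ω B ^ 2 ∂P := by
    rw [← lintegral_const_mul' _ _ (by simp)]
    refine (lintegral_mono fun ω => ENNReal.mul_le_half_add_half_sq _ _).trans ?_
    rw [lintegral_add_left' hae, h2, two_mul]
  exact (ENNReal.mul_le_mul_iff_right (by simp) (by simp)).1 h3

lemma lintegral_indepFun [IsFiniteMeasure P] {X Y : Type*} [MeasurableSpace X]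
    [MeasurableSpace Y] {f : Ω → X} {g : Ω → Y} (hf : AEMeasurable f P) (hg : AEMeasurable g P)
    (h : IndepFun f g P) {H : X × Y → ℝ≥0∞} (hH : Measurable H) :
    ∫⁻ ω, H (f ω, g ω) ∂P = ∫⁻ ω, ∫⁻ ω', H (f ω, g ω') ∂P ∂P := by
  rw [← lintegral_map' (f := H) (g := fun ω => (f ω, g ω)) hH.aemeasurable (hf.prodMk hg),
    h.map_prod_eq_prod_map_map hf hg, lintegral_prod _ hH.aemeasurable,
    lintegral_map' (hH.lintegral_prod_right').aemeasurable hf]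
  refine lintegral_congr fun ω => ?_
  exact lintegral_map' (hH.comp measurable_prodMk_left).aemeasurable hg

lemma IsStationaryCadlagField.measurable_uncurry (hZ : IsStationaryCadlagField P Z) :
    Measurable fun q : Ω × Space d => Z q.1 q.2 := by
  have h : (fun q : Ω × Space d => Z q.1 q.2) = fun q => regEval (Z q.1, q.2) :=
    funext fun q => ((hZ.cadlag q.1).regEval_eq q.2).symm
  rw [h]
  exact measurable_regEval.comp ((hZ.measurable.comp measurable_fst).prodMk measurable_snd)

lemma IsStationaryCadlagField.measurable_eval (hZ : IsStationaryCadlagField P Z) (x : Space d) :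
    Measurable fun ω => Z ω x :=
  (measurable_pi_apply x).comp hZ.measurable

/-- The expectation `E 1{x + Z(x) ∈ B, y + Z(y) ∈ B}`. -/
noncomputable def jointHit (P : Measure Ω) (Z : Ω → Space d → Space d) (B : Set (Space d))
    (p : Space d × Space d) : ℝ≥0∞ :=
  ∫⁻ ω, B.indicator (1 : Space d → ℝ≥0∞) (p.1 + Z ω p.1) *
    B.indicator (1 : Space d → ℝ≥0∞) (p.2 + Z ω p.2) ∂P

lemma IsStationaryCadlagField.measurable_jointHit_integrand (hZ : IsStationaryCadlagField P Z)
    {B : Set (Space d)} (hB : MeasurableSet B) :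
    Measurable fun q : (Space d × Space d) × Ω =>
      B.indicator (1 : Space d → ℝ≥0∞) (q.1.1 + Z q.2 q.1.1) *
      B.indicator (1 : Space d → ℝ≥0∞) (q.1.2 + Z q.2 q.1.2) := by
  have h1 : Measurable (B.indicator (1 : Space d → ℝ≥0∞)) := measurable_one.indicator hB
  have h2 : Measurable fun q : (Space d × Space d) × Ω => Z q.2 q.1.1 :=
    hZ.measurable_uncurry.comp (measurable_snd.prodMk measurable_fst.fst)
  have h3 : Measurable fun q : (Space d × Space d) × Ω => Z q.2 q.1.2 :=
    hZ.measurable_uncurry.comp (measurable_snd.prodMk measurable_fst.snd)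
  exact (h1.comp (measurable_fst.fst.add h2)).mul (h1.comp (measurable_fst.snd.add h3))

lemma IsStationaryCadlagField.measurable_jointHit [SFinite P] (hZ : IsStationaryCadlagField P Z)
    {B : Set (Space d)} (hB : MeasurableSet B) : Measurable (jointHit P Z B) :=
  (hZ.measurable_jointHit_integrand hB).lintegral_prod_right'

lemma IsStationaryCadlagField.jointHit_add (hZ : IsStationaryCadlagField P Z)
    {B : Set (Space d)} (hB : MeasurableSet B) (x u : Space d) :
    jointHit P Z B (x, x + u) = ∫⁻ ω, B.indicator (1 : Space d → ℝ≥0∞) (x + Z ω 0) *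
      B.indicator (1 : Space d → ℝ≥0∞) (x + (u + Z ω u)) ∂P := by
  have h1 : Measurable (B.indicator (1 : Space d → ℝ≥0∞)) := measurable_one.indicator hB
  have h2 : Measurable fun z : Space d → Space d => z u := measurable_pi_apply u
  have h0 : Measurable fun z : Space d → Space d => z 0 := measurable_pi_apply 0
  have hH : Measurable fun z : Space d → Space d =>
      B.indicator (1 : Space d → ℝ≥0∞) (x + z 0) *
      B.indicator (1 : Space d → ℝ≥0∞) (x + (u + z u)) :=
    (h1.comp (h0.const_add x)).mul
      (h1.comp ((h2.const_add u).const_add x))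
  have h := ((hZ.stationary x).comp hH).lintegral_eq
  simp only [Function.comp_def, zero_add] at h
  rw [← h, jointHit]
  simp only [add_assoc, add_comm u x]

/-- The expected covariogram of `B` at `u + Z(u) - Z(0)`. -/
noncomputable def jointCov (P : Measure Ω) (Z : Ω → Space d → Space d) (B : Set (Space d))
    (u : Space d) : ℝ≥0∞ :=
  ∫⁻ ω, covariogram B (u + Z ω u - Z ω 0) ∂P

lemma IsStationaryCadlagField.lintegral_jointHit [SFinite P] (hZ : IsStationaryCadlagField P Z)
    {B : Set (Space d)} (hB : MeasurableSet B) (u : Space d) :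
    ∫⁻ x, jointHit P Z B (x, x + u) = jointCov P Z B u := by
  have h1 : Measurable (B.indicator (1 : Space d → ℝ≥0∞)) := measurable_one.indicator hB
  have hm : Measurable fun q : Space d × Ω => B.indicator (1 : Space d → ℝ≥0∞) (q.1 + Z q.2 0) *
      B.indicator (1 : Space d → ℝ≥0∞) (q.1 + (u + Z q.2 u)) :=
    (h1.comp (measurable_fst.add ((hZ.measurable_eval 0).comp measurable_snd))).mul
      (h1.comp (measurable_fst.add
        (((hZ.measurable_eval u).comp measurable_snd).const_add u)))
  simp only [hZ.jointHit_add hB]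
  rw [lintegral_lintegral_swap hm.aemeasurable, jointCov]
  refine lintegral_congr fun ω => ?_
  rw [lintegral_indicator_mul_indicator hB]

lemma displaced_apply [IsFiniteMeasure P] (hΦ : IsStationarySqRandomMeasure P Φ)
    (hZ : IsStationaryCadlagField P Z) (hindep : IndepFun Φ Z P)
    {B : Set (Space d)} (hB : MeasurableSet B) {g : ℝ≥0∞ → ℝ≥0∞} (hg : Measurable g) :
    ∫⁻ ω, g (displaced Φ Z ω B) ∂P =
      ∫⁻ ω, ∫⁻ ω', g (Φ ω {x | x + Z ω' x ∈ B}) ∂P ∂P := by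
  have hH : Measurable fun p : Measure (Space d) × (Space d → Space d) => g (displaceMap p B) :=
    hg.comp ((Measure.measurable_coe hB).comp measurable_displaceMap)
  have h := lintegral_indepFun hΦ.isRandomMeasure.aemeasurable hZ.measurable.aemeasurable hindep hH
  refine Eq.trans (lintegral_congr_ae ?_) (h.trans (lintegral_congr_ae ?_))
  · filter_upwards [displaced_ae_eq hΦ.isRandomMeasure hZ] with ω hω
    rw [hω]
  · filter_upwards [hΦ.isRandomMeasure.ae_locallyFinite] with ω hω
    refine lintegral_congr fun ω' => ?_
    have hm : Measurable fun x => x + Z ω' x := measurable_id.add (hZ.cadlag ω').measurable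
    rw [← displaced_eq_displaceMap (hZ.cadlag ω'), Measure.map_apply hm hB]
    rfl

lemma lintegral_displaced_sq [IsFiniteMeasure P] (hΦ : IsStationarySqRandomMeasure P Φ)
    (hZ : IsStationaryCadlagField P Z) (hindep : IndepFun Φ Z P)
    {B : Set (Space d)} (hB : MeasurableSet B) :
    ∫⁻ ω, (displaced Φ Z ω B) ^ 2 ∂P =
      ∫⁻ u, jointCov P Z B u ∂reducedSecondMoment P Φ := by
  have h1 : Measurable (B.indicator (1 : Space d → ℝ≥0∞)) := measurable_one.indicator hB
  rw [displaced_apply hΦ hZ hindep hB (g := fun a => a ^ 2) (measurable_id.pow_const 2)]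
  simp only [← hZ.lintegral_jointHit hB]
  rw [← hΦ.lintegral_lintegral_prod (hZ.measurable_jointHit hB)]
  refine lintegral_congr_ae ?_
  filter_upwards [hΦ.isRandomMeasure.ae_locallyFinite] with ω hω
  unfold jointHit
  rw [lintegral_lintegral_swap (hZ.measurable_jointHit_integrand hB).aemeasurable]
  refine lintegral_congr fun ω' => ?_
  have hm : Measurable fun x => x + Z ω' x := measurable_id.add (hZ.cadlag ω').measurable
  rw [lintegral_prod_mul (f := fun x => B.indicator (1 : Space d → ℝ≥0∞) (x + Z ω' x))
    (g := fun x => B.indicator (1 : Space d → ℝ≥0∞) (x + Z ω' x)) (h1.comp hm).aemeasurable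
    (h1.comp hm).aemeasurable, ← sq]
  congr 1
  exact (lintegral_indicator_one (hm hB)).symm

lemma lintegral_displaced [IsFiniteMeasure P] (hΦ : IsStationarySqRandomMeasure P Φ)
    (hZ : IsStationaryCadlagField P Z) (hindep : IndepFun Φ Z P)
    {B : Set (Space d)} (hB : MeasurableSet B) :
    ∫⁻ ω, displaced Φ Z ω B ∂P = ENNReal.ofReal (intensity P Φ) * (P Set.univ * volume B) := by
  have h1 : Measurable (B.indicator (1 : Space d → ℝ≥0∞)) := measurable_one.indicator hB
  refine (displaced_apply hΦ hZ hindep hB (g := id) measurable_id).trans ?_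
  have hm1 : Measurable fun q : Space d × Ω => B.indicator (1 : Space d → ℝ≥0∞)
      (q.1 + Z q.2 q.1) := h1.comp (measurable_fst.add
    (hZ.measurable_uncurry.comp (measurable_snd.prodMk measurable_fst)))
  have hm2 : Measurable fun q : Space d × Ω => B.indicator (1 : Space d → ℝ≥0∞)
      (q.1 + Z q.2 0) := h1.comp (measurable_fst.add
    ((hZ.measurable_eval 0).comp measurable_snd))
  have h2 : ∀ x, ∫⁻ ω, B.indicator (1 : Space d → ℝ≥0∞) (x + Z ω x) ∂P =
      ∫⁻ ω, B.indicator (1 : Space d → ℝ≥0∞) (x + Z ω 0) ∂P := fun x => by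
    have h0 : Measurable fun z : Space d → Space d => z 0 := measurable_pi_apply 0
    have hH : Measurable fun z : Space d → Space d =>
        B.indicator (1 : Space d → ℝ≥0∞) (x + z 0) := h1.comp (h0.const_add x)
    have h := ((hZ.stationary x).comp hH).lintegral_eq
    simpa only [Function.comp_def, zero_add] using h
  have h3 : ∫⁻ x, ∫⁻ ω, B.indicator (1 : Space d → ℝ≥0∞) (x + Z ω x) ∂P =
      P Set.univ * volume B := by
    simp only [h2]
    rw [lintegral_lintegral_swap hm2.aemeasurable]
    have : ∀ ω, ∫⁻ x, B.indicator (1 : Space d → ℝ≥0∞) (x + Z ω 0) = volume B := fun ω => by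
      rw [lintegral_add_right_eq_self (fun x => B.indicator (1 : Space d → ℝ≥0∞) x),
        lintegral_indicator_one hB]
    simp [this, mul_comm]
  rw [← h3, ← hΦ.lintegral_lintegral hm1.lintegral_prod_right']
  refine lintegral_congr_ae ?_
  filter_upwards [hΦ.isRandomMeasure.ae_locallyFinite] with ω hω
  rw [lintegral_lintegral_swap hm1.aemeasurable]
  refine lintegral_congr fun ω' => ?_
  have hm : Measurable fun x => x + Z ω' x := measurable_id.add (hZ.cadlag ω').measurable
  exact (lintegral_indicator_one (hm hB)).symm

end Moments

section Windows

variable {d : ℕ} {W : Set (Space d)}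

lemma IsWindow.smul (hW : IsWindow W) {r : ℝ} (hr : 0 < r) : IsWindow (r • W) where
  convex := hW.convex.smul r
  isBounded := hW.isBounded.smul₀ r
  zero_mem_interior := by
    rw [interior_smul₀ hr.ne']
    exact ⟨0, hW.zero_mem_interior, smul_zero r⟩
  measurableSet := hW.measurableSet.const_smul₀ r

lemma IsWindow.volume_lt_top (hW : IsWindow W) : volume W < ∞ := hW.isBounded.measure_lt_top

lemma IsWindow.volume_pos (hW : IsWindow W) : 0 < volume W :=
  (isOpen_interior.measure_pos volume ⟨0, hW.zero_mem_interior⟩).trans_le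
    (measure_mono interior_subset)

lemma IsWindow.exists_closedBall_subset (hW : IsWindow W) :
    ∃ ρ > 0, Metric.closedBall 0 ρ ⊆ W :=
  Metric.nhds_basis_closedBall.mem_iff.1 (mem_interior_iff_mem_nhds.1 hW.zero_mem_interior)

lemma volume_smul_window (W : Set (Space d)) {r : ℝ} (hr : 0 ≤ r) :
    volume (r • W) = ENNReal.ofReal (r ^ d) * volume W := by
  rw [Measure.addHaar_smul, finrank_euclideanSpace_fin, abs_of_nonneg (by positivity)]

lemma IsWindow.le_covariogram (hW : IsWindow W) {ρ : ℝ} (hρ : 0 < ρ)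
    (hb : Metric.closedBall 0 ρ ⊆ W) {v : Space d} (hv : ‖v‖ ≤ ρ) :
    ENNReal.ofReal ((1 - ‖v‖ / ρ) ^ d) * volume W ≤ covariogram W v := by
  set t := ‖v‖ / ρ with ht
  have ht0 : 0 ≤ t := by positivity
  have ht1 : t ≤ 1 := (div_le_one hρ).2 hv
  rw [← volume_smul_window W (sub_nonneg.2 ht1), covariogram]
  refine measure_mono ?_
  rintro _ ⟨w, hw, rfl⟩
  have h0 : (0 : Space d) ∈ W := interior_subset hW.zero_mem_interior
  have hstar := hW.convex.starConvex h0
  refine ⟨hstar.smul_mem hw (sub_nonneg.2 ht1) (by linarith), ?_⟩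
  change (1 - t) • w + v ∈ W
  rcases eq_or_lt_of_le ht0 with h | h
  · have hv0 : v = 0 := by
      rw [ht, eq_comm, div_eq_zero_iff] at h
      exact norm_eq_zero.1 (h.resolve_right hρ.ne')
    simpa [← h, hv0] using hw
  · have hv' : t⁻¹ • v ∈ W := by
      refine hb (mem_closedBall_zero_iff.2 ?_)
      rw [norm_smul, Real.norm_of_nonneg (by positivity), ht, inv_div, div_mul_cancel₀]
      rintro h'
      simp [ht, h'] at h
    have := hW.convex hw hv' (sub_nonneg.2 ht1) ht0 (by ring)
    rwa [smul_inv_smul₀ h.ne'] at this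

/-- The covariogram normalized by the volume. -/
noncomputable def normCov (B : Set (Space d)) (v : Space d) : ℝ≥0∞ :=
  covariogram B v / volume B

lemma normCov_le_one (B : Set (Space d)) (v : Space d) : normCov B v ≤ 1 :=
  (ENNReal.div_le_div_right (covariogram_le B v) _).trans ENNReal.div_self_le_one

lemma measurable_normCov {B : Set (Space d)} (hB : MeasurableSet B) : Measurable (normCov B) :=
  (measurable_covariogram hB).div_const _

lemma IsWindow.le_normCov (hW : IsWindow W) {ρ : ℝ} (hρ : 0 < ρ)
    (hb : Metric.closedBall 0 ρ ⊆ W) {v : Space d} (hv : ‖v‖ ≤ ρ) :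
    ENNReal.ofReal ((1 - ‖v‖ / ρ) ^ d) ≤ normCov W v := by
  rw [normCov, ENNReal.le_div_iff_mul_le (Or.inl hW.volume_pos.ne') (Or.inl hW.volume_lt_top.ne)]
  exact hW.le_covariogram hρ hb hv

lemma IsWindow.tendsto_normCov (hW : IsWindow W) (v : Space d) :
    Tendsto (fun r : ℝ => normCov (r • W) v) atTop (𝓝 1) := by
  obtain ⟨ρ, hρ, hb⟩ := hW.exists_closedBall_subset
  have h1 : Tendsto (fun r : ℝ => ENNReal.ofReal ((1 - ‖v‖ / (r * ρ)) ^ d)) atTop (𝓝 1) := by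
    have h2 : Tendsto (fun r : ℝ => (1 - ‖v‖ / (r * ρ)) ^ d) atTop (𝓝 ((1 - 0) ^ d)) :=
      (tendsto_const_nhds.sub (tendsto_const_nhds.div_atTop
        (tendsto_id.atTop_mul_const hρ))).pow d
    simpa using ENNReal.tendsto_ofReal h2
  refine tendsto_of_tendsto_of_tendsto_of_le_of_le' h1 tendsto_const_nhds ?_
    (Eventually.of_forall fun r => normCov_le_one _ _)
  filter_upwards [eventually_gt_atTop 0, eventually_ge_atTop (‖v‖ / ρ)] with r hr hr'
  refine (hW.smul hr).le_normCov (by positivity) ?_ ((div_le_iff₀ hρ).1 hr')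
  have := Set.smul_set_mono (a := r) hb
  rwa [smul_closedBall _ _ hρ.le, smul_zero, Real.norm_of_nonneg hr.le] at this

end Windows

section Mixing

variable {Ω : Type*} [MeasurableSpace Ω] {d : ℕ} {P : Measure Ω} {Φ : Ω → Measure (Space d)}
  {Z : Ω → Space d → Space d}

lemma ofReal_abs_sub_le_tvNormSub {X : Type*} [MeasurableSpace X] (μ ν : Measure X)
    [IsFiniteMeasure μ] [IsFiniteMeasure ν] {f : X → ℝ≥0∞} (hf : Measurable f)
    (h1 : ∀ x, f x ≤ 1) :
    ENNReal.ofReal |(∫⁻ x, f x ∂μ).toReal - (∫⁻ x, f x ∂ν).toReal| ≤ tvNormSub μ ν := by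
  have hlt : ∀ x, f x < ∞ := fun x => (h1 x).trans_lt ENNReal.one_lt_top
  rw [← integral_toReal hf.aemeasurable (ae_of_all _ hlt),
    ← integral_toReal hf.aemeasurable (ae_of_all _ hlt)]
  refine le_iSup_of_le (fun x => (f x).toReal) (le_iSup_of_le hf.ennreal_toReal
    (le_iSup_of_le (fun x => ?_) le_rfl))
  have h0 : 0 ≤ (f x).toReal := ENNReal.toReal_nonneg
  have h2 : (f x).toReal ≤ 1 := ENNReal.toReal_mono ENNReal.one_ne_top (h1 x)
  exact ⟨by linarith, h2⟩

/-- The law of the difference of two independent copies of `Z(0)`. -/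
noncomputable def diffLaw (P : Measure Ω) (Z : Ω → Space d → Space d) : Measure (Space d) :=
  ((P.map fun ω => Z ω 0).prod (P.map fun ω => Z ω 0)).map fun p => p.1 - p.2

lemma IsStationaryCadlagField.isProbabilityMeasure_diffLaw [IsProbabilityMeasure P]
    (hZ : IsStationaryCadlagField P Z) : IsProbabilityMeasure (diffLaw P Z) := by
  have := Measure.isProbabilityMeasure_map (μ := P) (hZ.measurable_eval 0).aemeasurable
  unfold diffLaw
  exact Measure.isProbabilityMeasure_map (by fun_prop)

/-- The expected normalized covariogram at `u + Z(u) - Z(0)`. -/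
noncomputable def jointNormCov (P : Measure Ω) (Z : Ω → Space d → Space d) (B : Set (Space d))
    (u : Space d) : ℝ≥0∞ :=
  ∫⁻ ω, normCov B (u + Z ω u - Z ω 0) ∂P

/-- The expected normalized covariogram at `u + D` where `D` has law `η`. -/
noncomputable def avgNormCov (η : Measure (Space d)) (B : Set (Space d)) (u : Space d) : ℝ≥0∞ :=
  ∫⁻ w, normCov B (u + w) ∂η

lemma IsStationaryCadlagField.measurable_jointNormCov [SFinite P]
    (hZ : IsStationaryCadlagField P Z) {B : Set (Space d)} (hB : MeasurableSet B) :
    Measurable (jointNormCov P Z B) := by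
  refine Measurable.lintegral_prod_right' (f := fun q : Space d × Ω =>
    normCov B (q.1 + Z q.2 q.1 - Z q.2 0)) ((measurable_normCov hB).comp ?_)
  exact (measurable_fst.add (hZ.measurable_uncurry.comp
    (measurable_snd.prodMk measurable_fst))).sub ((hZ.measurable_eval 0).comp measurable_snd)

lemma measurable_avgNormCov (η : Measure (Space d)) [SFinite η] {B : Set (Space d)}
    (hB : MeasurableSet B) : Measurable (avgNormCov η B) :=
  Measurable.lintegral_prod_right' (f := fun q : Space d × Space d => normCov B (q.1 + q.2))
    ((measurable_normCov hB).comp (measurable_fst.add measurable_snd))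

lemma avgNormCov_le_one (η : Measure (Space d)) [IsProbabilityMeasure η] (B : Set (Space d))
    (u : Space d) : avgNormCov η B u ≤ 1 :=
  (lintegral_mono fun _ => normCov_le_one _ _).trans (by simp)

lemma jointNormCov_le_one [IsProbabilityMeasure P] (B : Set (Space d))
    (u : Space d) : jointNormCov P Z B u ≤ 1 :=
  (lintegral_mono fun _ => normCov_le_one _ _).trans (by simp)

/-- The difference of the joint and the decoupled expected normalized covariogram. -/
noncomputable def mixingDefect (P : Measure Ω) (Z : Ω → Space d → Space d) (B : Set (Space d))
    (u : Space d) : ℝ≥0∞ :=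
  ENNReal.ofReal |(jointNormCov P Z B u).toReal - (avgNormCov (diffLaw P Z) B u).toReal|

lemma IsStationaryCadlagField.mixingDefect_le [IsProbabilityMeasure P]
    (hZ : IsStationaryCadlagField P Z) {B : Set (Space d)} (hB : MeasurableSet B) (u : Space d) :
    mixingDefect P Z B u ≤ mixingCoeff P Z u := by
  have h0 := hZ.measurable_eval 0
  have hu := hZ.measurable_eval u
  have := Measure.isProbabilityMeasure_map (μ := P) h0.aemeasurable
  have hf : Measurable fun p : Space d × Space d => normCov B (u + (p.1 - p.2)) :=
    (measurable_normCov hB).comp (by fun_prop)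
  have hw : Measurable fun w : Space d => normCov B (u + w) :=
    (measurable_normCov hB).comp (by fun_prop)
  have h := ofReal_abs_sub_le_tvNormSub (P.map (fun ω => (Z ω u, Z ω 0)))
    ((P.map (fun ω => Z ω 0)).prod (P.map (fun ω => Z ω 0))) hf fun x => normCov_le_one _ _
  rw [lintegral_map hf (hu.prodMk h0),
    ← lintegral_map (f := fun w => normCov B (u + w)) (g := fun p : Space d × Space d => p.1 - p.2)
      hw (by fun_prop)] at h
  simpa only [mixingDefect, jointNormCov, avgNormCov, diffLaw, mixingCoeff, add_sub_assoc] using h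

lemma IsStationaryCadlagField.measurable_mixingDefect [IsProbabilityMeasure P]
    (hZ : IsStationaryCadlagField P Z) {B : Set (Space d)} (hB : MeasurableSet B) :
    Measurable (mixingDefect P Z B) := by
  have := hZ.isProbabilityMeasure_diffLaw
  exact ((hZ.measurable_jointNormCov hB).ennreal_toReal.sub
    (measurable_avgNormCov _ hB).ennreal_toReal).abs.ennreal_ofReal

lemma ENNReal.le_add_ofReal_abs_sub {a b : ℝ≥0∞} (ha : a ≠ ∞) (hb : b ≠ ∞) :
    a ≤ b + ENNReal.ofReal |a.toReal - b.toReal| := by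
  rw [← ENNReal.ofReal_toReal ha, ← ENNReal.ofReal_toReal hb,
    ENNReal.toReal_ofReal toReal_nonneg, ENNReal.toReal_ofReal toReal_nonneg,
    ← ENNReal.ofReal_add toReal_nonneg (abs_nonneg _)]
  exact ENNReal.ofReal_le_ofReal (by linarith [le_abs_self (a.toReal - b.toReal)])

lemma IsStationaryCadlagField.jointNormCov_le [IsProbabilityMeasure P]
    (hZ : IsStationaryCadlagField P Z) (B : Set (Space d)) (u : Space d) :
    jointNormCov P Z B u ≤ avgNormCov (diffLaw P Z) B u + mixingDefect P Z B u := by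
  have := hZ.isProbabilityMeasure_diffLaw
  exact ENNReal.le_add_ofReal_abs_sub ((jointNormCov_le_one _ _).trans_lt ENNReal.one_lt_top).ne
    ((avgNormCov_le_one _ _ _).trans_lt ENNReal.one_lt_top).ne

lemma IsStationaryCadlagField.avgNormCov_le [IsProbabilityMeasure P]
    (hZ : IsStationaryCadlagField P Z) (B : Set (Space d)) (u : Space d) :
    avgNormCov (diffLaw P Z) B u ≤ jointNormCov P Z B u + mixingDefect P Z B u := by
  have := hZ.isProbabilityMeasure_diffLaw
  rw [mixingDefect, abs_sub_comm]
  exact ENNReal.le_add_ofReal_abs_sub ((avgNormCov_le_one _ _ _).trans_lt ENNReal.one_lt_top).ne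
    ((jointNormCov_le_one _ _).trans_lt ENNReal.one_lt_top).ne

lemma IsWindow.tendsto_jointNormCov [IsProbabilityMeasure P] (hZ : IsStationaryCadlagField P Z)
    {W : Set (Space d)} (hW : IsWindow W) (u : Space d) :
    Tendsto (fun r : ℝ => jointNormCov P Z (r • W) u) atTop (𝓝 1) := by
  have h := tendsto_lintegral_filter_of_dominated_convergence (μ := P) (l := atTop)
    (F := fun (r : ℝ) ω => normCov (r • W) (u + Z ω u - Z ω 0)) (f := fun _ => 1) (fun _ => 1)
    ?_ (Eventually.of_forall fun r => ae_of_all _ fun ω => normCov_le_one _ _) (by simp)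
    (ae_of_all _ fun ω => hW.tendsto_normCov _)
  · simpa [jointNormCov] using h
  · refine Eventually.of_forall fun r => (measurable_normCov
      (hW.measurableSet.const_smul₀ r)).comp ?_
    exact ((hZ.measurable_eval u).const_add u).sub (hZ.measurable_eval 0)

lemma IsWindow.tendsto_avgNormCov (η : Measure (Space d)) [IsProbabilityMeasure η]
    {W : Set (Space d)} (hW : IsWindow W) (u : Space d) :
    Tendsto (fun r : ℝ => avgNormCov η (r • W) u) atTop (𝓝 1) := by
  have h := tendsto_lintegral_filter_of_dominated_convergence (μ := η) (l := atTop)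
    (F := fun (r : ℝ) w => normCov (r • W) (u + w)) (f := fun _ => 1) (fun _ => 1)
    ?_ (Eventually.of_forall fun r => ae_of_all _ fun ω => normCov_le_one _ _) (by simp)
    (ae_of_all _ fun ω => hW.tendsto_normCov _)
  · simpa [avgNormCov] using h
  · exact Eventually.of_forall fun r => (measurable_normCov
      (hW.measurableSet.const_smul₀ r)).comp (by fun_prop)

lemma IsWindow.tendsto_mixingDefect [IsProbabilityMeasure P] (hZ : IsStationaryCadlagField P Z)
    {W : Set (Space d)} (hW : IsWindow W) (u : Space d) :
    Tendsto (fun r : ℝ => mixingDefect P Z (r • W) u) atTop (𝓝 0) := by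
  have := hZ.isProbabilityMeasure_diffLaw
  have h1 := (ENNReal.tendsto_toReal ENNReal.one_ne_top).comp (hW.tendsto_jointNormCov hZ u)
  have h2 := (ENNReal.tendsto_toReal ENNReal.one_ne_top).comp
    (hW.tendsto_avgNormCov (diffLaw P Z) u)
  have h3 := ENNReal.tendsto_ofReal (h1.sub h2).abs
  simpa [mixingDefect] using h3

lemma IsWindow.tendsto_lintegral_mixingDefect [IsProbabilityMeasure P]
    (hZ : IsStationaryCadlagField P Z) {W : Set (Space d)} (hW : IsWindow W)
    {α : Measure (Space d)} (hmix : ∫⁻ y, mixingCoeff P Z y ∂α < ∞) :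
    Tendsto (fun r : ℝ => ∫⁻ u, mixingDefect P Z (r • W) u ∂α) atTop (𝓝 0) := by
  refine tendsto_of_seq_tendsto fun r hr => ?_
  have hm : ∀ n, Measurable (mixingDefect P Z (r n • W)) := fun n =>
    hZ.measurable_mixingDefect (hW.measurableSet.const_smul₀ _)
  have h := tendsto_lintegral_of_dominated_convergence (μ := α)
    (F := fun n => mixingDefect P Z (r n • W)) (f := fun _ => 0)
    (fun u => ⨆ n, mixingDefect P Z (r n • W) u) hm
    (fun n => ae_of_all _ fun u => le_iSup (fun n => mixingDefect P Z (r n • W) u) n) ?_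
    (ae_of_all _ fun u => (hW.tendsto_mixingDefect hZ u).comp hr)
  · simpa [Function.comp_def] using h
  · refine (lt_of_le_of_lt (lintegral_mono fun u => iSup_le fun n => ?_) hmix).ne
    exact hZ.mixingDefect_le (hW.measurableSet.const_smul₀ _) u

/-! ### The displaced random measure -/

lemma jointCov_eq [SFinite P] {B : Set (Space d)} (h0 : volume B ≠ 0) (h1 : volume B ≠ ∞)
    (u : Space d) : jointCov P Z B u = volume B * jointNormCov P Z B u := by
  simp only [jointCov, jointNormCov, normCov]
  rw [← lintegral_const_mul' _ _ h1]
  refine lintegral_congr fun ω => ?_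
  rw [ENNReal.mul_div_cancel h0 h1]

lemma IsStationarySqRandomMeasure.lintegral_normCov_add_le
    (hΦ : IsStationarySqRandomMeasure P Φ) {B : Set (Space d)} (hB : MeasurableSet B)
    (w : Space d) :
    ∫⁻ u, normCov B (u + w) ∂reducedSecondMoment P Φ ≤
      ∫⁻ u, normCov B u ∂reducedSecondMoment P Φ := by
  have h : ∀ w, ∫⁻ u, normCov B (u + w) ∂reducedSecondMoment P Φ =
      (∫⁻ u, covariogram B (u + w) ∂reducedSecondMoment P Φ) / volume B := fun w => by
    have hm : Measurable fun u => covariogram B (u + w) :=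
      (measurable_covariogram hB).comp (measurable_add_const w)
    simp only [normCov, div_eq_mul_inv]
    rw [lintegral_mul_const _ hm]
  have h' := h 0
  simp only [add_zero] at h'
  rw [h, h', ← hΦ.lintegral_sq hB]
  exact ENNReal.div_le_div_right (hΦ.lintegral_covariogram_add_le hB w) _

lemma IsStationarySqRandomMeasure.lintegral_avgNormCov_le
    (hΦ : IsStationarySqRandomMeasure P Φ) (η : Measure (Space d)) [IsProbabilityMeasure η]
    {B : Set (Space d)} (hB : MeasurableSet B) :
    ∫⁻ u, avgNormCov η B u ∂reducedSecondMoment P Φ ≤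
      ∫⁻ u, normCov B u ∂reducedSecondMoment P Φ := by
  have := hΦ.sigmaFinite
  have hm : Measurable fun q : Space d × Space d => normCov B (q.1 + q.2) :=
    (measurable_normCov hB).comp (measurable_fst.add measurable_snd)
  unfold avgNormCov
  rw [lintegral_lintegral_swap hm.aemeasurable]
  refine (lintegral_mono fun w => hΦ.lintegral_normCov_add_le hB w).trans ?_
  simp

lemma IsStationarySqRandomMeasure.lintegral_sq_eq_normCov
    (hΦ : IsStationarySqRandomMeasure P Φ) {B : Set (Space d)} (hB : MeasurableSet B)
    (h0 : volume B ≠ 0) (h1 : volume B ≠ ∞) :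
    ∫⁻ ω, Φ ω B ^ 2 ∂P = volume B * ∫⁻ u, normCov B u ∂reducedSecondMoment P Φ := by
  rw [hΦ.lintegral_sq hB, ← lintegral_const_mul' _ _ h1]
  refine lintegral_congr fun ω => ?_
  rw [normCov, ENNReal.mul_div_cancel h0 h1]

lemma IsStationarySqRandomMeasure.lintegral_normCov_lt_top
    (hΦ : IsStationarySqRandomMeasure P Φ) {B : Set (Space d)} (hB : MeasurableSet B)
    (hb : Bornology.IsBounded B) (h0 : volume B ≠ 0) :
    ∫⁻ u, normCov B u ∂reducedSecondMoment P Φ < ∞ := by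
  have h := hΦ.squareIntegrable B hb hB
  rw [hΦ.lintegral_sq_eq_normCov hB h0 hb.measure_lt_top.ne] at h
  by_contra hc
  rw [not_lt_top_iff] at hc
  rw [hc, ENNReal.mul_top h0] at h
  exact lt_irrefl _ h

lemma lintegral_displaced_sq_eq [IsProbabilityMeasure P] (hΦ : IsStationarySqRandomMeasure P Φ)
    (hZ : IsStationaryCadlagField P Z) (hindep : IndepFun Φ Z P)
    {B : Set (Space d)} (hB : MeasurableSet B) (h0 : volume B ≠ 0) (h1 : volume B ≠ ∞) :
    ∫⁻ ω, (displaced Φ Z ω B) ^ 2 ∂P =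
      volume B * ∫⁻ u, jointNormCov P Z B u ∂reducedSecondMoment P Φ := by
  rw [lintegral_displaced_sq hΦ hZ hindep hB, ← lintegral_const_mul' _ _ h1]
  exact lintegral_congr fun u => jointCov_eq h0 h1 u

lemma lintegral_jointNormCov_lt_top [IsProbabilityMeasure P]
    (hΦ : IsStationarySqRandomMeasure P Φ) (hZ : IsStationaryCadlagField P Z)
    (hmix : ∫⁻ y, mixingCoeff P Z y ∂(reducedSecondMoment P Φ) < ∞)
    {B : Set (Space d)} (hB : MeasurableSet B) (hb : Bornology.IsBounded B)
    (h0 : volume B ≠ 0) :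
    ∫⁻ u, jointNormCov P Z B u ∂reducedSecondMoment P Φ < ∞ := by
  have := hZ.isProbabilityMeasure_diffLaw
  calc _ ≤ ∫⁻ u, avgNormCov (diffLaw P Z) B u + mixingDefect P Z B u
        ∂reducedSecondMoment P Φ := lintegral_mono fun u => hZ.jointNormCov_le B u
    _ = ∫⁻ u, avgNormCov (diffLaw P Z) B u ∂reducedSecondMoment P Φ +
        ∫⁻ u, mixingDefect P Z B u ∂reducedSecondMoment P Φ :=
        lintegral_add_left (measurable_avgNormCov _ hB) _
    _ < ∞ := ENNReal.add_lt_top.2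
        ⟨(hΦ.lintegral_avgNormCov_le _ hB).trans_lt (hΦ.lintegral_normCov_lt_top hB hb h0),
        (lintegral_mono fun u => hZ.mixingDefect_le hB u).trans_lt hmix⟩

lemma isSquareIntegrable_displaced [IsProbabilityMeasure P]
    (hΦ : IsStationarySqRandomMeasure P Φ) (hZ : IsStationaryCadlagField P Z)
    (hindep : IndepFun Φ Z P)
    (hmix : ∫⁻ y, mixingCoeff P Z y ∂(reducedSecondMoment P Φ) < ∞) :
    IsSquareIntegrable P (displaced Φ Z) := by
  intro B hb _
  obtain ⟨R, hR⟩ := hb.subset_closedBall 0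
  set C := Metric.closedBall (0 : Space d) (max R 1)
  have hC : MeasurableSet C := Metric.isClosed_closedBall.measurableSet
  have hCb : Bornology.IsBounded C := Metric.isBounded_closedBall
  have hC0 : volume C ≠ 0 := (Metric.measure_closedBall_pos volume _ (by positivity)).ne'
  have hBC : B ⊆ C := hR.trans (Metric.closedBall_subset_closedBall (le_max_left _ _))
  calc ∫⁻ ω, (displaced Φ Z ω B) ^ 2 ∂P ≤ ∫⁻ ω, (displaced Φ Z ω C) ^ 2 ∂P :=
        lintegral_mono fun ω => by gcongr
    _ = _ := lintegral_displaced_sq_eq hΦ hZ hindep hC hC0 hCb.measure_lt_top.ne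
    _ < ∞ := ENNReal.mul_lt_top hCb.measure_lt_top
        (lintegral_jointNormCov_lt_top hΦ hZ hmix hC hCb hC0)

lemma isStationarySqRandomMeasure_displaced [IsProbabilityMeasure P]
    (hΦ : IsStationarySqRandomMeasure P Φ) (hZ : IsStationaryCadlagField P Z)
    (hindep : IndepFun Φ Z P)
    (hmix : ∫⁻ y, mixingCoeff P Z y ∂(reducedSecondMoment P Φ) < ∞) :
    IsStationarySqRandomMeasure P (displaced Φ Z) := by
  have hsq := isSquareIntegrable_displaced hΦ hZ hindep hmix
  have hae := aemeasurable_displaced hΦ.isRandomMeasure hZ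
  refine ⟨⟨hae, ?_⟩,
    isStationaryMeasure_displaced hΦ.isRandomMeasure hΦ.stationary hZ hindep, hsq⟩
  have h : ∀ᵐ ω ∂P, ∀ n : ℕ, displaced Φ Z ω (Metric.ball 0 n) < ∞ := by
    refine ae_all_iff.2 fun n => ?_
    refine ae_lt_top' ((Measure.measurable_coe Metric.isOpen_ball.measurableSet).comp_aemeasurable
      hae) (hsq.lintegral_lt_top Metric.isBounded_ball Metric.isOpen_ball.measurableSet).ne
  filter_upwards [h] with ω hω
  refine ⟨fun x => ?_⟩
  obtain ⟨n, hn⟩ := exists_nat_gt ‖x‖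
  exact ⟨_, Metric.isOpen_ball.mem_nhds (mem_ball_zero_iff.2 hn), hω n⟩

end Mixing

section Comparison

/-- If `Y ≤ X + o(1)` and `X ≤ Y + ε X + o(1)` for all `ε > 0`, and `X` stays bounded, then
`X - Y → 0`. -/
lemma tendsto_sub_of_comparison {X Y δ : ℝ → ℝ} (hX : ∀ᶠ r in atTop, 0 ≤ X r)
    (hδ : Tendsto δ atTop (𝓝 0)) (h1 : ∀ᶠ r in atTop, Y r ≤ X r + δ r)
    (h2 : ∀ ε > 0, ∃ e : ℝ → ℝ, Tendsto e atTop (𝓝 0) ∧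
      ∀ᶠ r in atTop, X r ≤ Y r + ε * X r + e r)
    {M : ℝ} (hM : ∀ᶠ r in atTop, X r ≤ M) :
    Tendsto (fun r => X r - Y r) atTop (𝓝 0) := by
  have hM0 : 0 ≤ M := by
    obtain ⟨r, ha, hb⟩ := (hX.and hM).exists
    exact ha.trans hb
  refine Metric.tendsto_nhds.2 fun η hη => ?_
  obtain ⟨e, he, hXe⟩ := h2 (η / (2 * (M + 1))) (by positivity)
  have he' := (tendsto_order.1 he).2 (η / 2) (by positivity)
  have hδ' := (tendsto_order.1 hδ).2 η hη
  filter_upwards [hX, h1, hXe, hM, he', hδ'] with r a1 a2 a3 a4 a5 a6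
  rw [Real.dist_eq, sub_zero, abs_lt]
  have : η / (2 * (M + 1)) * X r ≤ η / 2 := by
    calc η / (2 * (M + 1)) * X r ≤ η / (2 * (M + 1)) * (M + 1) := by gcongr; linarith
      _ = η / 2 := by field_simp
  constructor <;> linarith

lemma tendsto_ofReal_iff_of_comparison {X Y δ : ℝ → ℝ} (hX : ∀ᶠ r in atTop, 0 ≤ X r)
    (hY : ∀ᶠ r in atTop, 0 ≤ Y r)
    (hδ : Tendsto δ atTop (𝓝 0)) (h1 : ∀ᶠ r in atTop, Y r ≤ X r + δ r)
    (h2 : ∀ ε > 0, ∃ e : ℝ → ℝ, Tendsto e atTop (𝓝 0) ∧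
      ∀ᶠ r in atTop, X r ≤ Y r + ε * X r + e r) (v : ℝ≥0∞) :
    Tendsto (fun r => ENNReal.ofReal (X r)) atTop (𝓝 v) ↔
      Tendsto (fun r => ENNReal.ofReal (Y r)) atTop (𝓝 v) := by
  have hconv : ∀ {T : ℝ → ℝ}, (∀ᶠ r in atTop, 0 ≤ T r) → ∀ {w : ℝ≥0∞}, w ≠ ∞ →
      (Tendsto (fun r => ENNReal.ofReal (T r)) atTop (𝓝 w) ↔
        Tendsto T atTop (𝓝 w.toReal)) := by
    intro T hT w hw
    refine ⟨fun h => ?_, fun h => ?_⟩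
    · refine ((ENNReal.tendsto_toReal hw).comp h).congr' ?_
      filter_upwards [hT] with r hr
      exact ENNReal.toReal_ofReal hr
    · have := ENNReal.tendsto_ofReal h
      rwa [ENNReal.ofReal_toReal hw] at this
  obtain ⟨e, he, hXe⟩ := h2 (1 / 2) (by norm_num)
  rcases eq_or_ne v ∞ with rfl | hv
  · rw [ENNReal.tendsto_ofReal_nhds_top, ENNReal.tendsto_ofReal_nhds_top]
    refine ⟨fun h => ?_, fun h => ?_⟩
    · have h3 : Tendsto (fun r => 1 / 2 * X r + -e r) atTop atTop :=
        (h.const_mul_atTop (by norm_num)).atTop_add he.neg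
      refine tendsto_atTop_mono' _ ?_ h3
      filter_upwards [hXe] with r hr
      linarith
    · have h3 : Tendsto (fun r => Y r + -δ r) atTop atTop := h.atTop_add hδ.neg
      refine tendsto_atTop_mono' _ ?_ h3
      filter_upwards [h1] with r hr
      linarith
  · rw [hconv hX hv, hconv hY hv]
    refine ⟨fun h => ?_, fun h => ?_⟩
    · have h3 := tendsto_sub_of_comparison hX hδ h1 h2 (M := v.toReal + 1)
        ((tendsto_order.1 h).2 _ (by linarith) |>.mono fun r hr => le_of_lt hr)
      simpa using h.sub h3
    · have hb : ∀ᶠ r in atTop, X r ≤ 2 * (v.toReal + 2) := by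
        filter_upwards [hXe, (tendsto_order.1 h).2 (v.toReal + 1) (by linarith),
          (tendsto_order.1 he).2 1 one_pos] with r a1 a2 a3
        linarith
      have h3 := tendsto_sub_of_comparison hX hδ h1 h2 hb
      simpa using h.add h3

end Comparison

section Variance

variable {Ω : Type*} [MeasurableSpace Ω] {d : ℕ} {P : Measure Ω} {Φ : Ω → Measure (Space d)}
  {Z : Ω → Space d → Space d}

lemma evariance_apply_of_moments [IsProbabilityMeasure P] (hm : AEMeasurable Φ P)
    {B : Set (Space d)} (hB : MeasurableSet B)
    (h0 : volume B ≠ 0) (h1 : volume B ≠ ∞) {γ : ℝ} (hγ : 0 ≤ γ) {a : ℝ≥0∞} (ha : a ≠ ∞)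
    (hmean : ∫⁻ ω, Φ ω B ∂P = ENNReal.ofReal γ * volume B)
    (hsq : ∫⁻ ω, Φ ω B ^ 2 ∂P = volume B * a) :
    0 ≤ a.toReal - γ ^ 2 * (volume B).toReal ∧
    (volume B)⁻¹ * evariance (fun ω => (Φ ω B).toReal) P =
      ENNReal.ofReal (a.toReal - γ ^ 2 * (volume B).toReal) := by
  have hae : AEMeasurable (fun ω => Φ ω B) P :=
    (Measure.measurable_coe hB).comp_aemeasurable hm
  have hfin : ∫⁻ ω, Φ ω B ^ 2 ∂P < ∞ := by
    rw [hsq]; exact ENNReal.mul_lt_top h1.lt_top ha.lt_top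
  have hfin2 : ∀ᵐ ω ∂P, Φ ω B < ∞ := by
    filter_upwards [ae_lt_top' (hae.pow_const 2) hfin.ne] with ω h
    by_contra hc
    rw [not_lt_top_iff] at hc
    simp [hc] at h
  have hi2 : ∫ ω, (Φ ω B).toReal ^ 2 ∂P = (volume B).toReal * a.toReal := by
    rw [← ENNReal.toReal_mul, ← hsq, ← integral_toReal (hae.pow_const 2)
      (ae_lt_top' (hae.pow_const 2) hfin.ne)]
    simp
  have hi1 : ∫ ω, (Φ ω B).toReal ∂P = γ * (volume B).toReal := by
    rw [integral_toReal hae hfin2, hmean, ENNReal.toReal_mul, ENNReal.toReal_ofReal hγ]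
  have hL : MemLp (fun ω => (Φ ω B).toReal) 2 P := by
    rw [memLp_two_iff_integrable_sq hae.ennreal_toReal.aestronglyMeasurable]
    have := integrable_toReal_of_lintegral_ne_top (hae.pow_const 2) hfin.ne
    simpa using this
  have hvar : variance (fun ω => (Φ ω B).toReal) P =
      (volume B).toReal * (a.toReal - γ ^ 2 * (volume B).toReal) := by
    rw [variance_eq_sub hL]
    simp only [Pi.pow_apply]
    rw [hi2, hi1]
    ring
  have hpos : 0 < (volume B).toReal := ENNReal.toReal_pos h0 h1
  have hnn := variance_nonneg (fun ω => (Φ ω B).toReal) P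
  refine ⟨?_, ?_⟩
  · rw [hvar] at hnn
    exact nonneg_of_mul_nonneg_right hnn hpos
  · rw [← ofReal_variance hL, hvar, ENNReal.ofReal_mul hpos.le, ENNReal.ofReal_toReal h1,
      ← mul_assoc, ENNReal.inv_mul_cancel h0 h1, one_mul]

/-- The variance of `Φ(B)` divided by the volume of `B`. -/
noncomputable def scaledVar (P : Measure Ω) (Φ : Ω → Measure (Space d)) (B : Set (Space d)) : ℝ :=
  (∫⁻ u, normCov B u ∂reducedSecondMoment P Φ).toReal - intensity P Φ ^ 2 * (volume B).toReal

/-- The variance of `Γ(B)` divided by the volume of `B`, for the displaced random measure `Γ`. -/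
noncomputable def displacedScaledVar (P : Measure Ω) (Φ : Ω → Measure (Space d))
    (Z : Ω → Space d → Space d) (B : Set (Space d)) : ℝ :=
  (∫⁻ u, jointNormCov P Z B u ∂reducedSecondMoment P Φ).toReal -
    intensity P Φ ^ 2 * (volume B).toReal

lemma IsStationarySqRandomMeasure.scaledVar_eq [IsProbabilityMeasure P]
    (hΦ : IsStationarySqRandomMeasure P Φ) {W : Set (Space d)} (hW : IsWindow W) :
    0 ≤ scaledVar P Φ W ∧ (volume W)⁻¹ * evariance (fun ω => (Φ ω W).toReal) P =
      ENNReal.ofReal (scaledVar P Φ W) :=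
  evariance_apply_of_moments hΦ.isRandomMeasure.aemeasurable hW.measurableSet
    hW.volume_pos.ne' hW.volume_lt_top.ne intensity_nonneg
    (hΦ.lintegral_normCov_lt_top hW.measurableSet hW.isBounded hW.volume_pos.ne').ne
    (hΦ.lintegral_apply hW.measurableSet)
    (hΦ.lintegral_sq_eq_normCov hW.measurableSet hW.volume_pos.ne' hW.volume_lt_top.ne)

lemma displacedScaledVar_eq [IsProbabilityMeasure P]
    (hΦ : IsStationarySqRandomMeasure P Φ) (hZ : IsStationaryCadlagField P Z)
    (hindep : IndepFun Φ Z P)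
    (hmix : ∫⁻ y, mixingCoeff P Z y ∂(reducedSecondMoment P Φ) < ∞)
    {W : Set (Space d)} (hW : IsWindow W) :
    0 ≤ displacedScaledVar P Φ Z W ∧
    (volume W)⁻¹ * evariance (fun ω => (displaced Φ Z ω W).toReal) P =
      ENNReal.ofReal (displacedScaledVar P Φ Z W) := by
  refine evariance_apply_of_moments (aemeasurable_displaced hΦ.isRandomMeasure hZ)
    hW.measurableSet hW.volume_pos.ne' hW.volume_lt_top.ne intensity_nonneg
    (lintegral_jointNormCov_lt_top hΦ hZ hmix hW.measurableSet hW.isBounded hW.volume_pos.ne').ne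
    ?_ (lintegral_displaced_sq_eq hΦ hZ hindep hW.measurableSet hW.volume_pos.ne'
      hW.volume_lt_top.ne)
  rw [lintegral_displaced hΦ hZ hindep hW.measurableSet]
  simp

/-- The effect of averaging the normalized covariogram over `η`. -/
noncomputable def covDefect (η : Measure (Space d)) (B : Set (Space d)) (u : Space d) : ℝ :=
  (normCov B u).toReal - (avgNormCov η B u).toReal

lemma abs_covDefect_le (η : Measure (Space d)) [IsProbabilityMeasure η] (B : Set (Space d))
    (u : Space d) : |covDefect η B u| ≤ 1 := by
  have h1 := ENNReal.toReal_mono ENNReal.one_ne_top (normCov_le_one B u)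
  have h2 := ENNReal.toReal_mono ENNReal.one_ne_top (avgNormCov_le_one η B u)
  have h3 : 0 ≤ (normCov B u).toReal := ENNReal.toReal_nonneg
  have h4 : 0 ≤ (avgNormCov η B u).toReal := ENNReal.toReal_nonneg
  rw [ENNReal.toReal_one] at h1 h2
  rw [covDefect, abs_le]
  constructor <;> linarith

lemma measurable_covDefect (η : Measure (Space d)) [SFinite η] {B : Set (Space d)}
    (hB : MeasurableSet B) : Measurable (covDefect η B) :=
  (measurable_normCov hB).ennreal_toReal.sub (measurable_avgNormCov η hB).ennreal_toReal

lemma IsWindow.tendsto_covDefect (η : Measure (Space d)) [IsProbabilityMeasure η]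
    {W : Set (Space d)} (hW : IsWindow W) (u : Space d) :
    Tendsto (fun r : ℝ => covDefect η (r • W) u) atTop (𝓝 0) := by
  have h1 := (ENNReal.tendsto_toReal ENNReal.one_ne_top).comp (hW.tendsto_normCov u)
  have h2 := (ENNReal.tendsto_toReal ENNReal.one_ne_top).comp (hW.tendsto_avgNormCov η u)
  simpa [covDefect] using h1.sub h2

lemma lintegral_normCov_volume {W : Set (Space d)} (hW : IsWindow W) (w : Space d) :
    ∫⁻ u, normCov W (u + w) = volume W := by
  have hm : Measurable fun u => covariogram W (u + w) :=
    (measurable_covariogram hW.measurableSet).comp (measurable_add_const w)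
  simp only [normCov, div_eq_mul_inv]
  rw [lintegral_mul_const _ hm, lintegral_covariogram hW.measurableSet, sq, mul_assoc,
    ENNReal.mul_inv_cancel hW.volume_pos.ne' hW.volume_lt_top.ne, mul_one]

lemma lintegral_avgNormCov_volume (η : Measure (Space d)) [IsProbabilityMeasure η]
    {W : Set (Space d)} (hW : IsWindow W) :
    ∫⁻ u, avgNormCov η W u = volume W := by
  have hm : Measurable fun q : Space d × Space d => normCov W (q.1 + q.2) :=
    (measurable_normCov hW.measurableSet).comp (measurable_fst.add measurable_snd)
  unfold avgNormCov
  rw [lintegral_lintegral_swap hm.aemeasurable]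
  simp [lintegral_normCov_volume hW]

lemma integral_covDefect (η : Measure (Space d)) [IsProbabilityMeasure η] {B : Set (Space d)}
    (hB : MeasurableSet B) {α : Measure (Space d)} (h1 : ∫⁻ u, normCov B u ∂α ≠ ∞)
    (h2 : ∫⁻ u, avgNormCov η B u ∂α ≠ ∞) :
    Integrable (covDefect η B) α ∧ ∫ u, covDefect η B u ∂α =
      (∫⁻ u, normCov B u ∂α).toReal - (∫⁻ u, avgNormCov η B u ∂α).toReal := by
  have i1 := integrable_toReal_of_lintegral_ne_top (measurable_normCov hB).aemeasurable h1
  have i2 := integrable_toReal_of_lintegral_ne_top (measurable_avgNormCov η hB).aemeasurable h2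
  refine ⟨i1.sub i2, ?_⟩
  unfold covDefect
  rw [integral_sub i1 i2, integral_toReal (measurable_normCov hB).aemeasurable
    (ae_of_all _ fun u => (normCov_le_one _ _).trans_lt ENNReal.one_lt_top),
    integral_toReal (measurable_avgNormCov η hB).aemeasurable
    (ae_of_all _ fun u => (avgNormCov_le_one _ _ _).trans_lt ENNReal.one_lt_top)]

lemma integral_covDefect_volume (η : Measure (Space d)) [IsProbabilityMeasure η]
    {W : Set (Space d)} (hW : IsWindow W) :
    Integrable (covDefect η W) ∧ ∫ u, covDefect η W u = 0 := by
  have h1 : ∫⁻ u, normCov W u = volume W := by simpa using lintegral_normCov_volume hW 0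
  have h2 := lintegral_avgNormCov_volume η hW
  have := integral_covDefect (α := volume) η hW.measurableSet
    (by rw [h1]; exact hW.volume_lt_top.ne) (by rw [h2]; exact hW.volume_lt_top.ne)
  rwa [h1, h2, sub_self] at this

lemma IsStationarySqRandomMeasure.integral_covDefect
    (hΦ : IsStationarySqRandomMeasure P Φ) (η : Measure (Space d)) [IsProbabilityMeasure η]
    {W : Set (Space d)} (hW : IsWindow W) :
    Integrable (covDefect η W) (reducedSecondMoment P Φ) ∧
      ∫ u, covDefect η W u ∂reducedSecondMoment P Φ =
      (∫⁻ u, normCov W u ∂reducedSecondMoment P Φ).toReal -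
        (∫⁻ u, avgNormCov η W u ∂reducedSecondMoment P Φ).toReal := by
  have h := hΦ.lintegral_normCov_lt_top hW.measurableSet hW.isBounded hW.volume_pos.ne'
  exact _root_.integral_covDefect η hW.measurableSet h.ne
    ((hΦ.lintegral_avgNormCov_le η hW.measurableSet).trans_lt h).ne

lemma IsStationarySqRandomMeasure.integral_covDefect_nonneg
    (hΦ : IsStationarySqRandomMeasure P Φ) (η : Measure (Space d)) [IsProbabilityMeasure η]
    {W : Set (Space d)} (hW : IsWindow W) :
    0 ≤ ∫ u, covDefect η W u ∂reducedSecondMoment P Φ := by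
  rw [(hΦ.integral_covDefect η hW).2, sub_nonneg]
  exact ENNReal.toReal_mono
    (hΦ.lintegral_normCov_lt_top hW.measurableSet hW.isBounded hW.volume_pos.ne').ne
    (hΦ.lintegral_avgNormCov_le η hW.measurableSet)

lemma abs_scaledVar_sub_le [IsProbabilityMeasure P]
    (hΦ : IsStationarySqRandomMeasure P Φ) (hZ : IsStationaryCadlagField P Z)
    (hmix : ∫⁻ y, mixingCoeff P Z y ∂(reducedSecondMoment P Φ) < ∞)
    {W : Set (Space d)} (hW : IsWindow W) :
    |scaledVar P Φ W - displacedScaledVar P Φ Z W -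
      ∫ u, covDefect (diffLaw P Z) W u ∂reducedSecondMoment P Φ| ≤
      (∫⁻ u, mixingDefect P Z W u ∂reducedSecondMoment P Φ).toReal := by
  have := hZ.isProbabilityMeasure_diffLaw
  have hm := hW.measurableSet
  have f1 := hΦ.lintegral_normCov_lt_top hm hW.isBounded hW.volume_pos.ne'
  have f2 := (hΦ.lintegral_avgNormCov_le (diffLaw P Z) hm).trans_lt f1
  have f3 := lintegral_jointNormCov_lt_top hΦ hZ hmix hm hW.isBounded hW.volume_pos.ne'
  have f4 : ∫⁻ u, mixingDefect P Z W u ∂reducedSecondMoment P Φ < ∞ :=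
    (lintegral_mono fun u => hZ.mixingDefect_le hm u).trans_lt hmix
  have g1 : ∫⁻ u, jointNormCov P Z W u ∂reducedSecondMoment P Φ ≤
      ∫⁻ u, avgNormCov (diffLaw P Z) W u ∂reducedSecondMoment P Φ +
      ∫⁻ u, mixingDefect P Z W u ∂reducedSecondMoment P Φ := by
    rw [← lintegral_add_left (measurable_avgNormCov _ hm)]
    exact lintegral_mono fun u => hZ.jointNormCov_le W u
  have g2 : ∫⁻ u, avgNormCov (diffLaw P Z) W u ∂reducedSecondMoment P Φ ≤
      ∫⁻ u, jointNormCov P Z W u ∂reducedSecondMoment P Φ +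
      ∫⁻ u, mixingDefect P Z W u ∂reducedSecondMoment P Φ := by
    rw [← lintegral_add_left (hZ.measurable_jointNormCov hm)]
    exact lintegral_mono fun u => hZ.avgNormCov_le W u
  have g1' := ENNReal.toReal_mono (ENNReal.add_lt_top.2 ⟨f2, f4⟩).ne g1
  have g2' := ENNReal.toReal_mono (ENNReal.add_lt_top.2 ⟨f3, f4⟩).ne g2
  rw [ENNReal.toReal_add f2.ne f4.ne] at g1'
  rw [ENNReal.toReal_add f3.ne f4.ne] at g2'
  rw [(hΦ.integral_covDefect _ hW).2, scaledVar, displacedScaledVar, abs_le]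
  constructor <;> linarith

end Variance

section FiniteCovariance

variable {Ω : Type*} [MeasurableSpace Ω] {d : ℕ} {P : Measure Ω} {Φ : Ω → Measure (Space d)}

lemma ofReal_abs_covarianceMeasure_le {B : Set (Space d)} (hb : Bornology.IsBounded B)
    (hB : MeasurableSet B) :
    ENNReal.ofReal |covarianceMeasure P Φ B| ≤ covarianceTotalVariation P Φ := by
  classical
  refine le_iSup_of_le {B} (le_iSup_of_le ?_ (le_iSup_of_le ?_ ?_))
  · simpa using ⟨hb, hB⟩
  · simp
  · simp

/-- If the covariance measure has finite total variation, it has an integrable density with respect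
to some dominating measure. -/
lemma IsStationarySqRandomMeasure.exists_covariance_density
    (hΦ : IsStationarySqRandomMeasure P Φ) (hTV : covarianceTotalVariation P Φ < ∞) :
    ∃ (μ : Measure (Space d)) (b : Space d → ℝ), Integrable b μ ∧
      ∀ h : Space d → ℝ, Integrable h (reducedSecondMoment P Φ) → Integrable h →
        ∫ u, h u ∂reducedSecondMoment P Φ - intensity P Φ ^ 2 * ∫ u, h u = ∫ u, h u * b u ∂μ := by
  have hcomp := hΦ.isFiniteMeasureOnCompacts
  set α := reducedSecondMoment P Φ with hα
  set c : NNReal := ⟨intensity P Φ ^ 2, sq_nonneg _⟩ with hc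
  set β : Measure (Space d) := c • volume with hβ
  set μ := α + β with hμ
  have hαμ : α ≪ μ := Measure.AbsolutelyContinuous.rfl.add_right β
  have hβμ : β ≪ μ := by
    rw [hμ, add_comm]; exact Measure.AbsolutelyContinuous.rfl.add_right α
  have hμf : IsFiniteMeasureOnCompacts μ := ⟨fun K hK => by
    rw [hμ, Measure.add_apply]
    exact ENNReal.add_lt_top.2 ⟨hK.measure_lt_top, hK.measure_lt_top⟩⟩
  set b : Space d → ℝ := fun u => (α.rnDeriv μ u).toReal - (β.rnDeriv μ u).toReal with hb
  have hbm : Measurable b := (Measure.measurable_rnDeriv _ _).ennreal_toReal.sub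
    (Measure.measurable_rnDeriv _ _).ennreal_toReal
  have hset : ∀ B : Set (Space d), Bornology.IsBounded B → MeasurableSet B →
      IntegrableOn b B μ ∧ ∫ u in B, b u ∂μ = covarianceMeasure P Φ B := by
    intro B hBb hB
    have i1 : IntegrableOn (fun u => (α.rnDeriv μ u).toReal) B μ :=
      Measure.integrableOn_toReal_rnDeriv hBb.measure_lt_top.ne
    have i2 : IntegrableOn (fun u => (β.rnDeriv μ u).toReal) B μ :=
      Measure.integrableOn_toReal_rnDeriv hBb.measure_lt_top.ne
    refine ⟨i1.sub i2, ?_⟩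
    rw [hb, integral_sub i1 i2, Measure.setIntegral_toReal_rnDeriv hαμ,
      Measure.setIntegral_toReal_rnDeriv hβμ, covarianceMeasure, hβ, measureReal_def,
      measureReal_def, Measure.smul_apply, ENNReal.smul_def, smul_eq_mul, ENNReal.toReal_mul]
    rfl
  have hball : ∀ n : ℕ, ∫⁻ u in Metric.ball 0 n, ‖b u‖ₑ ∂μ ≤
      2 * covarianceTotalVariation P Φ := by
    intro n
    have hp : MeasurableSet {u | 0 ≤ b u} := measurableSet_le measurable_const hbm
    rw [← lintegral_inter_add_sdiff _ _ hp, two_mul]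
    have hb1 : Bornology.IsBounded (Metric.ball (0 : Space d) n ∩ {u | 0 ≤ b u}) :=
      Metric.isBounded_ball.subset Set.inter_subset_left
    have hb2 : Bornology.IsBounded (Metric.ball (0 : Space d) n \ {u | 0 ≤ b u}) :=
      Metric.isBounded_ball.subset Set.sdiff_subset
    have hm1 := Metric.isOpen_ball.measurableSet.inter hp (s₁ := Metric.ball (0 : Space d) n)
    have hm2 := Metric.isOpen_ball.measurableSet.diff hp (s₁ := Metric.ball (0 : Space d) n)
    refine add_le_add ?_ ?_
    · refine le_trans (le_of_eq ?_) (ofReal_abs_covarianceMeasure_le hb1 hm1)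
      rw [← (hset _ hb1 hm1).2, abs_of_nonneg (setIntegral_nonneg hm1 fun u hu => hu.2),
        ofReal_integral_eq_lintegral_ofReal (hset _ hb1 hm1).1
          ((ae_restrict_iff' hm1).2 (ae_of_all _ fun u hu => hu.2))]
      refine setLIntegral_congr_fun hm1 fun u hu => ?_
      exact Real.enorm_of_nonneg hu.2
    · have hneg : ∀ u ∈ Metric.ball (0 : Space d) n \ {u | 0 ≤ b u}, b u ≤ 0 := fun u hu =>
        (not_le.1 hu.2).le
      refine le_trans (le_of_eq ?_) (ofReal_abs_covarianceMeasure_le hb2 hm2)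
      rw [← (hset _ hb2 hm2).2, abs_of_nonpos (setIntegral_nonpos hm2 hneg), ← integral_neg,
        ofReal_integral_eq_lintegral_ofReal (f := fun u => -b u) (hset _ hb2 hm2).1.neg
          ((ae_restrict_iff' hm2).2 (ae_of_all _ fun u hu => neg_nonneg.2 (hneg u hu)))]
      refine setLIntegral_congr_fun hm2 fun u hu => ?_
      rw [← enorm_neg]
      exact Real.enorm_of_nonneg (neg_nonneg.2 (hneg u hu))
  have hbint : Integrable b μ := by
    refine ⟨hbm.aestronglyMeasurable, ?_⟩
    rw [HasFiniteIntegral, ← setLIntegral_univ, ← Metric.iUnion_ball_nat (0 : Space d),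
      setLIntegral_iUnion_of_directed]
    · exact (iSup_le hball).trans_lt (ENNReal.mul_lt_top (by simp) hTV)
    · exact Monotone.directed_le fun m n hmn => Metric.ball_subset_ball (by exact_mod_cast hmn)
  refine ⟨μ, b, hbint, fun h h1 h2 => ?_⟩
  have h2' : Integrable h β := h2.smul_measure_nnreal
  have e1 := integral_rnDeriv_smul (f := h) hαμ
  have e2 := integral_rnDeriv_smul (f := h) hβμ
  have e3 : ∫ u, h u ∂β = intensity P Φ ^ 2 * ∫ u, h u := by
    rw [hβ, integral_smul_nnreal_measure]
    rfl
  rw [← e3, ← e1, ← e2, ← integral_sub ((integrable_rnDeriv_smul_iff hαμ).2 h1)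
    ((integrable_rnDeriv_smul_iff hβμ).2 h2')]
  refine integral_congr_ae (ae_of_all _ fun u => ?_)
  simp only [hb, smul_eq_mul]
  ring

lemma IsStationarySqRandomMeasure.tendsto_integral_covDefect
    (hΦ : IsStationarySqRandomMeasure P Φ) (hTV : covarianceTotalVariation P Φ < ∞)
    (η : Measure (Space d)) [IsProbabilityMeasure η] {W : Set (Space d)} (hW : IsWindow W) :
    Tendsto (fun r : ℝ => ∫ u, covDefect η (r • W) u ∂reducedSecondMoment P Φ) atTop (𝓝 0) := by
  obtain ⟨μ, b, hb, h⟩ := hΦ.exists_covariance_density hTV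
  have h1 : Tendsto (fun r : ℝ => ∫ u, covDefect η (r • W) u * b u ∂μ) atTop
      (𝓝 (∫ _u, (0 : ℝ) ∂μ)) := by
    refine tendsto_integral_filter_of_dominated_convergence (fun u => ‖b u‖) ?_ ?_ hb.norm ?_
    · exact Eventually.of_forall fun r => ((measurable_covDefect η
        (hW.measurableSet.const_smul₀ r)).aestronglyMeasurable).mul hb.aestronglyMeasurable
    · refine Eventually.of_forall fun r => ae_of_all _ fun u => ?_
      rw [norm_mul]
      exact mul_le_of_le_one_left (norm_nonneg _) (abs_covDefect_le _ _ _)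
    · refine ae_of_all _ fun u => ?_
      simpa using (hW.tendsto_covDefect η u).mul_const (b u)
  rw [integral_zero] at h1
  refine h1.congr' ?_
  filter_upwards [eventually_gt_atTop 0] with r hr
  have hv := integral_covDefect_volume η (hW.smul hr)
  rw [← h _ (hΦ.integral_covDefect η (hW.smul hr)).1 hv.1, hv.2, mul_zero, sub_zero]

end FiniteCovariance

section CosineTransform

variable {d : ℕ}

/-- The wave `x ↦ cos (2 π ⟨k, x⟩)`. -/
noncomputable def cosWave (k x : Space d) : ℝ := Real.cos (2 * Real.pi * inner ℝ k x)

/-- The wave `x ↦ sin (2 π ⟨k, x⟩)`. -/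
noncomputable def sinWave (k x : Space d) : ℝ := Real.sin (2 * Real.pi * inner ℝ k x)

lemma continuous_cosWave : Continuous fun p : Space d × Space d => cosWave p.1 p.2 := by
  unfold cosWave; fun_prop

lemma continuous_cosWave_right (k : Space d) : Continuous (cosWave k) := by
  unfold cosWave; fun_prop

lemma continuous_sinWave_right (k : Space d) : Continuous (sinWave k) := by
  unfold sinWave; fun_prop

lemma abs_cosWave_le (k x : Space d) : |cosWave k x| ≤ 1 := Real.abs_cos_le_one _

lemma abs_sinWave_le (k x : Space d) : |sinWave k x| ≤ 1 := Real.abs_sin_le_one _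

lemma cosWave_sub (k x y : Space d) :
    cosWave k (y - x) = cosWave k x * cosWave k y + sinWave k x * sinWave k y := by
  rw [cosWave, inner_sub_right, mul_sub, Real.cos_sub, cosWave, cosWave, sinWave, sinWave]
  ring

lemma cosWave_add (k x y : Space d) :
    cosWave k (x + y) = cosWave k x * cosWave k y - sinWave k x * sinWave k y := by
  rw [cosWave, inner_add_right, mul_add, Real.cos_add, cosWave, cosWave, sinWave, sinWave]

lemma sinWave_neg (k x : Space d) : sinWave k (-x) = -sinWave k x := by
  rw [sinWave, inner_neg_right, mul_neg, Real.sin_neg, sinWave]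

lemma integrable_cosWave (μ : Measure (Space d)) [IsFiniteMeasure μ] (k : Space d) :
    Integrable (cosWave k) μ :=
  Integrable.of_bound (continuous_cosWave_right k).aestronglyMeasurable 1
    (ae_of_all _ fun x => abs_cosWave_le k x)

lemma integrable_sinWave (μ : Measure (Space d)) [IsFiniteMeasure μ] (k : Space d) :
    Integrable (sinWave k) μ :=
  Integrable.of_bound (continuous_sinWave_right k).aestronglyMeasurable 1
    (ae_of_all _ fun x => abs_sinWave_le k x)

lemma setIntegral_prod_cosWave_sub (φ : Measure (Space d)) [SFinite φ] {B : Set (Space d)}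
    (hφ : φ B < ∞) (k : Space d) :
    ∫ p in B ×ˢ B, cosWave k (p.2 - p.1) ∂φ.prod φ =
      (∫ x in B, cosWave k x ∂φ) ^ 2 + (∫ x in B, sinWave k x ∂φ) ^ 2 := by
  have : IsFiniteMeasure (φ.restrict B) := ⟨by simpa using hφ⟩
  rw [← Measure.prod_restrict]
  simp only [cosWave_sub]
  rw [integral_add ((integrable_cosWave _ k).mul_prod (integrable_cosWave _ k))
    ((integrable_sinWave _ k).mul_prod (integrable_sinWave _ k)), integral_prod_mul,
    integral_prod_mul, sq, sq]

lemma setIntegral_prod_cosWave_sub_eq {M : Measure (Space d × Space d)} {α : Measure (Space d)}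
    [SFinite α] (hM : M.map (fun p => (p.1, p.2 - p.1)) = volume.prod α) {B : Set (Space d)}
    (hB : MeasurableSet B) (hMB : M (B ×ˢ B) < ∞) (k : Space d) :
    ∫ p in B ×ˢ B, cosWave k (p.2 - p.1) ∂M =
      ∫ u, (covariogram B u).toReal * cosWave k u ∂α := by
  set T : Set (Space d × Space d) := {q | q.1 ∈ B ∧ q.1 + q.2 ∈ B} with hT
  have hTm : MeasurableSet T := (measurable_fst hB).inter ((measurable_fst.add measurable_snd) hB)
  have hpre : (fun p : Space d × Space d => (p.1, p.2 - p.1)) ⁻¹' T = B ×ˢ B := by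
    ext p; simp [hT]
  have hc : Continuous fun q : Space d × Space d => cosWave k q.2 :=
    (continuous_cosWave_right k).comp continuous_snd
  have hfin : volume.prod α T < ∞ := by
    rw [← hM, Measure.map_apply measurable_diffMap hTm, hpre]
    exact hMB
  have hint : Integrable (T.indicator fun q => cosWave k q.2) (volume.prod α) := by
    rw [integrable_indicator_iff hTm]
    exact Measure.integrableOn_of_bounded hfin.ne hc.aestronglyMeasurable
      (ae_of_all _ fun q => abs_cosWave_le k q.2)
  have h1 := setIntegral_map (μ := M) hTm (f := fun q : Space d × Space d => cosWave k q.2)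
    (g := fun p => (p.1, p.2 - p.1)) hc.aestronglyMeasurable measurable_diffMap.aemeasurable
  rw [hM, hpre] at h1
  rw [← h1, ← integral_indicator hTm, integral_prod_symm _ hint]
  refine integral_congr_ae (ae_of_all _ fun u => ?_)
  have hS : MeasurableSet (B ∩ (fun x => x + u) ⁻¹' B) := hB.inter (hB.preimage (by fun_prop))
  have h2 : ∀ x, T.indicator (fun q => cosWave k q.2) (x, u) =
      (B ∩ (fun x => x + u) ⁻¹' B).indicator (fun _ => cosWave k u) x := fun x => rfl
  simp only [h2]
  rw [integral_indicator hS, setIntegral_const, smul_eq_mul]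
  rfl

lemma integral_covariogram_mul_cosWave {B : Set (Space d)} (hB : MeasurableSet B)
    (h : volume B < ∞) (k : Space d) :
    ∫ u, (covariogram B u).toReal * cosWave k u =
      (∫ x in B, cosWave k x) ^ 2 + (∫ x in B, sinWave k x) ^ 2 := by
  rw [← setIntegral_prod_cosWave_sub volume h k]
  refine (setIntegral_prod_cosWave_sub_eq (M := volume.prod volume) ?_ hB ?_ k).symm
  · have := (measurePreserving_prod_neg_add (volume : Measure (Space d))
      (volume : Measure (Space d))).map_eq
    simpa only [neg_add_eq_sub] using this
  · rw [Measure.prod_prod]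
    exact ENNReal.mul_lt_top h h

end CosineTransform

section Positivity

variable {Ω : Type*} [MeasurableSpace Ω] {d : ℕ} {P : Measure Ω} {Φ : Ω → Measure (Space d)}

lemma integral_bind_kernel {X Y : Type*} [MeasurableSpace X] [MeasurableSpace Y] (P : Measure X)
    (κ : Kernel X Y) [SFinite P] [IsSFiniteKernel κ] {f : Y → ℝ} (hf : Integrable f (P.bind κ)) :
    ∫ y, f y ∂(P.bind κ) = ∫ x, ∫ y, f y ∂κ x ∂P ∧
      Integrable (fun x => ∫ y, f y ∂κ x) P := by
  have h : (κ ∘ₖ Kernel.const Unit P) () = P.bind κ := by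
    rw [Kernel.comp_apply, Kernel.const_apply]
  rw [← h] at hf ⊢
  refine ⟨?_, ?_⟩
  · rw [Kernel.integral_comp hf, Kernel.const_apply]
  · simpa using hf.integral_comp

lemma sq_integral_le_integral_sq [IsProbabilityMeasure P] {X : Ω → ℝ} (h : MemLp X 2 P) :
    (∫ ω, X ω ∂P) ^ 2 ≤ ∫ ω, X ω ^ 2 ∂P := by
  have h1 := variance_nonneg X P
  rw [variance_eq_sub h] at h1
  simpa using h1

/-- Positivity of the periodogram of the covariance measure. -/
lemma IsStationarySqRandomMeasure.integral_covariogram_mul_cosWave_le [IsProbabilityMeasure P]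
    (hΦ : IsStationarySqRandomMeasure P Φ) {B : Set (Space d)} (hB : MeasurableSet B)
    (hb : Bornology.IsBounded B) (k : Space d) :
    intensity P Φ ^ 2 * ∫ u, (covariogram B u).toReal * cosWave k u ≤
      ∫ u, (covariogram B u).toReal * cosWave k u ∂reducedSecondMoment P Φ := by
  have := hΦ.sigmaFinite
  have hR := hΦ.isRandomMeasure
  have hM2 := hΦ.secondMoment_prod_lt_top hb hb hB hB
  have hmap : hR.secondMoment.map (fun p => (p.1, p.2 - p.1)) =
      volume.prod (reducedSecondMoment P Φ) := hΦ.diffMoment_eq_prod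
  rw [← setIntegral_prod_cosWave_sub_eq hmap hB hM2,
    integral_covariogram_mul_cosWave hB hb.measure_lt_top]
  have hmean : ∀ f : Space d → ℝ, Continuous f → (∀ x, |f x| ≤ 1) →
      ∫ ω, ∫ x in B, f x ∂Φ ω ∂P = intensity P Φ * ∫ x in B, f x ∧
      MemLp (fun ω => ∫ x in B, f x ∂Φ ω) 2 P := by
    intro f hf hf1
    have hae : (fun ω => ∫ x, B.indicator f x ∂hR.version ω) =ᵐ[P]
        fun ω => ∫ x in B, f x ∂Φ ω := by
      filter_upwards [hR.version_ae_eq] with ω hω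
      rw [hω, integral_indicator hB]
    have hfin : hR.mean B < ∞ := by
      rw [hR.mean_apply hB]
      exact hΦ.squareIntegrable.lintegral_lt_top hb hB
    have hint : Integrable (B.indicator f) (P.bind hR.version) := by
      rw [integrable_indicator_iff hB]
      exact Measure.integrableOn_of_bounded hfin.ne hf.aestronglyMeasurable (ae_of_all _ hf1)
    obtain ⟨h1, h2⟩ := integral_bind_kernel P hR.version hint
    refine ⟨?_, ?_⟩
    · rw [← integral_congr_ae hae, ← h1, integral_indicator hB]
      change ∫ x in B, f x ∂hR.mean = _
      rw [hΦ.mean_eq, Measure.restrict_smul, integral_smul_measure,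
        ENNReal.toReal_ofReal intensity_nonneg, smul_eq_mul]
    · have hsm : AEStronglyMeasurable (fun ω => ∫ x in B, f x ∂Φ ω) P :=
        h2.aestronglyMeasurable.congr hae
      have hle : ∫⁻ ω, ‖∫ x in B, f x ∂Φ ω‖ₑ ^ 2 ∂P ≤ ∫⁻ ω, Φ ω B ^ 2 ∂P := by
        refine lintegral_mono fun ω => ?_
        gcongr
        refine (enorm_integral_le_lintegral_enorm _).trans ?_
        calc ∫⁻ x in B, ‖f x‖ₑ ∂Φ ω ≤ ∫⁻ _x in B, 1 ∂Φ ω := lintegral_mono fun x => by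
              rw [Real.enorm_eq_ofReal_abs]
              exact ENNReal.ofReal_le_one.2 (hf1 x)
          _ = Φ ω B := by simp
      refine ⟨hsm, ?_⟩
      rw [eLpNorm_lt_top_iff_lintegral_rpow_enorm_lt_top (by norm_num) (by norm_num)]
      refine lt_of_le_of_lt ?_ (hΦ.squareIntegrable B hb hB)
      simpa using hle
  obtain ⟨c1, c2⟩ := hmean (cosWave k) (continuous_cosWave_right k) (abs_cosWave_le k)
  obtain ⟨s1, s2⟩ := hmean (sinWave k) (continuous_sinWave_right k) (abs_sinWave_le k)
  have hint : Integrable ((B ×ˢ B).indicator fun p : Space d × Space d => cosWave k (p.2 - p.1))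
      (P.bind hR.versionProd) := by
    rw [integrable_indicator_iff (hB.prod hB)]
    exact Measure.integrableOn_of_bounded hM2.ne
      ((continuous_cosWave_right k).comp (by fun_prop)).aestronglyMeasurable
      (ae_of_all _ fun p => abs_cosWave_le k _)
  have hfinB : ∀ᵐ ω ∂P, Φ ω B < ∞ := by
    filter_upwards [hR.ae_locallyFinite] with ω hω
    exact hb.measure_lt_top
  have h2 : ∫ p in B ×ˢ B, cosWave k (p.2 - p.1) ∂hR.secondMoment =
      ∫ ω, ((∫ x in B, cosWave k x ∂Φ ω) ^ 2 + (∫ x in B, sinWave k x ∂Φ ω) ^ 2) ∂P := by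
    rw [← integral_indicator (hB.prod hB)]
    refine (integral_bind_kernel P hR.versionProd hint).1.trans (integral_congr_ae ?_)
    filter_upwards [hR.versionProd_ae_eq, hfinB, hR.ae_locallyFinite] with ω h1 h2 h3
    rw [h1, integral_indicator (hB.prod hB), setIntegral_prod_cosWave_sub _ h2]
  have e1 := sq_integral_le_integral_sq c2
  have e2 := sq_integral_le_integral_sq s2
  rw [h2, integral_add c2.integrable_sq s2.integrable_sq]
  rw [c1] at e1
  rw [s1] at e2
  nlinarith

end Positivity

section TranslationBounded

variable {d : ℕ}

/-- The weight `(1 + ‖x‖)^(-s)`. -/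
noncomputable def decayWeight (s : ℝ) (x : Space d) : ℝ≥0∞ := ENNReal.ofReal ((1 + ‖x‖) ^ (-s))

lemma measurable_decayWeight (s : ℝ) : Measurable (decayWeight (d := d) s) := by
  unfold decayWeight; fun_prop

lemma lintegral_decayWeight_lt_top {s : ℝ} (hs : (d : ℝ) < s) :
    ∫⁻ x : Space d, decayWeight s x < ∞ := by
  have h := integrable_one_add_norm (E := Space d) (μ := volume) (r := s) (by simpa using hs)
  have h2 := h.lintegral_lt_top
  exact h2

lemma decayWeight_le_of_dist_le {s : ℝ} (hs : 0 ≤ s) {x u : Space d} (h : dist x u ≤ 1) :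
    decayWeight s u ≤ ENNReal.ofReal (2 ^ s) * decayWeight s x := by
  rw [decayWeight, decayWeight, ← ENNReal.ofReal_mul (by positivity)]
  refine ENNReal.ofReal_le_ofReal ?_
  have h1 : 1 + ‖x‖ ≤ 2 * (1 + ‖u‖) := by
    have : ‖x‖ ≤ ‖u‖ + dist x u := by
      rw [dist_eq_norm]; simpa using norm_add_le u (x - u)
    linarith [norm_nonneg u]
  have h2 : (0 : ℝ) < 1 + ‖u‖ := by positivity
  have h3 : (0 : ℝ) < 1 + ‖x‖ := by positivity
  rw [Real.rpow_neg h2.le, Real.rpow_neg h3.le, ← div_eq_mul_inv,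
    inv_le_comm₀ (by positivity) (by positivity), inv_div, div_le_iff₀ (by positivity), mul_comm,
    ← Real.mul_rpow (by norm_num) h2.le]
  exact Real.rpow_le_rpow h3.le h1 hs

lemma lintegral_decayWeight_le (ν : Measure (Space d)) [SFinite ν] {C : ℝ≥0∞}
    (hC : ∀ v, ν (Metric.closedBall v 1) ≤ C) {s : ℝ} (hs : 0 ≤ s) :
    (∫⁻ u, decayWeight s u ∂ν) * volume (Metric.closedBall (0 : Space d) 1) ≤
      ENNReal.ofReal (2 ^ s) * C * ∫⁻ x : Space d, decayWeight s x := by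
  set D : Set (Space d × Space d) := {q | dist q.2 q.1 ≤ 1} with hD
  have hDm : MeasurableSet D :=
    (isClosed_le (by fun_prop : Continuous fun q : Space d × Space d => dist q.2 q.1)
      continuous_const).measurableSet
  have hm : Measurable fun q : Space d × Space d =>
      D.indicator (1 : Space d × Space d → ℝ≥0∞) q * decayWeight s q.2 :=
    (measurable_one.indicator hDm).mul ((measurable_decayWeight s).comp measurable_snd)
  have hball : ∀ u : Space d, MeasurableSet (Metric.closedBall u 1) := fun u =>
    Metric.isClosed_closedBall.measurableSet
  calc (∫⁻ u, decayWeight s u ∂ν) * volume (Metric.closedBall (0 : Space d) 1)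
      = ∫⁻ u, decayWeight s u * volume (Metric.closedBall u 1) ∂ν := by
        rw [← lintegral_mul_const _ (measurable_decayWeight s)]
        refine lintegral_congr fun u => ?_
        rw [Measure.addHaar_closedBall_center volume u 1]
    _ ≤ ∫⁻ u, ENNReal.ofReal (2 ^ s) * (∫⁻ x, D.indicator 1 (u, x) * decayWeight s x) ∂ν := by
        refine lintegral_mono fun u => ?_
        rw [← lintegral_const_mul' _ _ ENNReal.ofReal_ne_top, ← setLIntegral_const,
          ← lintegral_indicator (hball u)]
        refine lintegral_mono fun x => ?_
        by_cases hx : dist x u ≤ 1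
        · rw [Set.indicator_of_mem (Metric.mem_closedBall.2 hx),
            Set.indicator_of_mem (show (u, x) ∈ D from hx), Pi.one_apply, one_mul]
          exact decayWeight_le_of_dist_le hs hx
        · rw [Set.indicator_of_notMem (fun h => hx (Metric.mem_closedBall.1 h))]
          exact zero_le
    _ = ENNReal.ofReal (2 ^ s) * ∫⁻ x, (∫⁻ u, D.indicator 1 (u, x) * decayWeight s x ∂ν) := by
        rw [lintegral_const_mul' _ _ ENNReal.ofReal_ne_top, lintegral_lintegral_swap hm.aemeasurable]
    _ ≤ ENNReal.ofReal (2 ^ s) * ∫⁻ x : Space d, C * decayWeight s x := by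
        gcongr with x
        have hmx : Measurable fun u => D.indicator (1 : Space d × Space d → ℝ≥0∞) (u, x) :=
          (measurable_one.indicator hDm).comp measurable_prodMk_right
        rw [lintegral_mul_const _ hmx]
        gcongr
        refine le_trans (le_of_eq ?_) (hC x)
        rw [← lintegral_indicator_one (hball x)]
        refine lintegral_congr fun u => ?_
        have : (u, x) ∈ D ↔ u ∈ Metric.closedBall x 1 := by
          rw [Metric.mem_closedBall, dist_comm]; rfl
        by_cases hu : u ∈ Metric.closedBall x 1
        · rw [Set.indicator_of_mem hu, Set.indicator_of_mem (this.2 hu)]; rfl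
        · rw [Set.indicator_of_notMem hu, Set.indicator_of_notMem (mt this.1 hu)]
    _ = _ := by
        rw [lintegral_const_mul _ (measurable_decayWeight s), mul_assoc]

lemma exp_neg_pi_mul_sq_le {s t : ℝ} (hs : 0 ≤ s) (ht : 0 ≤ t) :
    Real.exp (-Real.pi * t ^ 2) ≤ Real.exp (s ^ 2 / (4 * Real.pi)) * (1 + t) ^ (-s) := by
  have h1 : (1 + t) ^ s ≤ Real.exp (s * t) := by
    rw [mul_comm, Real.exp_mul]
    exact Real.rpow_le_rpow (by positivity) (by linarith [Real.add_one_le_exp t]) hs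
  have h2 : s * t ≤ Real.pi * t ^ 2 + s ^ 2 / (4 * Real.pi) := by
    have hp := Real.pi_pos
    have : 0 ≤ (2 * Real.pi * t - s) ^ 2 / (4 * Real.pi) := by positivity
    have e : (2 * Real.pi * t - s) ^ 2 / (4 * Real.pi) =
        Real.pi * t ^ 2 - s * t + s ^ 2 / (4 * Real.pi) := by
      field_simp
      ring
    linarith
  rw [Real.rpow_neg (by positivity), ← div_eq_mul_inv, le_div_iff₀ (by positivity)]
  calc Real.exp (-Real.pi * t ^ 2) * (1 + t) ^ s
      ≤ Real.exp (-Real.pi * t ^ 2) * Real.exp (s * t) := by gcongr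
    _ = Real.exp (-Real.pi * t ^ 2 + s * t) := (Real.exp_add _ _).symm
    _ ≤ _ := Real.exp_le_exp.2 (by linarith)

/-- The Gaussian `x ↦ exp (-π ‖x‖²)`. -/
noncomputable def gaussWeight (x : Space d) : ℝ := Real.exp (-Real.pi * ‖x‖ ^ 2)

lemma continuous_gaussWeight : Continuous (gaussWeight (d := d)) := by
  unfold gaussWeight; fun_prop

lemma gaussWeight_pos (x : Space d) : 0 < gaussWeight x := Real.exp_pos _

lemma integrable_gaussWeight_of_closedBall_le (ν : Measure (Space d)) [SFinite ν] {C : ℝ≥0∞}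
    (hCt : C < ∞) (hC : ∀ v, ν (Metric.closedBall v 1) ≤ C) : Integrable gaussWeight ν := by
  refine ⟨continuous_gaussWeight.aestronglyMeasurable, ?_⟩
  have hs : (d : ℝ) < d + 1 := by linarith
  have hs0 : (0 : ℝ) ≤ d + 1 := by positivity
  have hdec : ∫⁻ u, decayWeight ((d : ℝ) + 1) u ∂ν < ∞ := by
    have h := lintegral_decayWeight_le ν hC hs0
    have h2 : (∫⁻ u, decayWeight ((d : ℝ) + 1) u ∂ν) *
        volume (Metric.closedBall (0 : Space d) 1) < ∞ :=
      h.trans_lt (ENNReal.mul_lt_top (ENNReal.mul_lt_top ENNReal.ofReal_lt_top hCt)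
        (lintegral_decayWeight_lt_top hs))
    by_contra hc
    rw [not_lt_top_iff] at hc
    rw [hc, ENNReal.top_mul (Metric.measure_closedBall_pos volume _ one_pos).ne'] at h2
    exact lt_irrefl _ h2
  refine lt_of_le_of_lt (b := ∫⁻ u, ENNReal.ofReal
    (Real.exp (((d : ℝ) + 1) ^ 2 / (4 * Real.pi))) * decayWeight ((d : ℝ) + 1) u ∂ν)
    (lintegral_mono fun u => ?_) ?_
  · rw [Real.enorm_of_nonneg (gaussWeight_pos u).le, decayWeight,
      ← ENNReal.ofReal_mul (Real.exp_pos _).le]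
    exact ENNReal.ofReal_le_ofReal (exp_neg_pi_mul_sq_le hs0 (norm_nonneg u))
  · rw [lintegral_const_mul' _ _ ENNReal.ofReal_ne_top]
    exact ENNReal.mul_lt_top ENNReal.ofReal_lt_top hdec

lemma integrable_gaussWeight : Integrable (gaussWeight (d := d)) :=
  integrable_gaussWeight_of_closedBall_le volume
    (C := volume (Metric.closedBall (0 : Space d) 1)) measure_closedBall_lt_top fun v => by
      rw [Measure.addHaar_closedBall_center]

lemma measure_closedBall_le_lintegral_gaussWeight (ν : Measure (Space d)) (v : Space d) :
    ν (Metric.closedBall v 1) ≤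
      ENNReal.ofReal (Real.exp Real.pi) * ∫⁻ k, ENNReal.ofReal (gaussWeight (k - v)) ∂ν := by
  rw [← lintegral_const_mul' _ _ ENNReal.ofReal_ne_top,
    ← lintegral_indicator_one Metric.isClosed_closedBall.measurableSet]
  refine lintegral_mono fun k => ?_
  by_cases hk : k ∈ Metric.closedBall v 1
  · rw [Set.indicator_of_mem hk, Pi.one_apply, ← ENNReal.ofReal_mul (Real.exp_pos _).le,
      gaussWeight, ← Real.exp_add, ENNReal.one_le_ofReal, Real.one_le_exp_iff]
    rw [mem_closedBall_iff_norm] at hk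
    have h1 : ‖k - v‖ ^ 2 ≤ 1 := pow_le_one₀ (norm_nonneg _) hk
    nlinarith [Real.pi_pos]
  · rw [Set.indicator_of_notMem hk]
    exact zero_le

end TranslationBounded

section Periodogram

variable {d : ℕ}

lemma cosWave_comm (k x : Space d) : cosWave k x = cosWave x k := by
  rw [cosWave, cosWave, real_inner_comm]

lemma sinWave_comm (k x : Space d) : sinWave k x = sinWave x k := by
  rw [sinWave, sinWave, real_inner_comm]

lemma integral_gaussWeight_mul (w : Space d) :
    ∫ v, gaussWeight v * cosWave w v = gaussWeight w ∧
    ∫ v, gaussWeight v * sinWave w v = 0 := by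
  have h := fourier_gaussian_innerProductSpace (V := Space d) (b := Real.pi)
    (by simpa using Real.pi_pos) w
  have hp : (Real.pi : ℂ) ≠ 0 := by exact_mod_cast Real.pi_ne_zero
  rw [div_self hp, Complex.one_cpow, one_mul, Real.fourier_eq'] at h
  have h2 : ∀ v : Space d, Complex.exp (↑(-2 * Real.pi * inner ℝ v w) * Complex.I) •
      Complex.exp (-(Real.pi : ℂ) * (‖v‖ : ℂ) ^ 2) =
      ((gaussWeight v * cosWave w v : ℝ) : ℂ) -
        ((gaussWeight v * sinWave w v : ℝ) : ℂ) * Complex.I := by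
    intro v
    rw [Complex.exp_mul_I, ← Complex.ofReal_cos, ← Complex.ofReal_sin]
    have : Complex.exp (-(Real.pi : ℂ) * (‖v‖ : ℂ) ^ 2) = (gaussWeight v : ℂ) := by
      rw [gaussWeight]; push_cast; rfl
    rw [this, cosWave, sinWave, real_inner_comm w v,
      show -2 * Real.pi * inner ℝ w v = -(2 * Real.pi * inner ℝ w v) by ring, Real.cos_neg,
      Real.sin_neg]
    push_cast
    rw [smul_eq_mul]
    ring
  simp only [h2] at h
  have i1 : Integrable fun v : Space d => gaussWeight v * cosWave w v :=
    integrable_gaussWeight.mul_bdd (c := 1) (continuous_cosWave_right w).aestronglyMeasurable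
      (ae_of_all _ fun v => abs_cosWave_le w v)
  have i2 : Integrable fun v : Space d => gaussWeight v * sinWave w v :=
    integrable_gaussWeight.mul_bdd (c := 1) (continuous_sinWave_right w).aestronglyMeasurable
      (ae_of_all _ fun v => abs_sinWave_le w v)
  rw [integral_sub i1.ofReal (i2.ofReal.mul_const _), integral_mul_const, integral_complex_ofReal,
    integral_complex_ofReal] at h
  have h3 : Complex.exp (-(Real.pi : ℂ) ^ 2 * (‖w‖ : ℂ) ^ 2 / Real.pi) = (gaussWeight w : ℂ) := by
    rw [gaussWeight]
    push_cast
    congr 1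
    field_simp
  rw [h3] at h
  refine ⟨?_, ?_⟩
  · simpa using congrArg Complex.re h
  · simpa using congrArg Complex.im h

lemma integral_gaussWeight_sub_mul_cosWave (k₀ u : Space d) :
    ∫ k, gaussWeight (k - k₀) * cosWave k u = cosWave k₀ u * gaussWeight u := by
  have h := integral_gaussWeight_mul u
  have i1 : Integrable fun v : Space d => gaussWeight v * cosWave u v :=
    integrable_gaussWeight.mul_bdd (c := 1) (continuous_cosWave_right u).aestronglyMeasurable
      (ae_of_all _ fun v => abs_cosWave_le u v)
  have i2 : Integrable fun v : Space d => gaussWeight v * sinWave u v :=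
    integrable_gaussWeight.mul_bdd (c := 1) (continuous_sinWave_right u).aestronglyMeasurable
      (ae_of_all _ fun v => abs_sinWave_le u v)
  rw [← integral_add_right_eq_self _ k₀]
  have e : ∀ k : Space d, gaussWeight (k + k₀ - k₀) * cosWave (k + k₀) u =
      cosWave k₀ u * (gaussWeight k * cosWave u k) -
        sinWave k₀ u * (gaussWeight k * sinWave u k) := fun k => by
    rw [cosWave_comm (k + k₀), cosWave_add, add_sub_cancel_right, cosWave_comm k₀,
      sinWave_comm k₀]
    ring
  simp only [e]
  rw [integral_sub (i1.const_mul _) (i2.const_mul _), integral_const_mul, integral_const_mul, h.1,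
    h.2, mul_zero, sub_zero]

/-- The cosine transform of a finite measure. -/
noncomputable def cosTransform (μ : Measure (Space d)) (k : Space d) : ℝ := ∫ u, cosWave k u ∂μ

lemma continuous_cosTransform (μ : Measure (Space d)) [IsFiniteMeasure μ] :
    Continuous (cosTransform μ) := by
  refine continuous_of_dominated (bound := fun _ => 1)
    (fun k => (continuous_cosWave_right k).aestronglyMeasurable)
    (fun k => ae_of_all _ fun u => abs_cosWave_le k u) (integrable_const _)
    (ae_of_all _ fun u => ?_)
  simp only [cosWave_comm _ u]
  exact continuous_cosWave_right u

lemma abs_cosTransform_le (μ : Measure (Space d)) [IsFiniteMeasure μ] (k : Space d) :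
    |cosTransform μ k| ≤ μ.real Set.univ := by
  have := norm_integral_le_of_norm_le_const (μ := μ) (f := cosWave k) (C := 1)
    (ae_of_all _ fun u => abs_cosWave_le k u)
  simpa [cosTransform] using this

lemma integral_integral_mul_cosWave (μ : Measure (Space d)) [IsFiniteMeasure μ]
    {q : Space d → ℝ} (hq : Integrable q) :
    ∫ u, (∫ k, q k * cosWave k u) ∂μ = ∫ k, q k * cosTransform μ k := by
  rw [integral_integral_swap]
  · simp only [cosTransform, integral_const_mul]
  · refine (hq.comp_snd μ).mul_bdd (c := 1) ?_ (ae_of_all _ fun p => abs_cosWave_le p.2 p.1)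
    exact (continuous_cosWave.comp continuous_swap).aestronglyMeasurable

end Periodogram

section WindowSpectrum

variable {d : ℕ} {W : Set (Space d)}

lemma covariogram_neg (B : Set (Space d)) (v : Space d) :
    covariogram B (-v) = covariogram B v := by
  rw [covariogram, covariogram, ← measure_preimage_add_right volume v]
  congr 1
  ext x
  simp [and_comm]

lemma normCov_neg (B : Set (Space d)) (v : Space d) : normCov B (-v) = normCov B v := by
  rw [normCov, normCov, covariogram_neg]

lemma covariogram_add_covariogram_le {B : Set (Space d)} (hB : MeasurableSet B)
    (v v' : Space d) : covariogram B v + covariogram B (v' - v) ≤ covariogram B v' + volume B := by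
  have hm : ∀ w : Space d, MeasurableSet ((fun x => x + w) ⁻¹' B) := fun w =>
    hB.preimage (by fun_prop)
  have h1 : covariogram B (v' - v) =
      volume ((fun x => x + v) ⁻¹' B ∩ (fun x => x + v') ⁻¹' B) := by
    rw [covariogram, ← measure_preimage_add_right volume v]
    congr 1
    ext x
    simp
  have h2 : volume ((fun x => x + v) ⁻¹' B) = volume B := measure_preimage_add_right volume v B
  rw [h1, ← h2, covariogram, covariogram, ← measure_union_add_inter _ ((hm v).inter (hm v')),
    add_comm]
  refine add_le_add (measure_mono ?_) (measure_mono ?_)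
  · rintro x ⟨⟨h3, _⟩, _, h4⟩
    exact ⟨h3, h4⟩
  · rintro x (⟨_, h⟩ | ⟨h, _⟩) <;> exact h

lemma toReal_normCov_le_one (B : Set (Space d)) (v : Space d) : (normCov B v).toReal ≤ 1 := by
  simpa using ENNReal.toReal_mono ENNReal.one_ne_top (normCov_le_one B v)

lemma normCov_ne_top (B : Set (Space d)) (v : Space d) : normCov B v ≠ ∞ :=
  ((normCov_le_one B v).trans_lt ENNReal.one_lt_top).ne

lemma IsWindow.toReal_normCov_sub_le (hW : IsWindow W) (v v' : Space d) :
    |(normCov W v).toReal - (normCov W v').toReal| ≤ 1 - (normCov W (v' - v)).toReal := by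
  have key : ∀ v v', (normCov W v).toReal - (normCov W v').toReal ≤
      1 - (normCov W (v' - v)).toReal := by
    intro v v'
    have h := ENNReal.div_le_div_right (covariogram_add_covariogram_le hW.measurableSet v v')
      (volume W)
    rw [ENNReal.add_div, ENNReal.add_div,
      ENNReal.div_self hW.volume_pos.ne' hW.volume_lt_top.ne] at h
    change normCov W v + normCov W (v' - v) ≤ normCov W v' + 1 at h
    have h2 := ENNReal.toReal_mono (by simp [normCov_ne_top]) h
    rw [ENNReal.toReal_add (normCov_ne_top _ _) (normCov_ne_top _ _),
      ENNReal.toReal_add (normCov_ne_top _ _) ENNReal.one_ne_top, ENNReal.toReal_one] at h2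
    linarith
  refine abs_sub_le_iff.2 ⟨key v v', ?_⟩
  have := key v' v
  rwa [← normCov_neg W (v - v'), neg_sub] at this

lemma IsWindow.continuous_toReal_normCov (hW : IsWindow W) :
    Continuous fun v => (normCov W v).toReal := by
  obtain ⟨ρ, hρ, hb⟩ := hW.exists_closedBall_subset
  refine continuous_iff_continuousAt.2 fun v => ?_
  rw [ContinuousAt, tendsto_iff_norm_sub_tendsto_zero]
  have h1 : Tendsto (fun v' : Space d => 1 - (1 - ‖v - v'‖ / ρ) ^ d) (𝓝 v)
      (𝓝 (1 - (1 - ‖v - v‖ / ρ) ^ d)) := Continuous.tendsto (by fun_prop) v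
  simp only [sub_self, norm_zero, zero_div, sub_zero, one_pow] at h1
  refine squeeze_zero' (Eventually.of_forall fun _ => norm_nonneg _) ?_ h1
  filter_upwards [Metric.closedBall_mem_nhds v hρ] with v' hv'
  rw [Metric.mem_closedBall, dist_comm, dist_eq_norm] at hv'
  refine (hW.toReal_normCov_sub_le v' v).trans ?_
  have h2 := ENNReal.toReal_mono (normCov_ne_top _ _) (hW.le_normCov hρ hb hv')
  rw [ENNReal.toReal_ofReal] at h2
  · linarith
  · have : ‖v - v'‖ / ρ ≤ 1 := (div_le_one hρ).2 hv'
    have h3 : 0 ≤ 1 - ‖v - v'‖ / ρ := by linarith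
    positivity

/-- A measure weighted by the normalized covariogram of `B`. -/
noncomputable def covWeighted (α : Measure (Space d)) (B : Set (Space d)) : Measure (Space d) :=
  α.withDensity (normCov B)

lemma integral_covWeighted (α : Measure (Space d)) {B : Set (Space d)} (hB : MeasurableSet B)
    (f : Space d → ℝ) :
    ∫ u, f u ∂covWeighted α B = ∫ u, (normCov B u).toReal * f u ∂α := by
  rw [covWeighted, integral_withDensity_eq_integral_toReal_smul (measurable_normCov hB)
    (ae_of_all _ fun u => (normCov_ne_top _ _).lt_top)]
  rfl

lemma IsWindow.isFiniteMeasure_covWeighted (hW : IsWindow W) :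
    IsFiniteMeasure (covWeighted volume W) := by
  refine isFiniteMeasure_withDensity ?_
  have := lintegral_normCov_volume hW 0
  simp only [add_zero] at this
  rw [this]
  exact hW.volume_lt_top.ne

/-- The Fourier transform of the normalized covariogram of a window. -/
noncomputable def windowSpectrum (W : Set (Space d)) : Space d → ℝ :=
  cosTransform (covWeighted volume W)

lemma cosTransform_covWeighted (α : Measure (Space d)) {B : Set (Space d)} (hB : MeasurableSet B)
    (k : Space d) : cosTransform (covWeighted α B) k =
      (volume B).toReal⁻¹ * ∫ u, (covariogram B u).toReal * cosWave k u ∂α := by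
  rw [cosTransform, integral_covWeighted α hB, ← integral_const_mul]
  refine integral_congr_ae (ae_of_all _ fun u => ?_)
  simp only [normCov, ENNReal.toReal_div]
  ring

lemma IsWindow.windowSpectrum_eq (hW : IsWindow W) (k : Space d) :
    windowSpectrum W k =
      ((∫ x in W, cosWave k x) ^ 2 + (∫ x in W, sinWave k x) ^ 2) / (volume W).toReal := by
  rw [windowSpectrum, cosTransform_covWeighted _ hW.measurableSet,
    integral_covariogram_mul_cosWave hW.measurableSet hW.volume_lt_top]
  ring

lemma IsWindow.windowSpectrum_nonneg (hW : IsWindow W) (k : Space d) : 0 ≤ windowSpectrum W k := by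
  rw [hW.windowSpectrum_eq]
  positivity

lemma IsWindow.continuous_windowSpectrum (hW : IsWindow W) : Continuous (windowSpectrum W) := by
  have := hW.isFiniteMeasure_covWeighted
  exact continuous_cosTransform _

lemma IsWindow.integrable_toReal_normCov (hW : IsWindow W) :
    Integrable fun v => (normCov W v).toReal := by
  refine integrable_toReal_of_lintegral_ne_top (measurable_normCov hW.measurableSet).aemeasurable ?_
  have := lintegral_normCov_volume hW 0
  simp only [add_zero] at this
  rw [this]
  exact hW.volume_lt_top.ne

open FourierTransform in
lemma IsWindow.fourier_normCov (hW : IsWindow W) :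
    𝓕 (fun v => ((normCov W v).toReal : ℂ)) = fun k => (windowSpectrum W k : ℂ) := by
  ext k
  rw [Real.fourier_eq']
  have h2 : ∀ v : Space d, Complex.exp (↑(-2 * Real.pi * inner ℝ v k) * Complex.I) •
      ((normCov W v).toReal : ℂ) = (((normCov W v).toReal * cosWave k v : ℝ) : ℂ) -
        (((normCov W v).toReal * sinWave k v : ℝ) : ℂ) * Complex.I := by
    intro v
    rw [Complex.exp_mul_I, ← Complex.ofReal_cos, ← Complex.ofReal_sin, cosWave, sinWave,
      real_inner_comm k v,
      show -2 * Real.pi * inner ℝ k v = -(2 * Real.pi * inner ℝ k v) by ring, Real.cos_neg,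
      Real.sin_neg]
    push_cast
    rw [smul_eq_mul]
    ring
  simp only [h2]
  have hi := hW.integrable_toReal_normCov
  have i1 : Integrable fun v : Space d => (normCov W v).toReal * cosWave k v :=
    hi.mul_bdd (c := 1) (continuous_cosWave_right k).aestronglyMeasurable
      (ae_of_all _ fun v => abs_cosWave_le k v)
  have i2 : Integrable fun v : Space d => (normCov W v).toReal * sinWave k v :=
    hi.mul_bdd (c := 1) (continuous_sinWave_right k).aestronglyMeasurable
      (ae_of_all _ fun v => abs_sinWave_le k v)
  have hodd : ∫ v, (normCov W v).toReal * sinWave k v = 0 := by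
    have := integral_neg_eq_self (fun v => (normCov W v).toReal * sinWave k v) volume
    simp only [normCov_neg, sinWave_neg, mul_neg, integral_neg] at this
    linarith
  rw [integral_sub i1.ofReal (i2.ofReal.mul_const _), integral_mul_const, integral_complex_ofReal,
    integral_complex_ofReal, hodd, windowSpectrum, cosTransform,
    integral_covWeighted _ hW.measurableSet]
  simp

open FourierTransform in
lemma IsWindow.normCov_eq_integral (hW : IsWindow W) (hq : Integrable (windowSpectrum W))
    (v : Space d) : (normCov W v).toReal = ∫ k, windowSpectrum W k * cosWave k v := by
  have hc : Continuous fun v => ((normCov W v).toReal : ℂ) :=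
    Complex.continuous_ofReal.comp hW.continuous_toReal_normCov
  have h := congrFun (hc.fourierInv_fourier_eq hW.integrable_toReal_normCov.ofReal
    (by rw [hW.fourier_normCov]; exact hq.ofReal)) v
  rw [hW.fourier_normCov, Real.fourierInv_eq'] at h
  have h2 : ∀ k : Space d, Complex.exp (↑(2 * Real.pi * inner ℝ k v) * Complex.I) •
      (windowSpectrum W k : ℂ) = ((windowSpectrum W k * cosWave k v : ℝ) : ℂ) +
        ((windowSpectrum W k * sinWave k v : ℝ) : ℂ) * Complex.I := by
    intro k
    rw [Complex.exp_mul_I, ← Complex.ofReal_cos, ← Complex.ofReal_sin, cosWave, sinWave]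
    push_cast
    rw [smul_eq_mul]
    ring
  simp only [h2] at h
  have c1 : Continuous fun k => cosWave k v := by
    simp only [cosWave_comm _ v]; exact continuous_cosWave_right v
  have c2 : Continuous fun k => sinWave k v := by
    simp only [sinWave_comm _ v]; exact continuous_sinWave_right v
  have i1 : Integrable fun k : Space d => windowSpectrum W k * cosWave k v :=
    hq.mul_bdd (c := 1) c1.aestronglyMeasurable (ae_of_all _ fun k => abs_cosWave_le k v)
  have i2 : Integrable fun k : Space d => windowSpectrum W k * sinWave k v :=
    hq.mul_bdd (c := 1) c2.aestronglyMeasurable (ae_of_all _ fun k => abs_sinWave_le k v)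
  rw [integral_add i1.ofReal (i2.ofReal.mul_const _), integral_mul_const, integral_complex_ofReal,
    integral_complex_ofReal] at h
  simpa using (congrArg Complex.re h).symm

lemma integral_cosWave_add (η : Measure (Space d)) [IsFiniteMeasure η]
    (hη : η.map (fun w => -w) = η) (k u : Space d) :
    ∫ w, cosWave k (u + w) ∂η = cosWave k u * cosTransform η k := by
  simp only [cosWave_add]
  have hodd : ∫ w, sinWave k w ∂η = 0 := by
    have h : ∫ w, sinWave k w ∂η = ∫ w, sinWave k (-w) ∂η := by
      conv_lhs => rw [← hη]
      exact integral_map measurable_neg.aemeasurable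
        (continuous_sinWave_right k).aestronglyMeasurable
    simp only [sinWave_neg, integral_neg] at h
    linarith
  rw [integral_sub ((integrable_cosWave η k).const_mul _) ((integrable_sinWave η k).const_mul _),
    integral_const_mul, integral_const_mul, hodd, mul_zero, sub_zero]
  rfl

lemma IsWindow.covDefect_eq_integral (hW : IsWindow W) (hq : Integrable (windowSpectrum W))
    (η : Measure (Space d)) [IsProbabilityMeasure η] (hη : η.map (fun w => -w) = η)
    (u : Space d) :
    covDefect η W u =
      ∫ k, (windowSpectrum W k * (1 - cosTransform η k)) * cosWave k u := by
  have hc : Continuous fun k => cosWave k u := by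
    simp only [cosWave_comm _ u]; exact continuous_cosWave_right u
  have h1 : (avgNormCov η W u).toReal =
      ∫ k, windowSpectrum W k * cosTransform η k * cosWave k u := by
    have hm : Measurable fun w => normCov W (u + w) :=
      (measurable_normCov hW.measurableSet).comp (measurable_const_add u)
    rw [avgNormCov, ← integral_toReal hm.aemeasurable
      (ae_of_all _ fun w => (normCov_ne_top _ _).lt_top)]
    simp only [hW.normCov_eq_integral hq]
    rw [integral_integral_swap]
    · refine integral_congr_ae (ae_of_all _ fun k => ?_)
      simp only
      rw [integral_const_mul, integral_cosWave_add η hη]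
      ring
    · refine (hq.comp_snd η).mul_bdd (c := 1) ?_
        (ae_of_all _ fun p => abs_cosWave_le p.2 (u + p.1))
      have : Continuous fun p : Space d × Space d => cosWave p.2 (u + p.1) := by
        unfold cosWave; fun_prop
      exact this.aestronglyMeasurable
  have i1 : Integrable fun k => windowSpectrum W k * cosWave k u :=
    hq.mul_bdd (c := 1) hc.aestronglyMeasurable (ae_of_all _ fun k => abs_cosWave_le k u)
  have hb : ∀ k, |cosTransform η k| ≤ 1 := fun k => by
    simpa using abs_cosTransform_le η k
  have i2 : Integrable fun k => windowSpectrum W k * cosTransform η k * cosWave k u :=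
    (hq.mul_bdd (c := 1) (continuous_cosTransform η).aestronglyMeasurable
      (ae_of_all _ hb)).mul_bdd (c := 1) hc.aestronglyMeasurable
      (ae_of_all _ fun k => abs_cosWave_le k u)
  rw [covDefect, hW.normCov_eq_integral hq, h1, ← integral_sub i1 i2]
  refine integral_congr_ae (ae_of_all _ fun k => ?_)
  simp only
  ring

/-- The decay of the spectrum of a dilated Fourier smooth window. -/
lemma IsWindow.windowSpectrum_smul_le (hW : IsWindow W) {c ϑ : ℝ}
    (h : ∀ k : Space d, ‖∫ x in W, Complex.exp (-Complex.I * ((inner ℝ k x : ℝ) : ℂ))‖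
      ≤ c * (1 + ‖k‖) ^ (-((d : ℝ) + ϑ) / 2)) {r : ℝ} (hr : 0 < r) (k : Space d) :
    windowSpectrum (r • W) k ≤ c ^ 2 / (volume W).toReal * r ^ d *
      (1 + 2 * Real.pi * r * ‖k‖) ^ (-((d : ℝ) + ϑ)) := by
  have hp := Real.pi_pos
  have hvol : (volume (r • W)).toReal = r ^ d * (volume W).toReal := by
    rw [volume_smul_window W hr.le, ENNReal.toReal_mul, ENNReal.toReal_ofReal (by positivity)]
  have hcs : ∀ f : Space d → ℝ, ∫ x in r • W, f x = r ^ d * ∫ x in W, f (r • x) := fun f => by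
    rw [Measure.setIntegral_comp_smul_of_pos volume f W hr, finrank_euclideanSpace_fin, smul_eq_mul,
      mul_inv_cancel_left₀ (by positivity)]
  have hF : (∫ x in W, cosWave k (r • x)) ^ 2 + (∫ x in W, sinWave k (r • x)) ^ 2 =
      ‖∫ x in W, Complex.exp (-Complex.I * ((inner ℝ ((2 * Real.pi * r) • k) x : ℝ) : ℂ))‖ ^ 2 := by
    have : IsFiniteMeasure (volume.restrict W) := ⟨by simpa using hW.volume_lt_top⟩
    have hs : ∀ x : Space d, Complex.exp (-Complex.I *
        ((inner ℝ ((2 * Real.pi * r) • k) x : ℝ) : ℂ)) =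
        ((cosWave k (r • x) : ℝ) : ℂ) - ((sinWave k (r • x) : ℝ) : ℂ) * Complex.I := fun x => by
      have e : 2 * Real.pi * r * inner ℝ k x = 2 * Real.pi * (r * inner ℝ k x) := by ring
      rw [show -Complex.I * ((inner ℝ ((2 * Real.pi * r) • k) x : ℝ) : ℂ) =
        ((-(inner ℝ ((2 * Real.pi * r) • k) x) : ℝ) : ℂ) * Complex.I by push_cast; ring,
        Complex.exp_mul_I, ← Complex.ofReal_cos, ← Complex.ofReal_sin, Real.cos_neg, Real.sin_neg,
        cosWave, sinWave, real_inner_smul_left, real_inner_smul_right, e]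
      push_cast
      ring
    have c1 : Continuous fun x : Space d => cosWave k (r • x) :=
      (continuous_cosWave_right k).comp (by fun_prop)
    have c2 : Continuous fun x : Space d => sinWave k (r • x) :=
      (continuous_sinWave_right k).comp (by fun_prop)
    have i1 : Integrable (fun x => cosWave k (r • x)) (volume.restrict W) :=
      Integrable.of_bound c1.aestronglyMeasurable 1 (ae_of_all _ fun x => abs_cosWave_le k _)
    have i2 : Integrable (fun x => sinWave k (r • x)) (volume.restrict W) :=
      Integrable.of_bound c2.aestronglyMeasurable 1 (ae_of_all _ fun x => abs_sinWave_le k _)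
    simp only [hs]
    rw [integral_sub i1.ofReal (i2.ofReal.mul_const _), integral_mul_const,
      integral_complex_ofReal, integral_complex_ofReal, ← Complex.normSq_eq_norm_sq,
      Complex.normSq_apply]
    simp
    ring
  have hb := h ((2 * Real.pi * r) • k)
  rw [norm_smul, Real.norm_of_nonneg (by positivity)] at hb
  have hX : (0 : ℝ) < 1 + 2 * Real.pi * r * ‖k‖ := by positivity
  have hsq := pow_le_pow_left₀ (norm_nonneg _) hb 2
  rw [← hF, mul_pow, ← Real.rpow_natCast (_ ^ (_ : ℝ)) 2, ← Real.rpow_mul hX.le,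
    Nat.cast_ofNat, div_mul_cancel₀ _ (two_ne_zero' ℝ)] at hsq
  have hV : 0 < (volume W).toReal := ENNReal.toReal_pos hW.volume_pos.ne' hW.volume_lt_top.ne
  rw [(hW.smul hr).windowSpectrum_eq, hcs, hcs, hvol, mul_pow, mul_pow, ← mul_add,
    div_le_iff₀ (by positivity)]
  calc (r ^ d) ^ 2 * ((∫ x in W, cosWave k (r • x)) ^ 2 + (∫ x in W, sinWave k (r • x)) ^ 2)
      ≤ (r ^ d) ^ 2 * (c ^ 2 * (1 + 2 * Real.pi * r * ‖k‖) ^ (-((d : ℝ) + ϑ))) := by gcongr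
    _ = _ := by field_simp

end WindowSpectrum

section SpectralComparison

variable {Ω : Type*} [MeasurableSpace Ω] {d : ℕ} {P : Measure Ω} {Φ : Ω → Measure (Space d)}
  {W B : Set (Space d)}

/-- The periodogram of the covariance measure, tapered by the normalized covariogram of `B`. -/
noncomputable def periodogram (P : Measure Ω) (Φ : Ω → Measure (Space d)) (B : Set (Space d))
    (k : Space d) : ℝ :=
  cosTransform (covWeighted (reducedSecondMoment P Φ) B) k -
    intensity P Φ ^ 2 * cosTransform (covWeighted volume B) k

lemma IsStationarySqRandomMeasure.isFiniteMeasure_covWeighted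
    (hΦ : IsStationarySqRandomMeasure P Φ) (hB : IsWindow B) :
    IsFiniteMeasure (covWeighted (reducedSecondMoment P Φ) B) :=
  isFiniteMeasure_withDensity
    (hΦ.lintegral_normCov_lt_top hB.measurableSet hB.isBounded hB.volume_pos.ne').ne

lemma IsStationarySqRandomMeasure.periodogram_nonneg [IsProbabilityMeasure P]
    (hΦ : IsStationarySqRandomMeasure P Φ) (hB : IsWindow B) (k : Space d) :
    0 ≤ periodogram P Φ B k := by
  rw [periodogram, cosTransform_covWeighted _ hB.measurableSet,
    cosTransform_covWeighted _ hB.measurableSet]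
  have h := hΦ.integral_covariogram_mul_cosWave_le hB.measurableSet hB.isBounded k
  have h2 : 0 ≤ (volume B).toReal⁻¹ := by positivity
  nlinarith [mul_le_mul_of_nonneg_left h h2]

lemma IsStationarySqRandomMeasure.continuous_periodogram
    (hΦ : IsStationarySqRandomMeasure P Φ) (hB : IsWindow B) :
    Continuous (periodogram P Φ B) := by
  have := hΦ.isFiniteMeasure_covWeighted hB
  have := hB.isFiniteMeasure_covWeighted
  exact (continuous_cosTransform _).sub ((continuous_cosTransform _).const_mul _)

lemma IsStationarySqRandomMeasure.integral_mul_periodogram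
    (hΦ : IsStationarySqRandomMeasure P Φ) (hB : IsWindow B) {q h : Space d → ℝ}
    (hq : Integrable q) (hh : ∀ u, h u = ∫ k, q k * cosWave k u) :
    Integrable (fun k => q k * periodogram P Φ B k) ∧
    ∫ k, q k * periodogram P Φ B k =
      ∫ u, (normCov B u).toReal * h u ∂reducedSecondMoment P Φ -
        intensity P Φ ^ 2 * ∫ u, (normCov B u).toReal * h u := by
  have := hΦ.isFiniteMeasure_covWeighted hB
  have := hB.isFiniteMeasure_covWeighted
  have i : ∀ (μ : Measure (Space d)) [IsFiniteMeasure μ],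
      Integrable fun k => q k * cosTransform μ k := fun μ _ =>
    hq.mul_bdd (c := μ.real Set.univ) (continuous_cosTransform μ).aestronglyMeasurable
      (ae_of_all _ fun k => abs_cosTransform_le μ k)
  have e : ∀ k, q k * periodogram P Φ B k =
      q k * cosTransform (covWeighted (reducedSecondMoment P Φ) B) k -
      intensity P Φ ^ 2 * (q k * cosTransform (covWeighted volume B) k) := fun k => by
    rw [periodogram]; ring
  simp only [e]
  refine ⟨(i _).sub ((i _).const_mul _), ?_⟩
  rw [integral_sub (i _) ((i _).const_mul _), integral_const_mul,
    ← integral_integral_mul_cosWave _ hq, ← integral_integral_mul_cosWave _ hq,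
    ← integral_covWeighted _ hB.measurableSet, ← integral_covWeighted _ hB.measurableSet]
  simp only [hh]

/-- The periodograms are translation bounded, uniformly in the taper. -/
lemma IsStationarySqRandomMeasure.exists_lintegral_gaussWeight_mul_periodogram_le
    [IsProbabilityMeasure P] (hΦ : IsStationarySqRandomMeasure P Φ) :
    ∃ C : ℝ≥0∞, C < ∞ ∧ ∀ B : Set (Space d), IsWindow B → ∀ k₀,
      ∫⁻ k, ENNReal.ofReal (gaussWeight (k - k₀)) * ENNReal.ofReal (periodogram P Φ B k) ≤ C := by
  have := hΦ.sigmaFinite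
  obtain ⟨C, hC, hCb⟩ := hΦ.exists_forall_closedBall_le 1
  have hgα := integrable_gaussWeight_of_closedBall_le _ hC hCb
  have hgv := integrable_gaussWeight (d := d)
  refine ⟨ENNReal.ofReal (∫ u, gaussWeight u ∂reducedSecondMoment P Φ +
    intensity P Φ ^ 2 * ∫ u, gaussWeight (d := d) u), ENNReal.ofReal_lt_top, fun B hB k₀ => ?_⟩
  have hgk : Integrable fun k => gaussWeight (k - k₀) := hgv.comp_sub_right k₀
  obtain ⟨hi, he⟩ := hΦ.integral_mul_periodogram hB hgk
    (fun u => (integral_gaussWeight_sub_mul_cosWave k₀ u).symm)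
  simp only [← ENNReal.ofReal_mul (gaussWeight_pos _).le]
  rw [← ofReal_integral_eq_lintegral_ofReal hi (ae_of_all _ fun k =>
    mul_nonneg (gaussWeight_pos _).le (hΦ.periodogram_nonneg hB k)), he]
  refine ENNReal.ofReal_le_ofReal ?_
  have key : ∀ α : Measure (Space d), Integrable gaussWeight α →
      |∫ u, (normCov B u).toReal * (cosWave k₀ u * gaussWeight u) ∂α| ≤
        ∫ u, gaussWeight u ∂α := by
    intro α hα
    rw [← Real.norm_eq_abs]
    refine norm_integral_le_of_norm_le hα (ae_of_all _ fun u => ?_)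
    rw [norm_mul, norm_mul, Real.norm_of_nonneg ENNReal.toReal_nonneg,
      Real.norm_of_nonneg (gaussWeight_pos u).le, ← mul_assoc]
    refine mul_le_of_le_one_left (gaussWeight_pos u).le ?_
    exact mul_le_one₀ (toReal_normCov_le_one _ _) (norm_nonneg _) (abs_cosWave_le _ _)
  have h1 := (abs_le.1 (key _ hgα)).2
  have h2 := (abs_le.1 (key _ hgv)).1
  have h3 := mul_le_mul_of_nonneg_left h2 (sq_nonneg (intensity P Φ))
  linarith

lemma IsStationarySqRandomMeasure.exists_integral_rpow_mul_periodogram_le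
    [IsProbabilityMeasure P] (hΦ : IsStationarySqRandomMeasure P Φ) {s : ℝ} (hs : (d : ℝ) < s) :
    ∃ C : ℝ, ∀ B : Set (Space d), IsWindow B →
      Integrable (fun k => (1 + ‖k‖) ^ (-s) * periodogram P Φ B k) ∧
      ∫ k, (1 + ‖k‖) ^ (-s) * periodogram P Φ B k ≤ C := by
  obtain ⟨C, hC, hCB⟩ := hΦ.exists_lintegral_gaussWeight_mul_periodogram_le
  have hs0 : 0 ≤ s := (Nat.cast_nonneg d).trans hs.le
  set V := volume (Metric.closedBall (0 : Space d) 1) with hV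
  have hV0 : V ≠ 0 := (Metric.measure_closedBall_pos volume _ one_pos).ne'
  have hVt : V ≠ ∞ := measure_closedBall_lt_top.ne
  set K := ENNReal.ofReal (2 ^ s) * (ENNReal.ofReal (Real.exp Real.pi) * C) *
    ∫⁻ x : Space d, decayWeight s x with hK
  have hKt : K < ∞ := ENNReal.mul_lt_top (ENNReal.mul_lt_top ENNReal.ofReal_lt_top
    (ENNReal.mul_lt_top ENNReal.ofReal_lt_top hC)) (lintegral_decayWeight_lt_top hs)
  refine ⟨(K / V).toReal, fun B hB => ?_⟩
  have hc := hΦ.continuous_periodogram hB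
  have hpm : Measurable fun k => ENNReal.ofReal (periodogram P Φ B k) :=
    hc.measurable.ennreal_ofReal
  set ν : Measure (Space d) := volume.withDensity fun k => ENNReal.ofReal (periodogram P Φ B k)
  have hνb : ∀ v, ν (Metric.closedBall v 1) ≤ ENNReal.ofReal (Real.exp Real.pi) * C := fun v => by
    refine (measure_closedBall_le_lintegral_gaussWeight ν v).trans ?_
    gcongr
    have hg : Measurable fun k : Space d => ENNReal.ofReal (gaussWeight (k - v)) :=
      (continuous_gaussWeight.measurable.comp (measurable_sub_const v)).ennreal_ofReal
    rw [lintegral_withDensity_eq_lintegral_mul _ hpm hg]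
    refine le_trans (le_of_eq (lintegral_congr fun k => ?_)) (hCB B hB v)
    rw [Pi.mul_apply, mul_comm]
  have h1 : ∫⁻ k, decayWeight s k ∂ν ≤ K / V := by
    rw [ENNReal.le_div_iff_mul_le (Or.inl hV0) (Or.inl hVt)]
    exact lintegral_decayWeight_le ν hνb hs0
  have h2 : ∫⁻ k, decayWeight s k ∂ν =
      ∫⁻ k, ENNReal.ofReal ((1 + ‖k‖) ^ (-s) * periodogram P Φ B k) := by
    rw [lintegral_withDensity_eq_lintegral_mul _ hpm (measurable_decayWeight s)]
    refine lintegral_congr fun k => ?_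
    rw [Pi.mul_apply, decayWeight, ← ENNReal.ofReal_mul (hΦ.periodogram_nonneg hB k), mul_comm]
  have hnn : ∀ k, 0 ≤ (1 + ‖k‖) ^ (-s) * periodogram P Φ B k := fun k =>
    mul_nonneg (by positivity) (hΦ.periodogram_nonneg hB k)
  have hm : AEStronglyMeasurable (fun k => (1 + ‖k‖) ^ (-s) * periodogram P Φ B k) volume := by
    have := hc.measurable
    exact Measurable.aestronglyMeasurable (by fun_prop)
  have hKV : K / V < ∞ := ENNReal.div_lt_top hKt.ne hV0
  refine ⟨⟨hm, ?_⟩, ?_⟩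
  · rw [hasFiniteIntegral_iff_ofReal (ae_of_all _ hnn), ← h2]
    exact h1.trans_lt hKV
  · rw [integral_eq_lintegral_of_nonneg_ae (ae_of_all _ hnn) hm, ← h2]
    exact ENNReal.toReal_mono hKV.ne h1

lemma IsWindow.tendsto_integral_normCov_mul (hW : IsWindow W) {α : Measure (Space d)}
    {h : Space d → ℝ} (hh : Integrable h α) :
    Tendsto (fun T : ℝ => ∫ u, (normCov (T • W) u).toReal * h u ∂α) atTop (𝓝 (∫ u, h u ∂α)) := by
  refine tendsto_integral_filter_of_dominated_convergence (fun u => ‖h u‖) ?_ ?_ hh.norm ?_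
  · exact Eventually.of_forall fun T => ((measurable_normCov
      (hW.measurableSet.const_smul₀ T)).ennreal_toReal.aestronglyMeasurable).mul
      hh.aestronglyMeasurable
  · refine Eventually.of_forall fun T => ae_of_all _ fun u => ?_
    rw [norm_mul, Real.norm_of_nonneg ENNReal.toReal_nonneg]
    exact mul_le_of_le_one_left (norm_nonneg _) (toReal_normCov_le_one _ _)
  · refine ae_of_all _ fun u => ?_
    have h1 := (ENNReal.tendsto_toReal ENNReal.one_ne_top).comp (hW.tendsto_normCov u)
    simpa using h1.mul_const (h u)

lemma IsStationarySqRandomMeasure.scaledVar_eq_integral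
    (hΦ : IsStationarySqRandomMeasure P Φ) (hW : IsWindow W) :
    Integrable (fun u => (normCov W u).toReal) (reducedSecondMoment P Φ) ∧
    scaledVar P Φ W = ∫ u, (normCov W u).toReal ∂reducedSecondMoment P Φ -
      intensity P Φ ^ 2 * ∫ u, (normCov W u).toReal := by
  have hm := (measurable_normCov hW.measurableSet).aemeasurable (μ := reducedSecondMoment P Φ)
  have hm' := (measurable_normCov hW.measurableSet).aemeasurable (μ := volume)
  have hv := lintegral_normCov_volume hW 0
  simp only [add_zero] at hv
  refine ⟨integrable_toReal_of_lintegral_ne_top hm (hΦ.lintegral_normCov_lt_top hW.measurableSet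
    hW.isBounded hW.volume_pos.ne').ne, ?_⟩
  rw [integral_toReal hm (ae_of_all _ fun u => (normCov_ne_top _ _).lt_top),
    integral_toReal hm' (ae_of_all _ fun u => (normCov_ne_top _ _).lt_top), hv, scaledVar]

/-- A spectral bound: if `windowSpectrum W k * (1 - η^(k))` is dominated by a small multiple of the
spectrum plus a decaying weight, then so is the effect of averaging over `η`. -/
lemma IsStationarySqRandomMeasure.integral_covDefect_le_of_spectrum [IsProbabilityMeasure P]
    (hΦ : IsStationarySqRandomMeasure P Φ) (hW : IsWindow W)
    (hq : Integrable (windowSpectrum W)) (η : Measure (Space d)) [IsProbabilityMeasure η]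
    (hη : η.map (fun w => -w) = η) {s C ε E : ℝ} (hE : 0 ≤ E)
    (hC : ∀ B : Set (Space d), IsWindow B →
      Integrable (fun k => (1 + ‖k‖) ^ (-s) * periodogram P Φ B k) ∧
      ∫ k, (1 + ‖k‖) ^ (-s) * periodogram P Φ B k ≤ C)
    (hbound : ∀ k, windowSpectrum W k * (1 - cosTransform η k) ≤
      ε * windowSpectrum W k + E * (1 + ‖k‖) ^ (-s)) :
    ∫ u, covDefect η W u ∂reducedSecondMoment P Φ ≤ ε * scaledVar P Φ W + E * C := by
  have hq' : Integrable fun k => windowSpectrum W k * (1 - cosTransform η k) := by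
    refine hq.mul_bdd (c := 2)
      (continuous_const.sub (continuous_cosTransform η)).aestronglyMeasurable
      (ae_of_all _ fun k => ?_)
    have := abs_le.1 (abs_cosTransform_le η k)
    simp only [probReal_univ] at this
    rw [Real.norm_eq_abs, abs_le]
    constructor <;> linarith [this.1, this.2]
  obtain ⟨hiα, hvar⟩ := hΦ.scaledVar_eq_integral hW
  have hdα := (hΦ.integral_covDefect η hW).1
  have hdv := integral_covDefect_volume η hW
  have key : ∀ᶠ T : ℝ in atTop,
      ∫ u, (normCov (T • W) u).toReal * covDefect η W u ∂reducedSecondMoment P Φ -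
        intensity P Φ ^ 2 * ∫ u, (normCov (T • W) u).toReal * covDefect η W u ≤
      ε * (∫ u, (normCov (T • W) u).toReal * (normCov W u).toReal ∂reducedSecondMoment P Φ -
        intensity P Φ ^ 2 * ∫ u, (normCov (T • W) u).toReal * (normCov W u).toReal) + E * C := by
    filter_upwards [eventually_gt_atTop 0] with T hT
    have hB := hW.smul hT
    obtain ⟨i1, e1⟩ := hΦ.integral_mul_periodogram hB hq' (hW.covDefect_eq_integral hq η hη)
    obtain ⟨i2, e2⟩ := hΦ.integral_mul_periodogram hB hq (hW.normCov_eq_integral hq)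
    obtain ⟨i3, e3⟩ := hC _ hB
    rw [← e1, ← e2, ← integral_const_mul]
    calc ∫ k, windowSpectrum W k * (1 - cosTransform η k) * periodogram P Φ (T • W) k
        ≤ ∫ k, (ε * (windowSpectrum W k * periodogram P Φ (T • W) k) +
          E * ((1 + ‖k‖) ^ (-s) * periodogram P Φ (T • W) k)) := by
          refine integral_mono i1 ((i2.const_mul ε).add (i3.const_mul E)) fun k => ?_
          have := mul_le_mul_of_nonneg_right (hbound k) (hΦ.periodogram_nonneg hB k)
          simp only
          linarith
      _ = (∫ k, ε * (windowSpectrum W k * periodogram P Φ (T • W) k)) +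
          E * ∫ k, (1 + ‖k‖) ^ (-s) * periodogram P Φ (T • W) k := by
          rw [integral_add (i2.const_mul ε) (i3.const_mul E), integral_const_mul E]
      _ ≤ _ := by gcongr
  have l1 := (hW.tendsto_integral_normCov_mul hdα).sub
    ((hW.tendsto_integral_normCov_mul hdv.1).const_mul (intensity P Φ ^ 2))
  have l2 := (((hW.tendsto_integral_normCov_mul hiα).sub
    ((hW.tendsto_integral_normCov_mul hW.integrable_toReal_normCov).const_mul
      (intensity P Φ ^ 2))).const_mul ε).add_const (E * C)
  have := le_of_tendsto_of_tendsto l1 l2 key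
  rwa [hdv.2, mul_zero, sub_zero, ← hvar] at this

lemma IsStationarySqRandomMeasure.exists_integral_covDefect_le [IsProbabilityMeasure P]
    (hΦ : IsStationarySqRandomMeasure P Φ) (hW : IsWindow W) (hF : IsFourierSmooth W)
    (η : Measure (Space d)) [IsProbabilityMeasure η] (hη : η.map (fun w => -w) = η)
    {ε : ℝ} (hε : 0 < ε) :
    ∃ e : ℝ → ℝ, Tendsto e atTop (𝓝 0) ∧ ∀ᶠ r : ℝ in atTop,
      ∫ u, covDefect η (r • W) u ∂reducedSecondMoment P Φ ≤
        ε * scaledVar P Φ (r • W) + e r := by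
  obtain ⟨c, ϑ, hc, hϑ, hF⟩ := hF
  set s : ℝ := d + ϑ with hs
  have hds : (d : ℝ) < s := by linarith
  have hs0 : 0 < s := (Nat.cast_nonneg d).trans_lt hds
  have hp := Real.pi_gt_three
  obtain ⟨C, hC⟩ := hΦ.exists_integral_rpow_mul_periodogram_le hds
  have hη0 : cosTransform η 0 = 1 := by simp [cosTransform, cosWave]
  obtain ⟨δ, hδ, hδε⟩ := Metric.continuousAt_iff.1
    ((continuous_cosTransform η).continuousAt (x := (0 : Space d))) ε hε
  set a : ℝ := δ / (1 + δ) with ha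
  have ha0 : 0 < a := by positivity
  set M : ℝ := c ^ 2 / (volume W).toReal with hM
  have hM0 : 0 ≤ M := by positivity
  refine ⟨fun r => 2 * M * a ^ (-s) * r ^ (-ϑ) * C, ?_, ?_⟩
  · have := ((tendsto_rpow_neg_atTop hϑ).const_mul (2 * M * a ^ (-s))).mul_const C
    simpa using this
  filter_upwards [eventually_ge_atTop 1] with r hr
  have hr0 : 0 < r := by linarith
  have hWr := hW.smul hr0
  have hdecay : ∀ k, windowSpectrum (r • W) k ≤
      M * r ^ d * (1 + 2 * Real.pi * r * ‖k‖) ^ (-s) :=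
    fun k => hW.windowSpectrum_smul_le hF hr0 k
  have hq : Integrable (windowSpectrum (r • W)) := by
    have hi := (integrable_one_add_norm (E := Space d) (μ := volume) (r := s)
      (by simpa using hds)).const_mul (M * r ^ d)
    refine hi.mono' hWr.continuous_windowSpectrum.aestronglyMeasurable (ae_of_all _ fun k => ?_)
    rw [Real.norm_of_nonneg (hWr.windowSpectrum_nonneg k)]
    refine (hdecay k).trans ?_
    have h1 : 1 + ‖k‖ ≤ 1 + 2 * Real.pi * r * ‖k‖ := by
      have : 1 ≤ 2 * Real.pi * r := by nlinarith
      nlinarith [norm_nonneg k]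
    exact mul_le_mul_of_nonneg_left
      (Real.rpow_le_rpow_of_nonpos (by positivity) h1 (by linarith)) (by positivity)
  refine hΦ.integral_covDefect_le_of_spectrum hWr hq η hη
    (E := 2 * M * a ^ (-s) * r ^ (-ϑ)) (by positivity) hC fun k => ?_
  have hnn := hWr.windowSpectrum_nonneg k
  have hct := abs_le.1 (abs_cosTransform_le η k)
  simp only [probReal_univ] at hct
  rcases lt_or_ge ‖k‖ δ with hk | hk
  · have h1 := hδε (x := k) (by rwa [dist_zero_right])
    rw [hη0, Real.dist_eq, abs_lt] at h1
    have h2 : windowSpectrum (r • W) k * (1 - cosTransform η k) ≤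
        windowSpectrum (r • W) k * ε := by
      gcongr
      linarith [h1.1]
    have h3 : 0 ≤ 2 * M * a ^ (-s) * r ^ (-ϑ) * (1 + ‖k‖) ^ (-s) := by positivity
    linarith
  · have h1 : a * r * (1 + ‖k‖) ≤ 1 + 2 * Real.pi * r * ‖k‖ := by
      have h2 : a * (1 + ‖k‖) ≤ ‖k‖ := by
        rw [ha, div_mul_eq_mul_div, div_le_iff₀ (by positivity)]
        nlinarith
      have h3 : r * (a * (1 + ‖k‖)) ≤ r * ‖k‖ := by gcongr
      have h4 : 0 ≤ r * ‖k‖ := by positivity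
      nlinarith
    have h2 : (1 + 2 * Real.pi * r * ‖k‖) ^ (-s) ≤
        a ^ (-s) * r ^ (-s) * (1 + ‖k‖) ^ (-s) := by
      rw [← Real.mul_rpow ha0.le hr0.le, ← Real.mul_rpow (by positivity) (by positivity)]
      exact Real.rpow_le_rpow_of_nonpos (by positivity) h1 (by linarith)
    have h3 : r ^ d * r ^ (-s) = r ^ (-ϑ) := by
      rw [← Real.rpow_natCast, ← Real.rpow_add hr0, hs]
      congr 1
      ring
    have h4 : windowSpectrum (r • W) k ≤ M * a ^ (-s) * r ^ (-ϑ) * (1 + ‖k‖) ^ (-s) := by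
      calc windowSpectrum (r • W) k ≤ M * r ^ d * (1 + 2 * Real.pi * r * ‖k‖) ^ (-s) := hdecay k
        _ ≤ M * r ^ d * (a ^ (-s) * r ^ (-s) * (1 + ‖k‖) ^ (-s)) := by gcongr
        _ = _ := by rw [← h3]; ring
    have h5 : windowSpectrum (r • W) k * (1 - cosTransform η k) ≤
        windowSpectrum (r • W) k * 2 := by
      gcongr
      linarith [hct.1]
    have h6 := mul_nonneg hε.le hnn
    linarith

end SpectralComparison

section Main

variable {Ω : Type*} [MeasurableSpace Ω] {d : ℕ} {P : Measure Ω} {Φ : Ω → Measure (Space d)}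
  {Z : Ω → Space d → Space d} {W : Set (Space d)}

lemma IsStationaryCadlagField.map_neg_diffLaw [IsProbabilityMeasure P]
    (hZ : IsStationaryCadlagField P Z) : (diffLaw P Z).map (fun w => -w) = diffLaw P Z := by
  have := Measure.isProbabilityMeasure_map (μ := P) (hZ.measurable_eval 0).aemeasurable
  have hsub : Measurable fun p : Space d × Space d => p.1 - p.2 := by fun_prop
  rw [diffLaw, Measure.map_map measurable_neg hsub]
  conv_rhs => rw [← Measure.prod_swap]
  rw [Measure.map_map hsub measurable_swap]
  congr 1
  ext1 p
  simp

lemma tendsto_scaledVar_iff [IsProbabilityMeasure P] (hΦ : IsStationarySqRandomMeasure P Φ)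
    (hW : IsWindow W) (v : ℝ≥0∞) :
    HasAsymptoticVariance P Φ W v ↔
      Tendsto (fun r : ℝ => ENNReal.ofReal (scaledVar P Φ (r • W))) atTop (𝓝 v) := by
  refine tendsto_congr' ?_
  filter_upwards [eventually_gt_atTop 0] with r hr
  exact (hΦ.scaledVar_eq (hW.smul hr)).2

lemma tendsto_displacedScaledVar_iff [IsProbabilityMeasure P]
    (hΦ : IsStationarySqRandomMeasure P Φ) (hZ : IsStationaryCadlagField P Z)
    (hindep : IndepFun Φ Z P)
    (hmix : ∫⁻ y, mixingCoeff P Z y ∂(reducedSecondMoment P Φ) < ∞)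
    (hW : IsWindow W) (v : ℝ≥0∞) :
    HasAsymptoticVariance P (displaced Φ Z) W v ↔
      Tendsto (fun r : ℝ => ENNReal.ofReal (displacedScaledVar P Φ Z (r • W))) atTop (𝓝 v) := by
  refine tendsto_congr' ?_
  filter_upwards [eventually_gt_atTop 0] with r hr
  exact (displacedScaledVar_eq hΦ hZ hindep hmix (hW.smul hr)).2

lemma hasAsymptoticVariance_zero_displaced [IsProbabilityMeasure P]
    (hΦ : IsStationarySqRandomMeasure P Φ) (hZ : IsStationaryCadlagField P Z)
    (hindep : IndepFun Φ Z P)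
    (hmix : ∫⁻ y, mixingCoeff P Z y ∂(reducedSecondMoment P Φ) < ∞)
    (hW : IsWindow W) (h : HasAsymptoticVariance P Φ W 0) :
    HasAsymptoticVariance P (displaced Φ Z) W 0 := by
  have := hZ.isProbabilityMeasure_diffLaw
  rw [tendsto_scaledVar_iff hΦ hW] at h
  rw [tendsto_displacedScaledVar_iff hΦ hZ hindep hmix hW]
  have hδ := hW.tendsto_lintegral_mixingDefect hZ hmix
  have hsum := h.add hδ
  rw [add_zero] at hsum
  refine tendsto_of_tendsto_of_tendsto_of_le_of_le' tendsto_const_nhds hsum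
    (Eventually.of_forall fun _ => zero_le) ?_
  filter_upwards [eventually_gt_atTop 0, hδ.eventually_lt_const ENNReal.zero_lt_top] with r hr hfin
  have h1 := abs_le.1 (abs_scaledVar_sub_le hΦ hZ hmix (hW.smul hr))
  have h2 := hΦ.integral_covDefect_nonneg (diffLaw P Z) (hW.smul hr)
  have h3 : displacedScaledVar P Φ Z (r • W) ≤ scaledVar P Φ (r • W) +
      (∫⁻ u, mixingDefect P Z (r • W) u ∂reducedSecondMoment P Φ).toReal := by linarith [h1.1]
  refine (ENNReal.ofReal_le_ofReal h3).trans ?_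
  rw [ENNReal.ofReal_add (hΦ.scaledVar_eq (hW.smul hr)).1 ENNReal.toReal_nonneg,
    ENNReal.ofReal_toReal hfin.ne]

lemma hasAsymptoticVariance_displaced_iff [IsProbabilityMeasure P]
    (hΦ : IsStationarySqRandomMeasure P Φ) (hZ : IsStationaryCadlagField P Z)
    (hindep : IndepFun Φ Z P)
    (hmix : ∫⁻ y, mixingCoeff P Z y ∂(reducedSecondMoment P Φ) < ∞)
    (hW : IsWindow W) (h : IsFourierSmooth W ∨ covarianceTotalVariation P Φ < ∞) (v : ℝ≥0∞) :
    HasAsymptoticVariance P Φ W v ↔ HasAsymptoticVariance P (displaced Φ Z) W v := by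
  have := hZ.isProbabilityMeasure_diffLaw
  have hδ : Tendsto (fun r : ℝ =>
      (∫⁻ u, mixingDefect P Z (r • W) u ∂reducedSecondMoment P Φ).toReal) atTop (𝓝 0) := by
    simpa [Function.comp_def] using (ENNReal.tendsto_toReal ENNReal.zero_ne_top).comp
      (hW.tendsto_lintegral_mixingDefect hZ hmix)
  have hdefect : ∀ ε > 0, ∃ e : ℝ → ℝ, Tendsto e atTop (𝓝 0) ∧ ∀ᶠ r : ℝ in atTop,
      ∫ u, covDefect (diffLaw P Z) (r • W) u ∂reducedSecondMoment P Φ ≤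
        ε * scaledVar P Φ (r • W) + e r := by
    intro ε hε
    rcases h with h | h
    · exact hΦ.exists_integral_covDefect_le hW h _ hZ.map_neg_diffLaw hε
    · refine ⟨_, hΦ.tendsto_integral_covDefect h (diffLaw P Z) hW, ?_⟩
      filter_upwards [eventually_gt_atTop 0] with r hr
      have := mul_nonneg hε.le (hΦ.scaledVar_eq (hW.smul hr)).1
      linarith
  rw [tendsto_scaledVar_iff hΦ hW, tendsto_displacedScaledVar_iff hΦ hZ hindep hmix hW]
  refine tendsto_ofReal_iff_of_comparison ?_ ?_ hδ ?_ (fun ε hε => ?_) v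
  · filter_upwards [eventually_gt_atTop 0] with r hr
    exact (hΦ.scaledVar_eq (hW.smul hr)).1
  · filter_upwards [eventually_gt_atTop 0] with r hr
    exact (displacedScaledVar_eq hΦ hZ hindep hmix (hW.smul hr)).1
  · filter_upwards [eventually_gt_atTop 0] with r hr
    have h1 := abs_le.1 (abs_scaledVar_sub_le hΦ hZ hmix (hW.smul hr))
    have h2 := hΦ.integral_covDefect_nonneg (diffLaw P Z) (hW.smul hr)
    linarith [h1.1]
  · obtain ⟨e, he, hle⟩ := hdefect ε hε
    refine ⟨_, by simpa using he.add hδ, ?_⟩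
    filter_upwards [eventually_gt_atTop 0, hle] with r hr h3
    have h1 := abs_le.1 (abs_scaledVar_sub_le hΦ hZ hmix (hW.smul hr))
    linarith [h1.2]

end Main

theorem theorem5p1 {Ω : Type*} [MeasurableSpace Ω] (P : Measure Ω) [IsProbabilityMeasure P]
    (d : ℕ) (Φ : Ω → Measure (Space d)) (hΦ : IsStationarySqRandomMeasure P Φ)
    (Z : Ω → Space d → Space d) (hZ : IsStationaryCadlagField P Z)
    (hindep : IndepFun Φ Z P)
    (hmix : ∫⁻ y, mixingCoeff P Z y ∂(reducedSecondMoment P Φ) < ∞) :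
    IsStationarySqRandomMeasure P (displaced Φ Z) ∧
    ∀ W : Set (Space d), IsWindow W →
      (IsHyperuniform P Φ W → IsHyperuniform P (displaced Φ Z) W) ∧
      ((IsFourierSmooth W ∨ covarianceTotalVariation P Φ < ∞) →
        ∀ v : ℝ≥0∞, HasAsymptoticVariance P Φ W v ↔
          HasAsymptoticVariance P (displaced Φ Z) W v) := by
  have hΓ := isStationarySqRandomMeasure_displaced hΦ hZ hindep hmix
  refine ⟨hΓ, fun W hW => ⟨fun h => ⟨hΓ, ?_⟩, fun h v => ?_⟩⟩
  · exact hasAsymptoticVariance_zero_displaced hΦ hZ hindep hmix hW h.asymptoticVariance_zero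
  · exact hasAsymptoticVariance_displaced_iff hΦ hZ hindep hmix hW h v
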